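/- All schemes are over $\mathbb{C}$. Let $Y$ be an irreducible projective curve with exactly one singular point, an ordinary node $p$; let $q:X\to Y$ be its normalization and $q^{-1}(p)=\{x_1,x_2\}$. Let $n\ge 1$, and let $Y_n=X\cup R$ be the nodal curve obtained from $X$ and a chain $R=R_1\cup\dots\cup R_n$, $R_i\cong\mathbb{P}^1$, whose nodes $p_1,\dots,p_{n+1}$ are $p_1$ (joining $x_1\in X$ with $R_1$), $p_{i+1}=R_i\cap R_{i+1}$ for $1\le i\le n-1$, and $p_{n+1}$ (joining $R_n$ with $x_2\in X$). The nodes $p_i,p_{i+1}$ are distinct points of $R_i$. Let $\pi_n:Y_n\to Y$ be the morphism which is $q$ on $X$ and contracts $R$ to $p$. A Gieseker bundle of rank $n$ on $Y_n$ is a vector bundle $\mathcal{E}$ of rank $n$ such that $(\pi_n)_*\mathcal{E}$ is torsion-free and, for each $i$, $\mathcal{E}|_{R_i}\cong\bigoplus_{j=1}^n\mathcal{O}(a_{ij})$ with all $a_{ij}\ge 0$ and some $a_{ij}>0$. Two Gieseker bundles $\mathcal{E},\mathcal{E}'$ on $Y_n$ are equivalent if there is an automorphism $\phi$ of $Y_n$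 with $\pi_n\circ\phi=\pi_n$ and $\mathcal{E}\cong\phi^*\mathcal{E}'$. For a Gieseker bundle $\mathcal{E}$ let $\mathcal{E}_{p_i}\xleftarrow{\,q_i\,}H^0(R_i,\mathcal{E}|_{R_i})\xrightarrow{\,q_{i+1}\,}\mathcal{E}_{p_{i+1}}$ be the evaluation maps. Transport a subspace $U\subseteq\mathcal{E}_{p_i}$ to the right by $U\mapsto q_{i+1}(q_i^{-1}(U))\subseteq\mathcal{E}_{p_{i+1}}$, and a subspace $U\subseteq\mathcal{E}_{p_{i+1}}$ to the left by $U\mapsto q_i(q_{i+1}^{-1}(U))\subseteq\mathcal{E}_{p_i}$. Put $V=\mathcal{E}|_X$. For $1\le i\le n$ let $G_i\subseteq V_{x_2}=\mathcal{E}_{p_{n+1}}$ be the subspace obtained by transporting $0\subseteq\mathcal{E}_{p_i}$ successively to the right up to $p_{n+1}$, and let $F_i\subseteq V_{x_1}=\mathcal{E}_{p_1}$ be the subspace obtained by transporting $0\subseteq\mathcal{E}_{p_{n+2-i}}$ successively to the left down to $p_1$. These are the full flags $F_\bullet$, $G_\bullet$ of the parabolic triple $(V,F_\bullet,G_\bullet)$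 of $\mathcal{E}$. Triples $(V,F_\bullet,G_\bullet)$ and $(V',F'_\bullet,G'_\bullet)$ are isomorphic if there is an isomorphism $\psi:V\to V'$ of vector bundles on $X$ with $\psi_{x_1}(F_i)=F'_i$ and $\psi_{x_2}(G_i)=G'_i$ for all $i$. Let $\mathcal{E}$ and $\mathcal{E}'$ be Gieseker bundles of rank $n$ on $Y_n$ whose parabolic triples $(V,F_\bullet,G_\bullet)$ and $(V',F'_\bullet,G'_\bullet)$ are isomorphic. Then $\mathcal{E}$ and $\mathcal{E}'$ are equivalent. -/

import Mathlib

open CategoryTheory AlgebraicGeometry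

noncomputable section

namespace Gieseker

/-! ### Points, fibres and evaluation of sections -/

/-- `Spec ℂ`. -/
abbrev pt : Scheme.{0} := Spec (CommRingCat.of ℂ)

/-- The fibre `M_s` of an `𝒪_S`-module `M` at a `ℂ`-point `s`, as a functor to complex vector
spaces: the global sections of `s^* M`. -/
def fiber {S : Scheme.{0}} (s : pt ⟶ S) : S.Modules ⥤ ModuleCat ℂ :=
  Scheme.Modules.pullback s ⋙ moduleSpecΓFunctor (R := CommRingCat.of ℂ)

/-- For `f : S ⟶ T`, the canonical identification of the fibre of `f^* M` at `s` with the fibre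
of `M` at the image point `t = f(s)`. -/
def fiberPullback {S T : Scheme.{0}} (f : S ⟶ T) (s : pt ⟶ S) (t : pt ⟶ T) (h : s ≫ f = t)
    (M : T.Modules) :
    (fiber s).obj ((Scheme.Modules.pullback f).obj M) ≅ (fiber t).obj M :=
  (moduleSpecΓFunctor (R := CommRingCat.of ℂ)).mapIso
    ((Scheme.Modules.pullbackComp s f).app M ≪≫ (Scheme.Modules.pullbackCongr h).app M)

/-- The complex vector space `H⁰(S, M)` for an `𝒪_S`-module `M` on a scheme `f : S ⟶ Spec ℂ`. -/
def H0 {S : Scheme.{0}} (f : S ⟶ pt) (M : S.Modules) : ModuleCat ℂ :=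
  (moduleSpecΓFunctor (R := CommRingCat.of ℂ)).obj ((Scheme.Modules.pushforward f).obj M)

/-- Evaluation `H⁰(S, M) → M_s` of global sections at a `ℂ`-point `s`. It is induced by the unit
`M → s_* s^* M`. -/
def evalAt {S : Scheme.{0}} (f : S ⟶ pt) (s : pt ⟶ S) (hs : s ≫ f = 𝟙 pt) (M : S.Modules) :
    H0 f M ⟶ (fiber s).obj M :=
  (moduleSpecΓFunctor (R := CommRingCat.of ℂ)).map
    ((Scheme.Modules.pushforward f).map
        ((Scheme.Modules.pullbackPushforwardAdjunction s).unit.app M) ≫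
      (Scheme.Modules.pushforwardComp s f).hom.app _ ≫
      (Scheme.Modules.pushforwardCongr hs).hom.app _ ≫
      (Scheme.Modules.pushforwardId pt).hom.app _)

/-! ### Vector bundles and torsion-free sheaves -/

/-- The sections `e j` of `M` over `U` form a frame: they induce an isomorphism
`𝒪_U^ι ≅ M|_U`. -/
def IsFrame {S : Scheme.{0}} (M : S.Modules) (U : S.Opens) {ι : Type} [Fintype ι]
    (e : ι → Γ(M, U)) : Prop :=
  ∀ (V : S.Opens) (h : V ≤ U), Function.Bijective
    (fun c : ι → Γ(S, V) => ∑ j, c j • (M.presheaf.map (homOfLE h).op (e j) : Γ(M, V)))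

/-- `M` is a vector bundle of rank `r`. -/
def IsVectorBundle {S : Scheme.{0}} (r : ℕ) (M : S.Modules) : Prop :=
  ∀ x : S, ∃ (U : S.Opens) (_ : x ∈ U) (e : Fin r → Γ(M, U)), IsFrame M U e

/-- A sheaf of modules on an integral scheme is torsion-free if no nonzero function kills a nonzero
section. -/
def IsTorsionFree {S : Scheme.{0}} (M : S.Modules) : Prop :=
  ∀ (U : S.Opens) (f : Γ(S, U)) (m : Γ(M, U)), f ≠ 0 → f • m = 0 → m = 0

/-! ### The projective line -/

section ProjectiveLine

attribute [local instance] MvPolynomial.gradedAlgebra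

/-- The standard grading of `ℂ[x₀, x₁]`. -/
abbrev grading : ℕ → Submodule ℂ (MvPolynomial (Fin 2) ℂ) :=
  MvPolynomial.homogeneousSubmodule (Fin 2) ℂ

/-- The projective line `ℙ¹ = Proj ℂ[x₀, x₁]`. -/
def P1 : Scheme.{0} := Proj grading

/-- The structure morphism `ℙ¹ ⟶ Spec ℂ`. -/
def P1.str : P1 ⟶ pt :=
  Proj.toSpecZero grading ≫ Spec.map (CommRingCat.ofHom (algebraMap ℂ (grading 0)))

/-- The standard chart `{xᵢ ≠ 0}`. -/
def P1.chart (i : Fin 2) : P1.Opens := Proj.basicOpen grading (MvPolynomial.X i)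

/-- The coordinate `t = x₁ / x₀` on the chart `{x₀ ≠ 0}`. -/
def P1.coord : Γ(P1, P1.chart 0) :=
  Proj.awayToSection grading (MvPolynomial.X 0)
    (HomogeneousLocalization.Away.mk grading (d := 1) (MvPolynomial.isHomogeneous_X ℂ 0) 1
      (MvPolynomial.X 1) (by simpa using MvPolynomial.isHomogeneous_X ℂ 1))

end ProjectiveLine

/-- `M ≅ ⨁ⱼ 𝒪(aⱼ)` on `ℙ¹`. The line bundle `𝒪(a)` has the frames `x₀ᵃ` on `{x₀ ≠ 0}` and `x₁ᵃ` on
`{x₁ ≠ 0}`, related by `x₁ᵃ = tᵃ x₀ᵃ` on the overlap. -/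
def SplitsAs {r : ℕ} (a : Fin r → ℕ) (M : P1.Modules) : Prop :=
  ∃ (e₀ : Fin r → Γ(M, P1.chart 0)) (e₁ : Fin r → Γ(M, P1.chart 1)),
    IsFrame M (P1.chart 0) e₀ ∧ IsFrame M (P1.chart 1) e₁ ∧
    ∀ j, (M.presheaf.map (homOfLE (inf_le_right : P1.chart 0 ⊓ P1.chart 1 ≤ _)).op (e₁ j) :
        Γ(M, P1.chart 0 ⊓ P1.chart 1)) =
      (P1.presheaf.map (homOfLE (inf_le_left : P1.chart 0 ⊓ P1.chart 1 ≤ _)).op P1.coord) ^ a j •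
        (M.presheaf.map (homOfLE (inf_le_left : P1.chart 0 ⊓ P1.chart 1 ≤ _)).op (e₀ j) :
          Γ(M, P1.chart 0 ⊓ P1.chart 1))

/-- A rank `r` bundle on `ℙ¹` is strictly positive if it is `⨁ⱼ 𝒪(aⱼ)` with all `aⱼ ≥ 0` and
some `aⱼ > 0`. -/
def IsStrictlyPositive (r : ℕ) (M : P1.Modules) : Prop :=
  ∃ a : Fin r → ℕ, SplitsAs a M ∧ ∃ j, 0 < a j

/-! ### Nodal curves and Gieseker curves -/

/-- A scheme over `ℂ` with two distinct marked `ℂ`-points. -/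
structure TwoPointed where
  C : Scheme.{0}
  str : C ⟶ pt
  s : pt ⟶ C
  t : pt ⟶ C
  s_str : s ≫ str = 𝟙 pt
  t_str : t ≫ str = 𝟙 pt
  s_ne_t : s ≠ t

/-- `Z` is the curve with nodes `p k` obtained from the disjoint union of the curves `C i` by
identifying transversally all marked points carrying the same label `k`: the marked points `s` and
`t` of `C i` carry the labels `σ i` and `τ i`. Every function on an open subset of `Z` is the same as
a family of functions on its inverse images in the curves `C i` whose values at marked points with
the same label agree. When each label is carried by exactly two marked points of smooth curves, the
`p k` are ordinary double points and `∐ C i ⟶ Z` is the normalization. -/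
structure IsNodalGluing {ι K : Type} (C : ι → TwoPointed) (σ τ : ι → K) {Z : Scheme.{0}}
    (ν : ∀ i, (C i).C ⟶ Z) (p : K → (pt ⟶ Z)) : Prop where
  finite : ∀ i, IsFinite (ν i)
  surjective : ∀ z : Z, ∃ (i : ι) (x : (C i).C), ν i x = z
  p_injective : Function.Injective p
  s_eq : ∀ i, (C i).s ≫ ν i = p (σ i)
  t_eq : ∀ i, (C i).t ≫ ν i = p (τ i)
  /-- the map to `Z` is injective away from the marked points -/
  injective : ∀ (i j : ι) (x : (C i).C) (y : (C j).C), ν i x = ν j y →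
    (⟨i, x⟩ : Σ i, (C i).C) = ⟨j, y⟩ ∨ (x ∈ Set.range (C i).s ∪ Set.range (C i).t)
  app_injective : ∀ (U : Z.Opens) (g g' : Γ(Z, U)),
    (∀ i, (ν i).app U g = (ν i).app U g') → g = g'
  exists_app_eq : ∀ (U : Z.Opens) (f : ∀ i, Γ((C i).C, ν i ⁻¹ᵁ U)) (c : K → Γ(pt, ⊤)),
    (∀ i (h : ⊤ ≤ (C i).s ⁻¹ᵁ ν i ⁻¹ᵁ U), (C i).s.appLE (ν i ⁻¹ᵁ U) ⊤ h (f i) = c (σ i)) →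
    (∀ i (h : ⊤ ≤ (C i).t ⁻¹ᵁ ν i ⁻¹ᵁ U), (C i).t.appLE (ν i ⁻¹ᵁ U) ⊤ h (f i) = c (τ i)) →
    ∃ g : Γ(Z, U), ∀ i, (ν i).app U g = f i

/-- An irreducible projective curve `Y` over `ℂ` with a single node, together with its
normalization `q : X ⟶ Y` and the two points `x₁ = X.s`, `x₂ = X.t` of `X` over the node. -/
structure NodalCurve where
  X : TwoPointed
  integral : IsIntegral X.C
  smooth : SmoothOfRelativeDimension 1 X.str
  proper : IsProper X.str
  Y : Scheme.{0}
  str : Y ⟶ pt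
  str_proper : IsProper str
  q : X.C ⟶ Y
  q_str : q ≫ str = X.str
  node : pt ⟶ Y
  gluing : IsNodalGluing (ι := Unit) (K := Unit) (fun _ => X) id id (fun _ => q) (fun _ => node)

/-- The components of a Gieseker curve: `X`, and the projective lines `Rᵢ` with marked points. -/
def components (X : TwoPointed) {k : ℕ} (a b : Fin k → (pt ⟶ P1))
    (ha : ∀ i, a i ≫ P1.str = 𝟙 pt) (hb : ∀ i, b i ≫ P1.str = 𝟙 pt) (hab : ∀ i, a i ≠ b i) :
    Option (Fin k) → TwoPointed
  | none => X
  | some i => ⟨P1, P1.str, a i, b i, ha i, hb i, hab i⟩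

/-- The inclusions of the components, as a family. -/
def inclusions {X : TwoPointed} {k : ℕ} {a b : Fin k → (pt ⟶ P1)}
    {ha : ∀ i, a i ≫ P1.str = 𝟙 pt} {hb : ∀ i, b i ≫ P1.str = 𝟙 pt} {hab : ∀ i, a i ≠ b i}
    {Z : Scheme.{0}} (jX : X.C ⟶ Z) (jR : Fin k → (P1 ⟶ Z)) :
    ∀ i, (components X a b ha hb hab i).C ⟶ Z
  | none => jX
  | some i => jR i

/-- A Gieseker curve `Y_k` over the nodal curve `Y`, with its morphism `π : Y_k ⟶ Y`: the union of
`X` and a chain `R = R₁ ∪ ⋯ ∪ R_k` of projective lines, with nodes `p₁, …, p_{k+1}` (`p 0, …, p k`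
below). The node `p₁` joins `x₁ ∈ X` and `R₁`, the node `p_{i+1}` joins `R_i` and `R_{i+1}`, and
`p_{k+1}` joins `R_k` and `x₂ ∈ X`. The points of `R_i` at its two nodes are `a i` and `b i`. The
morphism `π` is the normalization on `X` and contracts `R` to the node. -/
structure GiesekerCurve (Y : NodalCurve) (k : ℕ) where
  Z : Scheme.{0}
  π : Z ⟶ Y.Y
  a : Fin k → (pt ⟶ P1)
  b : Fin k → (pt ⟶ P1)
  a_str : ∀ i, a i ≫ P1.str = 𝟙 pt
  b_str : ∀ i, b i ≫ P1.str = 𝟙 pt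
  a_ne_b : ∀ i, a i ≠ b i
  jX : Y.X.C ⟶ Z
  jR : Fin k → (P1 ⟶ Z)
  p : Fin (k + 1) → (pt ⟶ Z)
  jX_π : jX ≫ π = Y.q
  jR_π : ∀ i, jR i ≫ π = P1.str ≫ Y.node
  gluing : IsNodalGluing (components Y.X a b a_str b_str a_ne_b)
    (fun o => o.elim 0 Fin.castSucc) (fun o => o.elim (Fin.last k) Fin.succ)
    (inclusions jX jR) p

namespace GiesekerCurve

variable {Y : NodalCurve} {k : ℕ} (Z : GiesekerCurve Y k)

lemma s_jX : Y.X.s ≫ Z.jX = Z.p 0 := Z.gluing.s_eq none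

lemma t_jX : Y.X.t ≫ Z.jX = Z.p (Fin.last k) := Z.gluing.t_eq none

lemma a_jR (i : Fin k) : Z.a i ≫ Z.jR i = Z.p i.castSucc := Z.gluing.s_eq (some i)

lemma b_jR (i : Fin k) : Z.b i ≫ Z.jR i = Z.p i.succ := Z.gluing.t_eq (some i)

/-! ### Gieseker bundles and their equivalence -/

/-- A Gieseker vector bundle of rank `r` on `Y_k`: a vector bundle whose restriction to the chain
is strictly positive and whose direct image on `Y` is torsion-free. -/
structure IsGiesekerBundle (r : ℕ) (E : Z.Z.Modules) : Prop where
  isVectorBundle : IsVectorBundle r E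
  isStrictlyPositive :
    ∀ i, IsStrictlyPositive r ((Scheme.Modules.pullback (Z.jR i)).obj E)
  isTorsionFree : IsTorsionFree ((Scheme.Modules.pushforward Z.π).obj E)

/-- Equivalence of Gieseker bundles (families over a point): there is an isomorphism `φ` over `Y` of
the underlying curves with `E ≅ φ^* E'`. A line bundle pulled back from the base of the family is
trivial here. -/
def Equivalent {k' : ℕ} (Z : GiesekerCurve Y k) (E : Z.Z.Modules) (Z' : GiesekerCurve Y k')
    (E' : Z'.Z.Modules) : Prop :=
  ∃ φ : Z.Z ≅ Z'.Z, φ.hom ≫ Z'.π = Z.π ∧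
    Nonempty (E ≅ (Scheme.Modules.pullback φ.hom).obj E')

/-! ### The parabolic triple of a bundle on a Gieseker curve -/

variable (E : Z.Z.Modules)

/-- The space of sections `H⁰(R_i, E|_{R_i})`. -/
def sections (i : Fin k) : ModuleCat ℂ :=
  H0 P1.str ((Scheme.Modules.pullback (Z.jR i)).obj E)

/-- Evaluation `H⁰(R_i, E|_{R_i}) → E_{p_i}` at the first node of `R_i`. -/
def evalLeft (i : Fin k) : Z.sections E i ⟶ (fiber (Z.p i.castSucc)).obj E :=
  evalAt P1.str (Z.a i) (Z.a_str i) _ ≫ (fiberPullback (Z.jR i) _ _ (Z.a_jR i) E).hom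

/-- Evaluation `H⁰(R_i, E|_{R_i}) → E_{p_{i+1}}` at the second node of `R_i`. -/
def evalRight (i : Fin k) : Z.sections E i ⟶ (fiber (Z.p i.succ)).obj E :=
  evalAt P1.str (Z.b i) (Z.b_str i) _ ≫ (fiberPullback (Z.jR i) _ _ (Z.b_jR i) E).hom

/-- For `j ≥ i`, the subspace of `E_{p_j}` obtained from `0 ⊆ E_{p_i}` by transporting successively
along `R_i, …, R_{j-1}`, where a subspace `V ⊆ E_{p_j}` is transported to
`q_{j+1} (q_j⁻¹ V) ⊆ E_{p_{j+1}}` with `q_j`, `q_{j+1}` the evaluations of sections on `R_j`.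
(For `j < i` it is set to be zero.) -/
def transportRight (i : Fin (k + 1)) :
    ∀ j : Fin (k + 1), Submodule ℂ ((fiber (Z.p j)).obj E) :=
  Fin.induction ⊥ (fun j V =>
    if i ≤ j.castSucc then (V.comap (Z.evalLeft E j).hom).map (Z.evalRight E j).hom else ⊥)

/-- For `j ≤ i`, the subspace of `E_{p_j}` obtained from `0 ⊆ E_{p_i}` by transporting successively
along `R_{i-1}, …, R_j`. (For `j > i` it is set to be zero.) -/
def transportLeft (i : Fin (k + 1)) :
    ∀ j : Fin (k + 1), Submodule ℂ ((fiber (Z.p j)).obj E) :=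
  fun j => Fin.reverseInduction
    (motive := fun j : Fin (k + 1) => Submodule ℂ ((fiber (Z.p j)).obj E)) ⊥ (fun j V =>
      if j.succ ≤ i then (V.comap (Z.evalRight E j).hom).map (Z.evalLeft E j).hom else ⊥) j

end GiesekerCurve

/-- A triple `(V, F, G)` of a sheaf `V` on `X` and families of subspaces `F 0, …, F (n-1)` of the
fibre `V_{x₁}` and `G 0, …, G (n-1)` of the fibre `V_{x₂}`. -/
structure ParabolicTriple (X : TwoPointed) (n : ℕ) where
  V : X.C.Modules
  F : Fin n → Submodule ℂ ((fiber X.s).obj V)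
  G : Fin n → Submodule ℂ ((fiber X.t).obj V)

/-- Isomorphism of triples: an isomorphism `V ≅ V'` respecting both filtrations. -/
def ParabolicTriple.Isomorphic {X : TwoPointed} {n : ℕ} (T T' : ParabolicTriple X n) : Prop :=
  ∃ ψ : T.V ≅ T'.V,
    (∀ i, (T.F i).map ((fiber X.s).map ψ.hom).hom = T'.F i) ∧
    (∀ i, (T.G i).map ((fiber X.t).map ψ.hom).hom = T'.G i)

/-- The triple `(V, F, G)` induced on the normalization by `E` on `Y_n`: `V = E|_X`, and, with
one-based indices, `F_i ⊆ V_{x₁} = E_{p₁}` is the transport of `0 ⊆ E_{p_{n+2-i}}` to `p₁` and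
`G_i ⊆ V_{x₂} = E_{p_{n+1}}` is the transport of `0 ⊆ E_{p_i}` to `p_{n+1}`, for `i = 1, …, n`. -/
def GiesekerCurve.parabolicTriple {Y : NodalCurve} {n : ℕ} (Z : GiesekerCurve Y n)
    (E : Z.Z.Modules) : ParabolicTriple Y.X n where
  V := (Scheme.Modules.pullback Z.jX).obj E
  F i := (Z.transportLeft E i.rev.succ 0).comap (fiberPullback Z.jX _ _ Z.s_jX E).hom.hom
  G i := (Z.transportRight E i.castSucc (Fin.last n)).comap
    (fiberPullback Z.jX _ _ Z.t_jX E).hom.hom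

end Gieseker

end

/-! Restricted to the chain, a Gieseker bundle becomes linear algebra. Let `E k` be the fibre at the
`k`-th node (counted from 0), `H j` the space of sections on the `j`-th line, and `l j`, `r j` the
evaluations of `H j` at its two nodes. A family is a compatible choice of elements of all `E k` and
`H j`, that is, a section over the whole chain. Strict positivity makes `l j` and `r j` surjective
and `ker (l j)` nonzero. Torsion-freeness makes a family vanishing at both ends zero: extended by
zero to `X`, it would be a section of the direct image killed by a nonzero function on `Y` vanishing
at the node (`IsGiesekerBundle.eq_zero`).

Transporting 0 from the first node to the right raises the dimension by `dim ker (l j) ≥ 1` at each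
of the `n` links and ends in a space of dimension `n` (`finrank_chainRight`). So every kernel is a
line, 0 is transported to the whole last fibre, and a family is the same as its pair of end values
in `V_{x₁} ⊕ V_{x₂}` (`bijective_ends`). It vanishes at node `k` exactly when these end values lie
in the two subspaces transported from node `k`. Hence `E k` is the quotient of `V_{x₁} ⊕ V_{x₂}` by
members of the two flags, and `H j` is the quotient by the families vanishing at both nodes of the
line. An isomorphism of triples therefore induces isomorphisms of all `E k` and `H j` commuting with
evaluation (`IsGiesekerChain.exists_iso`).

On a single line, the one-dimensional kernels and the absence of nonzero sections vanishing at both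
nodes force `𝒪(1) ⊕ 𝒪ⁿ⁻¹` (`exists_eq_single`). The isomorphism of `H j` respects vanishing at each
node, so it multiplies the two sections of `𝒪(1)` vanishing at one node by scalars `α` and `β`. It
is induced by a map of bundles over the automorphism of the line which fixes both nodes and scales
by `β / α` (`exists_semiHom`); this is where equivalence is used instead of isomorphism over the
identity. These automorphisms and the identity of `X` glue to an automorphism over `Y`, and the maps
of bundles glue because they agree at the nodes (`IsNodalGluing.exists_iso`).

Modules are handled throughout by their sections: `pb` pulls sections back, `SemiHom` is a map of
modules over a morphism of schemes, and frames give coordinates in which gluing of sections becomes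
gluing of functions. -/

noncomputable section

namespace Gieseker

open TopologicalSpace Opposite

/-! ### Sections of sheaves of modules -/

section Sections

variable {S : Scheme.{0}} {M N K : S.Modules} {U V W : S.Opens}

/-- Restriction of functions. -/
def resF (h : V ≤ U) : Γ(S, U) →+* Γ(S, V) := (S.presheaf.map (homOfLE h).op).hom

/-- Restriction of sections. -/
def res (h : V ≤ U) : Γ(M, U) →+ Γ(M, V) := (M.presheaf.map (homOfLE h).op).hom

lemma resF_apply (h : V ≤ U) (g : Γ(S, U)) : resF h g = S.presheaf.map (homOfLE h).op g := rfl

lemma res_apply (h : V ≤ U) (m : Γ(M, U)) : res h m = M.presheaf.map (homOfLE h).op m := rfl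

@[simp] lemma resF_self (h : U ≤ U) (g : Γ(S, U)) : resF h g = g := by
  have : (homOfLE h) = 𝟙 U := rfl
  rw [resF_apply, this]; simp

@[simp] lemma res_self (h : U ≤ U) (m : Γ(M, U)) : res h m = m := by
  have : (homOfLE h) = 𝟙 U := rfl
  rw [res_apply, this]; simp

@[simp] lemma resF_resF (h : V ≤ U) (h' : W ≤ V) (g : Γ(S, U)) :
    resF h' (resF h g) = resF (h'.trans h) g := by
  rw [resF_apply, resF_apply, resF_apply, ← ConcreteCategory.comp_apply, ← Functor.map_comp]; rfl

@[simp] lemma res_res (h : V ≤ U) (h' : W ≤ V) (m : Γ(M, U)) :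
    res h' (res h m) = res (h'.trans h) m := by
  rw [res_apply, res_apply, res_apply, ← ConcreteCategory.comp_apply, ← Functor.map_comp]; rfl

@[simp] lemma res_smul (h : V ≤ U) (g : Γ(S, U)) (m : Γ(M, U)) :
    res h (g • m) = resF h g • res h m :=
  Scheme.Modules.map_smul M (homOfLE h) g m

lemma app_res (f : M ⟶ N) (h : V ≤ U) (m : Γ(M, U)) :
    f.app V (res h m) = res h (f.app U m) :=
  ConcreteCategory.congr_hom (f.mapPresheaf.naturality (homOfLE h).op) m

/-- A morphism of sheaves of modules from its action on sections. -/
def homMk (f : ∀ U, Γ(M, U) →+ Γ(N, U))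
    (hs : ∀ U (r : Γ(S, U)) (m : Γ(M, U)), f U (r • m) = r • f U m)
    (hr : ∀ {U V} (h : V ≤ U) (m : Γ(M, U)), f V (res h m) = res h (f U m)) : M ⟶ N :=
  ⟨{ app := fun U => ModuleCat.ofHom
      (X := M.val.obj U) (Y := N.val.obj U) { toFun := f U.unop, map_add' := map_add _, map_smul' := hs U.unop }
     naturality := by
      intro U V i
      ext m
      exact hr i.unop.le m }⟩

lemma hom_ext_sections {f g : M ⟶ N} (h : ∀ U (m : Γ(M, U)), f.app U m = g.app U m) : f = g := by
  ext U m
  exact h U m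

lemma existsUnique_glue {ι : Type} (V : ι → S.Opens) (hle : ∀ i, V i ≤ U) (hcov : U ≤ ⨆ i, V i)
    (m : ∀ i, Γ(M, V i))
    (hm : ∀ i j, res (inf_le_left : V i ⊓ V j ≤ V i) (m i) = res inf_le_right (m j)) :
    ∃! m' : Γ(M, U), ∀ i, res (hle i) m' = m i :=
  TopCat.Sheaf.existsUnique_gluing' (F := ⟨M.presheaf, M.isSheaf⟩) V U
    (fun i => homOfLE (hle i)) hcov m hm

lemma existsUnique_glueF {ι : Type} (V : ι → S.Opens) (hle : ∀ i, V i ≤ U) (hcov : U ≤ ⨆ i, V i)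
    (m : ∀ i, Γ(S, V i))
    (hm : ∀ i j, resF (inf_le_left : V i ⊓ V j ≤ V i) (m i) = resF inf_le_right (m j)) :
    ∃! m' : Γ(S, U), ∀ i, resF (hle i) m' = m i :=
  TopCat.Sheaf.existsUnique_gluing' (F := S.sheaf) V U
    (fun i => homOfLE (hle i)) hcov m hm

lemma section_ext {m m' : Γ(M, U)}
    (h : ∀ x ∈ U, ∃ (V : S.Opens) (hV : V ≤ U), x ∈ V ∧ res hV m = res hV m') : m = m' := by
  choose V hV hx hm using fun x : U => h x x.2
  refine (existsUnique_glue (M := M) V hV ?_ (fun x => res (hV x) m') ?_).unique hm fun _ => rfl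
  · intro x hxU
    exact Opens.mem_iSup.2 ⟨⟨x, hxU⟩, hx _⟩
  · intros; simp

lemma function_ext {m m' : Γ(S, U)}
    (h : ∀ x ∈ U, ∃ (V : S.Opens) (hV : V ≤ U), x ∈ V ∧ resF hV m = resF hV m') : m = m' := by
  choose V hV hx hm using fun x : U => h x x.2
  refine (existsUnique_glueF V hV ?_ (fun x => resF (hV x) m') ?_).unique hm fun _ => rfl
  · intro x hxU
    exact Opens.mem_iSup.2 ⟨⟨x, hxU⟩, hx _⟩
  · intros; simp

/-- A local property which locally has exactly one solution has a solution. -/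
lemma exists_section_of_local (P : ∀ V : S.Opens, V ≤ U → Γ(M, V) → Prop)
    (hP : ∀ V W (hV : V ≤ U) (h : W ≤ V) m, P V hV m → P W (h.trans hV) (res h m))
    (huniq : ∀ V hV m m', P V hV m → P V hV m' → m = m')
    (hex : ∀ x ∈ U, ∃ (V : S.Opens) (hV : V ≤ U), x ∈ V ∧ ∃ m, P V hV m)
    (hloc : ∀ m, (∀ x ∈ U, ∃ (V : S.Opens) (hV : V ≤ U), x ∈ V ∧ P V hV (res hV m)) →
      P U le_rfl m) :
    ∃ m, P U le_rfl m := by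
  choose V hV hx m hm using fun x : U => hex x x.2
  obtain ⟨m', hm', -⟩ := existsUnique_glue (M := M) (U := U) V hV
    (fun x hxU => Opens.mem_iSup.2 ⟨⟨x, hxU⟩, hx _⟩) m
    (fun i j => huniq _ (inf_le_left.trans (hV i)) _ _ (hP _ _ _ _ _ (hm i)) (hP _ _ _ _ _ (hm j)))
  exact ⟨m', hloc m' fun x hxU => ⟨V ⟨x, hxU⟩, hV _, hx _, by rw [hm']; exact hm _⟩⟩

lemma isIso_of_bijective (f : M ⟶ N) (h : ∀ U, Function.Bijective (f.app U)) : IsIso f :=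
  Scheme.Modules.Hom.isIso_iff_isIso_app.2 fun U =>
    (ConcreteCategory.isIso_iff_bijective (f.app U)).2 (h U)

end Sections

/-! ### Pullback of sections -/

section Pullback

variable {S T : Scheme.{0}} (f : S ⟶ T) {M N : T.Modules} {U V : T.Opens}

/-- The pullback of functions. -/
def pbF (U : T.Opens) : Γ(T, U) →+* Γ(S, f ⁻¹ᵁ U) := (f.app U).hom

/-- The pullback of sections. -/
def pb (U : T.Opens) : Γ(M, U) →+ Γ((Scheme.Modules.pullback f).obj M, f ⁻¹ᵁ U) :=
  (((Scheme.Modules.pullbackPushforwardAdjunction f).unit.app M).app U).hom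

lemma preimage_mono (h : V ≤ U) : f ⁻¹ᵁ V ≤ f ⁻¹ᵁ U := fun _ hx => h hx

lemma pbF_res (h : V ≤ U) (g : Γ(T, U)) :
    pbF f V (resF h g) = resF (preimage_mono f h) (pbF f U g) :=
  ConcreteCategory.congr_hom (f.naturality (homOfLE h).op) g

lemma pb_res (h : V ≤ U) (m : Γ(M, U)) :
    pb f V (res h m) = res (preimage_mono f h) (pb f U m) :=
  app_res ((Scheme.Modules.pullbackPushforwardAdjunction f).unit.app M) h m

lemma pb_smul (g : Γ(T, U)) (m : Γ(M, U)) :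
    pb f U (g • m) = pbF f U g • pb f U m :=
  Scheme.Modules.Hom.app_smul ((Scheme.Modules.pullbackPushforwardAdjunction f).unit.app M) g m

lemma pb_naturality (α : M ⟶ N) (m : Γ(M, U)) :
    ((Scheme.Modules.pullback f).map α).app (f ⁻¹ᵁ U) (pb f U m) = pb f U (α.app U m) := by
  have := (Scheme.Modules.pullbackPushforwardAdjunction f).unit.naturality α
  exact (ConcreteCategory.congr_hom (congr($(this).app U)) m).symm

/-- Under the adjunction, a map out of a pullback is determined by its composite with the unit,
which is its effect on pulled-back sections. -/
lemma pullback_hom_ext {P : S.Modules} {α β : (Scheme.Modules.pullback f).obj M ⟶ P}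
    (h : ∀ U (m : Γ(M, U)), α.app _ (pb f U m) = β.app _ (pb f U m)) : α = β := by
  apply ((Scheme.Modules.pullbackPushforwardAdjunction f).homEquiv _ _).injective
  apply hom_ext_sections
  intro U m
  simp only [Adjunction.homEquiv_unit]
  exact h U m

lemma exists_hom_pushforward {P : S.Modules} (F : ∀ V, Γ(M, V) →+ Γ(P, f ⁻¹ᵁ V))
    (hs : ∀ V (g : Γ(T, V)) m, F V (g • m) = pbF f V g • F V m)
    (hr : ∀ {V W : T.Opens} (h : W ≤ V) m, F W (res h m) = res (preimage_mono f h) (F V m)) :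
    ∃ α : M ⟶ (Scheme.Modules.pushforward f).obj P, ∀ V m,
      (α.app V m : Γ(P, f ⁻¹ᵁ V)) = F V m :=
  ⟨homMk (N := (Scheme.Modules.pushforward f).obj P) F (fun V g m => hs V g m)
    (fun h m => hr h m), fun _ _ => rfl⟩

/-- A map of modules over a morphism of schemes, as a family of maps on sections. -/
structure SemiHom (f : S ⟶ T) (M : T.Modules) (P : S.Modules) where
  app : ∀ V : T.Opens, Γ(M, V) →+ Γ(P, f ⁻¹ᵁ V)
  app_smul : ∀ V (g : Γ(T, V)) m, app V (g • m) = pbF f V g • app V m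
  app_res : ∀ {V W : T.Opens} (h : W ≤ V) m, app W (res h m) = res (preimage_mono f h) (app V m)

/-- A map of modules over a morphism of schemes from a functional relation on sections. -/
lemma SemiHom.exists_of_rel {P : S.Modules} (R : ∀ U : T.Opens, Γ(M, U) → Γ(P, f ⁻¹ᵁ U) → Prop)
    (hex : ∀ U m, ∃! n, R U m n)
    (hadd : ∀ U m m' n n', R U m n → R U m' n' → R U (m + m') (n + n'))
    (hsmul : ∀ U (r : Γ(T, U)) m n, R U m n → R U (r • m) (pbF f U r • n))
    (hres : ∀ {U V : T.Opens} (h : V ≤ U) m n, R U m n →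
      R V (res h m) (res (preimage_mono f h) n)) :
    ∃ θ : SemiHom f M P, ∀ U m, R U m (θ.app U m) :=
  ⟨{ app := fun U => AddMonoidHom.mk' (fun m => (hex U m).choose)
      (fun m m' => (hex U _).unique (hex U _).choose_spec.1
        (hadd _ _ _ _ _ (hex U m).choose_spec.1 (hex U m').choose_spec.1))
     app_smul := fun U _ m => (hex U _).unique (hex U _).choose_spec.1
      (hsmul _ _ _ _ (hex U m).choose_spec.1)
     app_res := fun h m => (hex _ _).unique (hex _ _).choose_spec.1
      (hres h _ _ (hex _ m).choose_spec.1) }, fun U m => (hex U m).choose_spec.1⟩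

lemma SemiHom.nonempty_iso {P : S.Modules} (θ : SemiHom f M P)
    (h : ∀ U, Function.Bijective (θ.app U)) :
    Nonempty (M ≅ (Scheme.Modules.pushforward f).obj P) := by
  obtain ⟨α, hα⟩ := exists_hom_pushforward f θ.app θ.app_smul θ.app_res
  have : IsIso α := isIso_of_bijective α fun U => by
    have := h U
    rwa [← show (fun m => (α.app U m : Γ(P, f ⁻¹ᵁ U))) = θ.app U from funext (hα U)] at this
  exact ⟨asIso α⟩

/-- The universal property of the pullback in terms of sections. It replaces any explicit
description of the sections of `f^* M`. -/
lemma exists_pullback_desc {P : S.Modules} (F : ∀ V, Γ(M, V) →+ Γ(P, f ⁻¹ᵁ V))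
    (hs : ∀ V (g : Γ(T, V)) m, F V (g • m) = pbF f V g • F V m)
    (hr : ∀ {V W : T.Opens} (h : W ≤ V) m, F W (res h m) = res (preimage_mono f h) (F V m)) :
    ∃ β : (Scheme.Modules.pullback f).obj M ⟶ P, ∀ U (m : Γ(M, U)),
      β.app _ (pb f U m) = F U m := by
  obtain ⟨α, hα⟩ := exists_hom_pushforward f F hs hr
  refine ⟨((Scheme.Modules.pullbackPushforwardAdjunction f).homEquiv _ _).symm α, fun U m => ?_⟩
  rw [← hα]
  have := ((Scheme.Modules.pullbackPushforwardAdjunction f).homEquiv _ _).apply_symm_apply α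
  conv_rhs => rw [← this]
  rw [Adjunction.homEquiv_unit]
  rfl

end Pullback

end Gieseker

end

noncomputable section

namespace Gieseker

open TopologicalSpace Opposite

/-! ### Frames -/

section Frames

variable {S T : Scheme.{0}} {M N : S.Modules} {U V W : S.Opens} {ι : Type} [Fintype ι]
  {e : ι → Γ(M, U)}

/-- Coordinates in a frame. -/
def IsFrame.repr (he : IsFrame M U e) (h : V ≤ U) : Γ(M, V) ≃ₗ[Γ(S, V)] (ι → Γ(S, V)) :=
  (LinearEquiv.ofBijective (Fintype.linearCombination Γ(S, V) (fun j => res h (e j))) (he V h)).symm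

lemma IsFrame.sum_repr (he : IsFrame M U e) (h : V ≤ U) (m : Γ(M, V)) :
    ∑ j, he.repr h m j • res h (e j) = m :=
  (he.repr h).symm_apply_apply m

lemma IsFrame.repr_sum (he : IsFrame M U e) (h : V ≤ U) (c : ι → Γ(S, V)) :
    he.repr h (∑ j, c j • res h (e j)) = c :=
  (he.repr h).apply_symm_apply c

lemma IsFrame.repr_self [DecidableEq ι] (he : IsFrame M U e) (h : V ≤ U) (j : ι) :
    he.repr h (res h (e j)) = Pi.single j 1 := by
  rw [← he.repr_sum h (Pi.single j 1)]
  simp [Pi.single_apply]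

lemma IsFrame.repr_res (he : IsFrame M U e) (h : V ≤ U) (h' : W ≤ V) (m : Γ(M, V)) (j : ι) :
    he.repr (h'.trans h) (res h' m) j = resF h' (he.repr h m j) := by
  have : res h' m = ∑ j, resF h' (he.repr h m j) • res (h'.trans h) (e j) := by
    conv_lhs => rw [← he.sum_repr h m]
    simp
  rw [this, he.repr_sum]

lemma IsFrame.ext (he : IsFrame M U e) (h : V ≤ U) {c c' : ι → Γ(S, V)}
    (hc : ∑ j, c j • res h (e j) = ∑ j, c' j • res h (e j)) : c = c' :=
  (he V h).1 hc

/-- The direct image of the restriction of a module to an open subset. -/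
def openExt (U : S.Opens) (N : S.Modules) : S.Modules :=
  (Scheme.Modules.pushforward U.ι).obj (N.restrict U.ι)

/-- The intersection with `U`. -/
abbrev cut (U V : S.Opens) : S.Opens := U.ι ''ᵁ U.ι ⁻¹ᵁ V

lemma cut_eq (U V : S.Opens) : cut U V = U ⊓ V := by
  ext x
  constructor
  · rintro ⟨y, hy, rfl⟩
    exact ⟨y.2, hy⟩
  · rintro ⟨h1, h2⟩
    exact ⟨⟨x, h1⟩, h2, rfl⟩

lemma cut_le (U V : S.Opens) : cut U V ≤ V := (cut_eq U V).le.trans inf_le_right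

lemma cut_le_left (U V : S.Opens) : cut U V ≤ U := (cut_eq U V).le.trans inf_le_left

lemma le_cut (h : V ≤ U) : V ≤ cut U V := (le_inf h le_rfl).trans (cut_eq U V).ge

lemma cut_mono (U : S.Opens) (h : W ≤ V) : cut U W ≤ cut U V := by
  rw [cut_eq, cut_eq]; exact inf_le_inf_left _ h

lemma openExt_smul (U : S.Opens) (N : S.Modules) (g : Γ(S, V)) (m : Γ(N, cut U V)) :
    @HSMul.hSMul Γ(S, V) Γ(openExt U N, V) Γ(openExt U N, V) _ g m =
      resF (cut_le U V) g • m := by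
  change (((U.ι.appIso _).inv.hom (U.ι.app V g)) • m : Γ(N, cut U V)) = _
  congr 1
  rw [resF_apply, Scheme.Opens.ι_appIso]
  rfl

lemma exists_hom_openExt (U : S.Opens) (F : ∀ V, Γ(M, V) →+ Γ(N, cut U V))
    (hs : ∀ V (g : Γ(S, V)) m, F V (g • m) = resF (cut_le U V) g • F V m)
    (hr : ∀ {V W : S.Opens} (h : W ≤ V) m, F W (res h m) = res (cut_mono U h) (F V m)) :
    ∃ α : M ⟶ openExt U N, ∀ V m, (α.app V m : Γ(N, cut U V)) = F V m :=
  ⟨homMk (N := openExt U N) F (fun V g m => (hs V g m).trans (openExt_smul U N g _).symm)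
    (fun h m => hr h m), fun _ _ => rfl⟩

end Frames

section FramePullback

variable {S T : Scheme.{0}} (f : S ⟶ T) {M : T.Modules} {U : T.Opens} {ι : Type} [Fintype ι]
  {e : ι → Γ(M, U)}

/-- The structure sheaf as a module over itself. -/
abbrev unitModule (S : Scheme.{0}) : S.Modules := SheafOfModules.unit S.ringCatSheaf

lemma unitModule_res {V W : S.Opens} (h : W ≤ V) (c : Γ(S, V)) :
    (res (M := unitModule S) h c : Γ(S, W)) = resF h c := rfl

lemma cut_preimage_le (V : T.Opens) : cut (f ⁻¹ᵁ U) (f ⁻¹ᵁ V) ≤ f ⁻¹ᵁ (U ⊓ V) :=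
  (cut_eq _ _).le

/-- The `j`-th coordinate is so far known only for sections of `M`. As a map from `M` to the direct
image of `𝒪` extended from `f⁻¹ U`, it factors through the pullback; the extension `openExt` makes
it defined on every open subset, as the universal property requires. -/
lemma IsFrame.exists_coord (he : IsFrame M U e) (j : ι) :
    ∃ κ : ∀ V, Γ((Scheme.Modules.pullback f).obj M, V) →+ Γ(S, cut (f ⁻¹ᵁ U) V),
      (∀ V (m : Γ(M, V)), κ _ (pb f V m) =
        resF (cut_preimage_le f V) (pbF f (U ⊓ V) (he.repr inf_le_left (res inf_le_right m) j))) ∧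
      (∀ V (g : Γ(S, V)) m, κ V (g • m) = resF (cut_le _ _) g * κ V m) ∧
      (∀ V W (h : W ≤ V) m, κ W (res h m) = resF (cut_mono _ h) (κ V m)) := by
  obtain ⟨κ, hκ⟩ := exists_pullback_desc f (M := M)
    (P := openExt (f ⁻¹ᵁ U) (unitModule S))
    (fun V => (((resF (cut_preimage_le f V)).comp (pbF f (U ⊓ V))).toAddMonoidHom.comp
      ((Pi.evalAddMonoidHom _ j).comp (he.repr inf_le_left).toLinearMap.toAddMonoidHom)).comp
      (res inf_le_right))
    (by
      intro V r m
      refine Eq.trans ?_ (openExt_smul (f ⁻¹ᵁ U) (unitModule S) (pbF f V r) _).symm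
      change resF _ (pbF f _ (he.repr inf_le_left (res inf_le_right (r • m)) j)) = _
      rw [res_smul, map_smul, Pi.smul_apply, smul_eq_mul, map_mul, map_mul, pbF_res, resF_resF]
      rfl)
    (by
      intro V W h m
      have h2 : U ⊓ W ≤ U ⊓ V := inf_le_inf_left _ h
      have := he.repr_res (inf_le_left : U ⊓ V ≤ U) h2 (res inf_le_right m) j
      rw [res_res] at this
      refine Eq.trans ?_ (unitModule_res (cut_mono _ (preimage_mono f h)) _).symm
      change resF _ (pbF f _ (he.repr inf_le_left (res inf_le_right (res h m)) j)) =
        resF _ (resF _ (pbF f _ (he.repr inf_le_left (res inf_le_right m) j)))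
      rw [res_res, resF_resF, this, pbF_res, resF_resF])
  exact ⟨fun V => (κ.app V).hom, hκ, fun V g m => (κ.app_smul g m).trans
    (openExt_smul (f ⁻¹ᵁ U) (unitModule S) g _), fun V W h m => app_res κ h m⟩

/-- The coordinate maps `κ j` are dual to the pulled-back frame. The identity `∑ κ j • e j = id` is
an equality of two maps out of a pullback, so it is enough to check it on pulled-back sections,
where it is the expansion in the original frame. -/
lemma IsFrame.pullback (he : IsFrame M U e) :
    IsFrame ((Scheme.Modules.pullback f).obj M) (f ⁻¹ᵁ U) (fun j => pb f U (e j)) := by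
  classical
  choose κ hκ hs hr using he.exists_coord f
  have key : ∀ (V : S.Opens) (m : Γ((Scheme.Modules.pullback f).obj M, V)),
      ∑ j, κ j V m • res (cut_le_left (f ⁻¹ᵁ U) V) (pb f U (e j)) = res (cut_le _ V) m := by
    obtain ⟨δ, hδ⟩ := exists_hom_openExt (M := (Scheme.Modules.pullback f).obj M)
      (N := (Scheme.Modules.pullback f).obj M) (f ⁻¹ᵁ U)
      (fun V => AddMonoidHom.mk' (fun m =>
        ∑ j, κ j V m • res (cut_le_left (f ⁻¹ᵁ U) V) (pb f U (e j)))
        (fun a b => by simp only [map_add, add_smul, Finset.sum_add_distrib]))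
      (fun V r m => by simp only [AddMonoidHom.mk'_apply, Finset.smul_sum, hs, mul_smul])
      (fun h m => by simp only [AddMonoidHom.mk'_apply, map_sum, hr, res_smul, res_res])
    obtain ⟨η, hη⟩ := exists_hom_openExt (M := (Scheme.Modules.pullback f).obj M)
      (N := (Scheme.Modules.pullback f).obj M) (f ⁻¹ᵁ U) (fun V => res (cut_le _ V))
      (fun V r m => res_smul _ _ _) (fun h m => by rw [res_res, res_res])
    have hδη : δ = η := by
      apply pullback_hom_ext
      intro V m
      refine (hδ _ _).trans (Eq.trans ?_ (hη _ _).symm)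
      rw [AddMonoidHom.mk'_apply]
      have h1 : res (cut_le (f ⁻¹ᵁ U) (f ⁻¹ᵁ V)) (pb f V m) =
          res (cut_preimage_le f V) (pb f (U ⊓ V) (res inf_le_right m)) := by
        rw [pb_res, res_res]
      conv_rhs => rw [h1, ← he.sum_repr inf_le_left (res inf_le_right m), map_sum, map_sum]
      refine Finset.sum_congr rfl fun j _ => ?_
      rw [pb_smul, res_smul, hκ, pb_res, res_res]
    intro V m
    exact (hδ V m).symm.trans (congr($(hδη).app V m).trans (hη V m))
  intro V h
  constructor
  · intro c c' hc
    have hcc : ∑ j, c j • res h (pb f U (e j)) = ∑ j, c' j • res h (pb f U (e j)) := hc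
    ext k
    have : ∀ c : ι → Γ(S, V), resF (le_cut h) (κ k V (∑ j, c j • res h (pb f U (e j)))) = c k := by
      intro c
      have h1 : ∀ j, κ k V (res h (pb f U (e j))) = if j = k then 1 else 0 := by
        intro j
        rw [hr, hκ, he.repr_self]
        by_cases hjk : j = k
        · subst hjk; simp
        · simp [hjk, Ne.symm hjk]
      simp [map_sum, hs, h1]
    rw [← this c, ← this c', hcc]
  · intro m
    refine ⟨fun j => resF (le_cut h) (κ j V m), ?_⟩
    change ∑ j, resF (le_cut h) (κ j V m) • res h (pb f U (e j)) = m
    have := congrArg (res (le_cut h)) (key V m)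
    rw [map_sum] at this
    simpa only [res_smul, res_res, res_self] using this

end FramePullback

end Gieseker

end

noncomputable section

namespace Gieseker

open TopologicalSpace Opposite

/-! ### Pulled-back sections along composites -/

section PullbackComp

variable {S T R : Scheme.{0}} (f : S ⟶ T) (g : T ⟶ R)

/-- The comparison isomorphism of pullbacks is the mate of the identification of direct images, so
it is compatible with the adjunction units. -/
lemma pullbackComp_pb (M : R.Modules) {U : R.Opens} (m : Γ(M, U)) :
    ((Scheme.Modules.pullbackComp f g).hom.app M).app (f ⁻¹ᵁ g ⁻¹ᵁ U) (pb f _ (pb g U m)) =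
      pb (f ≫ g) U m := by
  have h := unit_conjugateEquiv ((Scheme.Modules.pullbackPushforwardAdjunction g).comp
    (Scheme.Modules.pullbackPushforwardAdjunction f))
      (Scheme.Modules.pullbackPushforwardAdjunction (f ≫ g))
      (Scheme.Modules.pullbackComp f g).inv M
  rw [Scheme.Modules.conjugateEquiv_pullbackComp_inv] at h
  have h2 : pb f _ (pb g U m) = ((Scheme.Modules.pullbackComp f g).inv.app M).app
      (f ⁻¹ᵁ g ⁻¹ᵁ U) (pb (f ≫ g) U m) := congr($(h).app U m)
  rw [h2]
  exact congr(($((Scheme.Modules.pullbackComp f g).inv_hom_id_app M)).app (f ⁻¹ᵁ g ⁻¹ᵁ U)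
    (pb (f ≫ g) U m))

lemma pullbackCongr_pb {f f' : S ⟶ T} (h : f = f') (M : T.Modules) {U : T.Opens} (m : Γ(M, U)) :
    ((Scheme.Modules.pullbackCongr h).hom.app M).app (f ⁻¹ᵁ U) (pb f U m) =
      res (by rw [h]) (pb f' U m) := by
  subst h
  rw [res_self]
  rfl

lemma pbF_comp {U : R.Opens} (c : Γ(R, U)) : pbF (f ≫ g) U c = pbF f _ (pbF g U c) := rfl

end PullbackComp

/-! ### Values at points -/

section Values

variable {S T : Scheme.{0}} (s : pt ⟶ S) {M N : S.Modules} {U V : S.Opens}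

/-- The point `s` lies in `U`. -/
abbrev MemOpen (s : pt ⟶ S) (U : S.Opens) : Prop := (⊤ : pt.Opens) ≤ s ⁻¹ᵁ U

lemma memOpen_top {s : pt ⟶ S} : MemOpen s ⊤ := le_top

/-- The value of a function at a point. -/
def evF (U : S.Opens) (h : MemOpen s U) : Γ(S, U) →+* ℂ :=
  (Scheme.ΓSpecIso (CommRingCat.of ℂ)).hom.hom.comp ((resF h).comp (pbF s U))

/-- The value of a section at a point. -/
def val (U : S.Opens) (h : MemOpen s U) : Γ(M, U) →+ (fiber s).obj M :=
  (res h).comp (pb s U)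

lemma ΓSpecIso_bijective :
    Function.Bijective (Scheme.ΓSpecIso (CommRingCat.of ℂ)).hom :=
  (ConcreteCategory.isIso_iff_bijective _).1 inferInstance

lemma fiber_smul (c : ℂ) (x : Γ((Scheme.Modules.pullback s).obj M, ⊤)) :
    @HSMul.hSMul ℂ ((fiber s).obj M) ((fiber s).obj M) _ c x =
      (Scheme.ΓSpecIso (CommRingCat.of ℂ)).inv c • x := rfl

lemma val_smul (h : MemOpen s U) (g : Γ(S, U)) (m : Γ(M, U)) :
    val s U h (g • m) = evF s U h g • val s U h m := by
  refine Eq.trans ?_ (fiber_smul s _ _).symm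
  change res h (pb s U (g • m)) = (Scheme.ΓSpecIso (CommRingCat.of ℂ)).inv
    ((Scheme.ΓSpecIso (CommRingCat.of ℂ)).hom (resF h (pbF s U g))) • res h (pb s U m)
  rw [pb_smul, res_smul, ← ConcreteCategory.comp_apply, Iso.hom_inv_id]
  rfl

lemma evF_res (h : MemOpen s V) (hVU : V ≤ U) (g : Γ(S, U)) :
    evF s V h (resF hVU g) = evF s U (h.trans (preimage_mono s hVU)) g := by
  change (Scheme.ΓSpecIso (CommRingCat.of ℂ)).hom (resF _ (pbF s V (resF hVU g))) = _
  rw [pbF_res, resF_resF]; rfl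

lemma val_res (h : MemOpen s V) (hVU : V ≤ U) (m : Γ(M, U)) :
    val s V h (res hVU m) = val s U (h.trans (preimage_mono s hVU)) m := by
  change res h (pb s V (res hVU m)) = _
  rw [pb_res, res_res]; rfl

lemma fiber_map_val (α : M ⟶ N) (h : MemOpen s U) (m : Γ(M, U)) :
    (fiber s).map α (val s U h m) = val s U h (α.app U m) := by
  change ((Scheme.Modules.pullback s).map α).app ⊤ (res h (pb s U m)) = res h (pb s U (α.app U m))
  rw [app_res, pb_naturality]

lemma fiberPullback_val (f : T ⟶ S) (t : pt ⟶ T) (h : t ≫ f = s) (hU : MemOpen t (f ⁻¹ᵁ U))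
    (hU' : MemOpen s U) (m : Γ(M, U)) :
    (fiberPullback f t s h M).hom (val t (f ⁻¹ᵁ U) hU (pb f U m)) = val s U hU' m := by
  subst h
  change ((Scheme.Modules.pullbackCongr rfl).hom.app M).app ⊤
    (((Scheme.Modules.pullbackComp t f).hom.app M).app ⊤ (res hU (pb t _ (pb f U m)))) = _
  rw [app_res, pullbackComp_pb]
  change ((Scheme.Modules.pullbackCongr rfl).hom.app M).app ⊤ (res hU' (pb (t ≫ f) U m)) = _
  rw [app_res, pullbackCongr_pb, res_res]
  rfl

lemma evF_comp (f : T ⟶ S) (t : pt ⟶ T) (h : t ≫ f = s) (hU : MemOpen t (f ⁻¹ᵁ U))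
    (hU' : MemOpen s U) (g : Γ(S, U)) :
    evF t (f ⁻¹ᵁ U) hU (pbF f U g) = evF s U hU' g := by
  subst h; rfl

lemma moduleSpecΓFunctor_map_apply {P Q : pt.Modules} (α : P ⟶ Q) (x : Γ(P, ⊤)) :
    (moduleSpecΓFunctor (R := CommRingCat.of ℂ)).map α x = α.app ⊤ x := rfl

lemma evalAt_eq (f : S ⟶ pt) (hs : s ≫ f = 𝟙 pt) (m : Γ(M, ⊤)) :
    evalAt f s hs M m = val s ⊤ memOpen_top m := by
  refine (moduleSpecΓFunctor_map_apply _ _).trans ?_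
  rw [Scheme.Modules.Hom.comp_app, Scheme.Modules.Hom.comp_app, Scheme.Modules.Hom.comp_app,
    Scheme.Modules.pushforwardId_hom_app_app, Scheme.Modules.pushforwardCongr_hom_app_app,
    Scheme.Modules.pushforwardComp_hom_app_app]
  rfl

variable {ι : Type} [Fintype ι] {e : ι → Γ(M, U)}

/-- The frame pulled back to the point is a frame over `Spec ℂ`; only the scalars have to be
translated by `Scheme.ΓSpecIso`. -/
lemma IsFrame.bijective_val (he : IsFrame M U e) (h : MemOpen s U) :
    Function.Bijective (fun c : ι → ℂ => ∑ j, c j • val s U h (e j)) := by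
  have h1 := (he.pullback s) ⊤ h
  have h2 : Function.Bijective (fun c : ι → ℂ =>
      fun j => (Scheme.ΓSpecIso (CommRingCat.of ℂ)).inv (c j)) := by
    have : Function.Bijective (Scheme.ΓSpecIso (CommRingCat.of ℂ)).inv :=
      (ConcreteCategory.isIso_iff_bijective _).1 inferInstance
    exact ⟨this.1.comp_left, this.2.comp_left⟩
  exact h1.comp h2

/-- The basis of a fibre given by a frame. -/
def IsFrame.fiberBasis (he : IsFrame M U e) (h : MemOpen s U) :
    Module.Basis ι ℂ ((fiber s).obj M) :=
  Module.Basis.ofEquivFun (LinearEquiv.ofBijective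
    (Fintype.linearCombination ℂ (fun j => val s U h (e j))) (he.bijective_val s h)).symm

lemma IsFrame.fiberBasis_apply (he : IsFrame M U e) (h : MemOpen s U) (j : ι) :
    he.fiberBasis s h j = val s U h (e j) := by
  classical
  simp only [fiberBasis, Module.Basis.coe_ofEquivFun, LinearEquiv.symm_symm]
  exact (Fintype.linearCombination_apply_single ℂ (fun j => val s U h (e j)) j (1 : ℂ)).trans
    (one_smul _ _)

end Values

end Gieseker

end

noncomputable section

namespace Gieseker

open TopologicalSpace Opposite

/-! ### Values of sections of a pullback in the fibre at the image point -/

section PointPullback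

variable {S T : Scheme.{0}} {M : S.Modules} {U V : S.Opens} {s : pt ⟶ S} {t : pt ⟶ T} {f : T ⟶ S}
  {ι : Type} [Fintype ι] {e : ι → Γ(M, U)}

lemma memOpen_iff (h : t ≫ f = s) : MemOpen t (f ⁻¹ᵁ U) ↔ MemOpen s U := by
  subst h; rfl

/-- The value at `t` of a section of a pullback, in the fibre at the image point. The definition is
sealed by `Exists.choose`, so that proofs are not checked by unfolding `fiberPullback`. -/
def pval (h : t ≫ f = s) (V : T.Opens) (hV : MemOpen t V) :
    Γ((Scheme.Modules.pullback f).obj M, V) →+ (fiber s).obj M :=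
  (⟨_, rfl⟩ : ∃ F : Γ((Scheme.Modules.pullback f).obj M, V) →+ (fiber s).obj M,
    F = (fiberPullback f t s h M).hom.hom.toAddMonoidHom.comp (val t V hV)).choose

lemma pval_apply (h : t ≫ f = s) {V : T.Opens} (hV : MemOpen t V)
    (m : Γ((Scheme.Modules.pullback f).obj M, V)) :
    pval h V hV m = (fiberPullback f t s h M).hom (val t V hV m) :=
  DFunLike.congr_fun (⟨_, rfl⟩ : ∃ F : Γ((Scheme.Modules.pullback f).obj M, V) →+ (fiber s).obj M,
    F = (fiberPullback f t s h M).hom.hom.toAddMonoidHom.comp (val t V hV)).choose_spec m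

lemma pval_smul (h : t ≫ f = s) {V : T.Opens} (hV : MemOpen t V) (g : Γ(T, V))
    (m : Γ((Scheme.Modules.pullback f).obj M, V)) :
    pval h V hV (g • m) = evF t V hV g • pval h V hV m := by
  rw [pval_apply, pval_apply, val_smul, map_smul]

lemma pval_res (h : t ≫ f = s) {V W : T.Opens} (hV : MemOpen t V) (hVW : V ≤ W)
    (m : Γ((Scheme.Modules.pullback f).obj M, W)) :
    pval h V hV (res hVW m) = pval h W (hV.trans (preimage_mono t hVW)) m := by
  rw [pval_apply, pval_apply, val_res]

lemma pval_pb (h : t ≫ f = s) (hV : MemOpen t (f ⁻¹ᵁ V)) (m : Γ(M, V)) :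
    pval h (f ⁻¹ᵁ V) hV (pb f V m) = val s V ((memOpen_iff h).1 hV) m :=
  (pval_apply h hV _).trans (fiberPullback_val s f t h hV _ m)

lemma IsFrame.pval_eq (he : IsFrame M U e) (h : t ≫ f = s) {V : T.Opens} (hVU : V ≤ f ⁻¹ᵁ U)
    (hV : MemOpen t V) (m : Γ((Scheme.Modules.pullback f).obj M, V)) (hU : MemOpen s U) :
    pval h V hV m = ∑ j, evF t V hV ((he.pullback f).repr hVU m j) • val s U hU (e j) := by
  conv_lhs => rw [← (he.pullback f).sum_repr hVU m]
  rw [map_sum]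
  refine Finset.sum_congr rfl fun j _ => ?_
  rw [pval_smul, pval_res, pval_pb]

lemma IsFrame.fiberBasis_repr_sum (he : IsFrame M U e) (hU : MemOpen s U) (c : ι → ℂ) :
    (he.fiberBasis s hU).equivFun (∑ j, c j • val s U hU (e j)) = c := by
  simp_rw [← he.fiberBasis_apply s hU]
  rw [← Module.Basis.equivFun_symm_apply, LinearEquiv.apply_symm_apply]

lemma IsFrame.evF_repr (he : IsFrame M U e) (h : t ≫ f = s) {V : T.Opens} (hVU : V ≤ f ⁻¹ᵁ U)
    (hV : MemOpen t V) (m : Γ((Scheme.Modules.pullback f).obj M, V)) (hU : MemOpen s U) (j : ι) :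
    evF t V hV ((he.pullback f).repr hVU m j) =
      (he.fiberBasis s hU).equivFun (pval h V hV m) j := by
  rw [he.pval_eq h hVU hV m hU, he.fiberBasis_repr_sum]

lemma repr_pb (he : IsFrame M U e) (h : V ≤ U) (m : Γ(M, V)) (j : ι) :
    (he.pullback f).repr (preimage_mono f h) (pb f V m) j = pbF f V (he.repr h m j) := by
  have : pb f V m = ∑ j, pbF f V (he.repr h m j) • res (preimage_mono f h) (pb f U (e j)) := by
    conv_lhs => rw [← he.sum_repr h m]
    rw [map_sum]
    exact Finset.sum_congr rfl fun j _ => by rw [pb_smul, pb_res]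
  rw [this, (he.pullback f).repr_sum]

end PointPullback

/-! ### Functions and sections of vector bundles on a nodal gluing -/

namespace IsNodalGluing

variable {ι K : Type} {C : ι → TwoPointed} {σ τ : ι → K} {Z : Scheme.{0}}
    {ν : ∀ i, (C i).C ⟶ Z} {p : K → (pt ⟶ Z)} (G : IsNodalGluing C σ τ ν p)
    {M N : Z.Modules} {U V : Z.Opens}
include G

lemma pbF_injective {g g' : Γ(Z, U)} (h : ∀ i, pbF (ν i) U g = pbF (ν i) U g') : g = g' :=
  G.app_injective U g g' h

lemma exists_function (f : ∀ i, Γ((C i).C, ν i ⁻¹ᵁ U)) (c : K → ℂ)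
    (hs : ∀ i (h : MemOpen (C i).s (ν i ⁻¹ᵁ U)), evF (C i).s _ h (f i) = c (σ i))
    (ht : ∀ i (h : MemOpen (C i).t (ν i ⁻¹ᵁ U)), evF (C i).t _ h (f i) = c (τ i)) :
    ∃ g : Γ(Z, U), ∀ i, pbF (ν i) U g = f i := by
  refine G.exists_app_eq U f (fun k => (Scheme.ΓSpecIso (CommRingCat.of ℂ)).inv (c k)) ?_ ?_
  · intro i h
    refine ΓSpecIso_bijective.1 ?_
    exact (hs i h).trans (Iso.inv_hom_id_apply (Scheme.ΓSpecIso (CommRingCat.of ℂ)) _).symm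
  · intro i h
    refine ΓSpecIso_bijective.1 ?_
    exact (ht i h).trans (Iso.inv_hom_id_apply (Scheme.ΓSpecIso (CommRingCat.of ℂ)) _).symm

/-- In a local frame this is the injectivity of the restriction of functions to the components,
applied to each coordinate. -/
lemma pb_injective {r : ℕ} (hM : IsVectorBundle r M) {m m' : Γ(M, U)}
    (h : ∀ i, pb (ν i) U m = pb (ν i) U m') : m = m' := by
  refine section_ext fun x hx => ?_
  obtain ⟨V, hV, e, he⟩ := hM x
  refine ⟨U ⊓ V, inf_le_left, ⟨hx, hV⟩, (he.repr inf_le_right).injective ?_⟩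
  ext j
  refine G.pbF_injective fun i => ?_
  rw [← repr_pb, ← repr_pb, pb_res, pb_res, h]

/-- The gluing axiom for functions, carried over to bundles. In a local frame, agreement in the
fibre at a node is agreement of coordinates, so the coordinates glue; the local solutions are unique
by `pb_injective` and hence glue as well. -/
lemma exists_section {r : ℕ} (hM : IsVectorBundle r M)
    (m : ∀ i, Γ((Scheme.Modules.pullback (ν i)).obj M, ν i ⁻¹ᵁ U)) (w : ∀ k, (fiber (p k)).obj M)
    (hs : ∀ i (h : MemOpen (C i).s (ν i ⁻¹ᵁ U)), pval (G.s_eq i) _ h (m i) = w (σ i))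
    (ht : ∀ i (h : MemOpen (C i).t (ν i ⁻¹ᵁ U)), pval (G.t_eq i) _ h (m i) = w (τ i)) :
    ∃ n : Γ(M, U), ∀ i, pb (ν i) U n = m i := by
  classical
  have := exists_section_of_local (M := M) (U := U)
    (fun V hV n => ∀ i, pb (ν i) V n = res (preimage_mono (ν i) hV) (m i))
    (fun V W hV h n hn i => by rw [pb_res, hn, res_res])
    (fun V hV n n' hn hn' => G.pb_injective hM fun i => (hn i).trans (hn' i).symm)
    (fun x hx => by
      obtain ⟨W, hW, e, he⟩ := hM x
      refine ⟨U ⊓ W, inf_le_left, ⟨hx, hW⟩, ?_⟩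
      let f : ∀ i, Fin r → Γ((C i).C, ν i ⁻¹ᵁ (U ⊓ W)) := fun i =>
        (he.pullback (ν i)).repr (preimage_mono (ν i) inf_le_right)
          (res (preimage_mono (ν i) inf_le_left) (m i))
      -- The default 0 is harmless: a label whose node lies outside `W` imposes no condition.
      let c : K → Fin r → ℂ := fun k => if hk : MemOpen (p k) W then
        (he.fiberBasis (p k) hk).equivFun (w k) else 0
      have hg : ∀ j, ∃ g : Γ(Z, U ⊓ W), ∀ i, pbF (ν i) _ g = f i j := by
        intro j
        refine G.exists_function (fun i => f i j) (fun k => c k j) ?_ ?_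
        · intro i h
          have hW' : MemOpen (p (σ i)) W :=
            ((memOpen_iff (G.s_eq i)).1 h).trans (preimage_mono _ inf_le_right)
          rw [he.evF_repr (G.s_eq i) _ h _ hW', pval_res, hs]
          simp only [c, dif_pos hW']
        · intro i h
          have hW' : MemOpen (p (τ i)) W :=
            ((memOpen_iff (G.t_eq i)).1 h).trans (preimage_mono _ inf_le_right)
          rw [he.evF_repr (G.t_eq i) _ h _ hW', pval_res, ht]
          simp only [c, dif_pos hW']
      choose g hg using hg
      refine ⟨∑ j, g j • res inf_le_right (e j), fun i => ?_⟩
      refine ((he.pullback (ν i)).repr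
        (preimage_mono (ν i) (inf_le_right : U ⊓ W ≤ W))).injective ?_
      ext j
      rw [repr_pb he inf_le_right, he.repr_sum, hg])
    (fun n hn i => by
      rw [res_self]
      refine section_ext fun x hx => ?_
      obtain ⟨V, hV, hxV, h⟩ := hn (ν i x) hx
      exact ⟨ν i ⁻¹ᵁ V, preimage_mono _ hV, hxV, by rw [← h i, pb_res]⟩)
  simpa only [res_self] using this

end IsNodalGluing

end Gieseker

end

/-! ### Points and morphisms of schemes, and descent of morphisms to a nodal gluing -/

noncomputable section

namespace Gieseker

open TopologicalSpace Opposite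

/-- The point of `Spec ℂ`. -/
def pt₀ : pt := IsLocalRing.closedPoint ℂ

instance : Subsingleton pt := inferInstanceAs (Subsingleton (PrimeSpectrum ℂ))

lemma memOpen_iff_mem {S : Scheme.{0}} {s : pt ⟶ S} {U : S.Opens} : MemOpen s U ↔ s pt₀ ∈ U :=
  ⟨fun h => h (x := pt₀) trivial, fun h y _ => by rw [Subsingleton.elim y pt₀]; exact h⟩

lemma exists_eq_fromSpecResidueField {Z : Scheme.{0}} (f : pt ⟶ Z) (x : Z) (h : f pt₀ = x) :
    ∃ a : Z.residueField x ⟶ CommRingCat.of ℂ, f = Spec.map a ≫ Z.fromSpecResidueField x := by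
  subst h
  exact ⟨_, (Scheme.descResidueField_stalkClosedPointTo_fromSpecResidueField ℂ Z f).symm⟩

/-- `ℂ`-points with the same image are equal. -/
lemma point_ext {Z : Scheme.{0}} (str : Z ⟶ pt) {f g : pt ⟶ Z} (hf : f ≫ str = 𝟙 pt)
    (hg : g ≫ str = 𝟙 pt) (h : f pt₀ = g pt₀) : f = g := by
  obtain ⟨a, rfl⟩ := exists_eq_fromSpecResidueField f _ h
  obtain ⟨a', ha'⟩ := exists_eq_fromSpecResidueField g _ rfl
  generalize g pt₀ = x at *
  subst ha'
  obtain ⟨b, hb⟩ := Spec.map_surjective (Z.fromSpecResidueField x ≫ str)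
  -- Any `a` coming from a `ℂ`-point over `Spec ℂ` is a left inverse of `b`. As a homomorphism of
  -- fields it is injective, so it is also a right inverse, and this determines it.
  have key : ∀ a : Z.residueField x ⟶ CommRingCat.of ℂ,
      (Spec.map a ≫ Z.fromSpecResidueField x) ≫ str = 𝟙 pt → ∀ c, a (b c) = c := by
    intro a ha c
    rw [Category.assoc, ← hb, ← Spec.map_comp, ← Spec.map_id] at ha
    exact ConcreteCategory.congr_hom (Spec.map_injective ha) c
  congr 2
  ext y
  have h1 : b (a y) = y := a.hom.injective (key a hf _)
  have h2 := key a' hg (a y)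
  rw [h1] at h2
  exact h2.symm

lemma preimage_eq {S T : Scheme.{0}} {f g : S ⟶ T} (h : ∀ x, f x = g x) (U : T.Opens) :
    f ⁻¹ᵁ U = g ⁻¹ᵁ U := by
  ext x
  change f x ∈ U ↔ g x ∈ U
  rw [h]

lemma pbF_congr {S T : Scheme.{0}} {f g : S ⟶ T} (h : f = g) (U : T.Opens) (c : Γ(T, U)) :
    pbF f U c = resF (by rw [h]) (pbF g U c) := by
  subst h; simp

lemma scheme_hom_ext {S T : Scheme.{0}} {f g : S ⟶ T} (h : ∀ x, f x = g x)
    (h' : ∀ U c, pbF f U c = resF (preimage_eq h U).le (pbF g U c)) : f = g := by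
  have hb : f.base = g.base := by
    ext x
    exact h x
  refine Scheme.Hom.ext hb fun U => ?_
  ext c
  change resF (preimage_eq h U).ge (pbF f U c) = pbF g U c
  rw [h', resF_resF, resF_self]

/-- A morphism of schemes from its action on points and functions, where locality is checked on
a jointly surjective family. -/
lemma exists_schemeHom {ι : Type} {C : ι → Scheme.{0}} {Z T : Scheme.{0}} (ν : ∀ i, C i ⟶ Z)
    (hν : ∀ z : Z, ∃ (i : ι) (x : C i), ν i x = z) (h : ∀ i, C i ⟶ T) (f : C(Z, T))
    (hf : ∀ i x, f (ν i x) = h i x)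
    (F : ∀ U : T.Opens, Γ(T, U) →+* Γ(Z, U.comap f))
    (hF : ∀ U g i, pbF (ν i) _ (F U g) =
      resF (fun x hx => by have := hf i x; change f (ν i x) ∈ U at hx; rwa [this] at hx)
        (pbF (h i) U g))
    (hr : ∀ {U V : T.Opens} (hUV : V ≤ U) g, F V (resF hUV g) =
      resF (Opens.comap_mono f hUV) (F U g)) :
    ∃ φ : Z ⟶ T, (∀ z, φ z = f z) ∧ ∀ i, ν i ≫ φ = h i := by
  let φ₀ : Z.toPresheafedSpace.Hom T.toPresheafedSpace :=
    { base := TopCat.ofHom f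
      c := { app := fun U => CommRingCat.ofHom (F U.unop)
             naturality := by
              intro U V i
              ext g
              exact hr i.unop.le g } }
  let φ : Z ⟶ T := ⟨⟨φ₀, by
    intro z
    obtain ⟨i, x, rfl⟩ := hν z
    refine ⟨fun a ha => ?_⟩
    obtain ⟨U, hxU, g, rfl⟩ := TopCat.Presheaf.exists_germ_eq T.presheaf a
    -- A germ which becomes a unit on `Z` is nonvanishing at a point of some `C i`, where its
    -- pullback comes from the morphism `h i`; locality of `h i` then applies.
    have h1 : IsUnit (Z.presheaf.germ (U.comap f) (ν i x) hxU (F U g)) := by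
      have := PresheafedSpace.stalkMap_germ_apply φ₀ U (ν i x) hxU g
      exact this ▸ ha
    have h2 : ν i x ∈ Z.basicOpen (F U g) := (Z.mem_basicOpen _ _ hxU).2 h1
    have h3 : x ∈ ν i ⁻¹ᵁ Z.basicOpen (F U g) := h2
    rw [Scheme.preimage_basicOpen] at h3
    have h4 := hF U g i
    have h5 : x ∈ (C i).basicOpen (pbF (ν i) _ (F U g)) := h3
    rw [h4] at h5
    have h6 : x ∈ (C i).basicOpen (pbF (h i) U g) := by
      rw [resF_apply, Scheme.basicOpen_res] at h5
      exact h5.2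
    have h7 : x ∈ h i ⁻¹ᵁ T.basicOpen g := by
      rw [Scheme.preimage_basicOpen]; exact h6
    have h8 : f (ν i x) ∈ T.basicOpen g := by rw [hf]; exact h7
    exact (T.mem_basicOpen _ _ hxU).1 h8⟩⟩
  refine ⟨φ, fun _ => rfl, fun i => ?_⟩
  exact scheme_hom_ext (fun x => hf i x) fun U g => hF U g i

namespace IsNodalGluing

variable {ι K : Type} {C : ι → TwoPointed} {σ τ : ι → K} {Z : Scheme.{0}}
    {ν : ∀ i, (C i).C ⟶ Z} {p : K → (pt ⟶ Z)} (G : IsNodalGluing C σ τ ν p)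
include G

lemma hom_ext {T : Scheme.{0}} {f g : Z ⟶ T} (h : ∀ i, ν i ≫ f = ν i ≫ g) : f = g := by
  have hb : ∀ z, f z = g z := by
    intro z
    obtain ⟨i, x, rfl⟩ := G.surjective z
    exact congr($(h i) x)
  refine scheme_hom_ext hb fun U c => G.pbF_injective fun i => ?_
  rw [pbF_res]
  exact pbF_congr (h i) U c

/-- Two points of the components have the same image only when they coincide or are marked points
with the same label, and there the maps agree through `c`. This gives the map on points; functions
pull back by the gluing axiom, with value at the node `p k` equal to the value at `c k`. -/
lemma exists_desc [Finite ι] (hp : ∀ k l, p k pt₀ = p l pt₀ → k = l) {T : Scheme.{0}}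
    (h : ∀ i, (C i).C ⟶ T) (c : K → (pt ⟶ T))
    (hs : ∀ i, (C i).s ≫ h i = c (σ i)) (ht : ∀ i, (C i).t ≫ h i = c (τ i)) :
    ∃ f : Z ⟶ T, ∀ i, ν i ≫ f = h i := by
  have hmark : ∀ i x, x ∈ Set.range (C i).s ∪ Set.range (C i).t →
      ∃ k, ν i x = p k pt₀ ∧ h i x = c k pt₀ := by
    rintro i x (⟨q, rfl⟩ | ⟨q, rfl⟩)
    · obtain rfl := Subsingleton.elim q pt₀
      exact ⟨σ i, congr($(G.s_eq i) pt₀), congr($(hs i) pt₀)⟩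
    · obtain rfl := Subsingleton.elim q pt₀
      exact ⟨τ i, congr($(G.t_eq i) pt₀), congr($(ht i) pt₀)⟩
  have hwd : ∀ i j x y, ν i x = ν j y → h i x = h j y := by
    intro i j x y hxy
    rcases G.injective i j x y hxy with h1 | h1
    · cases h1; rfl
    rcases G.injective j i y x hxy.symm with h2 | h2
    · cases h2; rfl
    obtain ⟨k, hk, hk'⟩ := hmark i x h1
    obtain ⟨l, hl, hl'⟩ := hmark j y h2
    obtain rfl := hp k l (hk.symm.trans (hxy.trans hl))
    rw [hk', hl']
  choose I X hIX using G.surjective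
  let f₀ : Z → T := fun z => h (I z) (X z)
  have hf : ∀ i x, f₀ (ν i x) = h i x := fun i x => hwd _ _ _ _ (hIX _)
  -- The preimage of a closed set is a finite union of images of closed sets under the finite, hence
  -- closed, maps `ν i`.
  have hcont : Continuous f₀ := by
    rw [continuous_iff_isClosed]
    intro A hA
    have : f₀ ⁻¹' A = ⋃ i, ν i '' (h i ⁻¹' A) := by
      ext z
      simp only [Set.mem_preimage, Set.mem_iUnion, Set.mem_image]
      constructor
      · intro hz
        exact ⟨I z, X z, hz, hIX z⟩
      · rintro ⟨i, x, hx, rfl⟩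
        rwa [hf]
    rw [this]
    refine isClosed_iUnion_of_finite fun i => ?_
    have := G.finite i
    exact (ν i).isClosedMap _ (hA.preimage (h i).continuous)
  let f : C(Z, T) := ⟨f₀, hcont⟩
  have hle : ∀ i (U : T.Opens), ν i ⁻¹ᵁ (U.comap f) ≤ h i ⁻¹ᵁ U := by
    intro i U x hx
    have := hf i x
    change f₀ (ν i x) ∈ U at hx
    rwa [this] at hx
  have hex : ∀ (U : T.Opens) (g : Γ(T, U)), ∃ g' : Γ(Z, U.comap f), ∀ i, pbF (ν i) _ g' =
      resF (hle i U) (pbF (h i) U g) := by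
    intro U g
    classical
    refine G.exists_function _ (fun k => if hk : MemOpen (c k) U then evF (c k) U hk g else 0) ?_ ?_
    · intro i hi
      have hk : MemOpen (c (σ i)) U := (memOpen_iff (hs i)).1 (hi.trans (preimage_mono _ (hle i U)))
      rw [evF_res, dif_pos hk, evF_comp _ _ _ (hs i) _ hk]
    · intro i hi
      have hk : MemOpen (c (τ i)) U := (memOpen_iff (ht i)).1 (hi.trans (preimage_mono _ (hle i U)))
      rw [evF_res, dif_pos hk, evF_comp _ _ _ (ht i) _ hk]
  choose F hF using hex
  obtain ⟨φ, -, hφ⟩ := exists_schemeHom ν G.surjective h f hf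
    (fun U => { toFun := F U
                map_one' := G.pbF_injective fun i => by rw [hF]; simp
                map_zero' := G.pbF_injective fun i => by rw [hF]; simp
                map_add' := fun a b => G.pbF_injective fun i => by rw [hF]; simp [hF]
                map_mul' := fun a b => G.pbF_injective fun i => by rw [hF]; simp [hF] })
    (fun U g i => hF U g i)
    (fun hUV g => G.pbF_injective fun i => by
      refine (hF _ _ i).trans (Eq.trans ?_ (pbF_res (ν i) _ _).symm)
      refine Eq.trans ?_ (congrArg _ (hF _ g i)).symm
      rw [pbF_res, resF_resF, resF_resF])
  exact ⟨φ, hφ⟩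

end IsNodalGluing

end Gieseker

end

/-! ### Gluing isomorphisms of bundles along the nodes -/

noncomputable section

namespace Gieseker

open TopologicalSpace Opposite

lemma isIso_counit_of_isIso {S T : Scheme.{0}} (φ : S ⟶ T) [IsIso φ] (M : S.Modules) :
    IsIso ((Scheme.Modules.pullbackPushforwardAdjunction φ).counit.app M) := by
  have : (Scheme.Modules.pushforward φ).Full := inferInstance
  have : (Scheme.Modules.pushforward φ).Faithful := inferInstance
  infer_instance

lemma nonempty_pullback_iso {S T : Scheme.{0}} (φ : S ⟶ T) [IsIso φ] {M : S.Modules}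
    {N : T.Modules} (e : N ≅ (Scheme.Modules.pushforward φ).obj M) :
    Nonempty (M ≅ (Scheme.Modules.pullback φ).obj N) :=
  have := isIso_counit_of_isIso φ M
  ⟨((Scheme.Modules.pullback φ).mapIso e ≪≫
    asIso ((Scheme.Modules.pullbackPushforwardAdjunction φ).counit.app M)).symm⟩

namespace IsNodalGluing

variable {ι K : Type} {C : ι → TwoPointed} {σ τ : ι → K} {Z : Scheme.{0}}
    {ν : ∀ i, (C i).C ⟶ Z} {p : K → (pt ⟶ Z)} (G : IsNodalGluing C σ τ ν p)
include G

/-- A section of `E` is a family of sections on the components agreeing at the nodes. Applying `θ i`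
componentwise keeps the agreement, because all `θ i` induce the same `f k` at a node; the inverse
works in the same way with `(f k).symm`. -/
lemma exists_iso_pushforward {E E' : Z.Modules} {r : ℕ} (hE : IsVectorBundle r E)
    (hE' : IsVectorBundle r E') (φ : Z ⟶ Z) (φi : ∀ i, (C i).C ⟶ (C i).C)
    (hφ : ∀ i, ν i ≫ φ = φi i ≫ ν i)
    (hφs : ∀ i, (C i).s ≫ φi i = (C i).s) (hφt : ∀ i, (C i).t ≫ φi i = (C i).t)
    (θ : ∀ i, SemiHom (φi i) ((Scheme.Modules.pullback (ν i)).obj E)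
      ((Scheme.Modules.pullback (ν i)).obj E'))
    (hθ : ∀ i W, Function.Bijective ((θ i).app W))
    (f : ∀ k, (fiber (p k)).obj E ≃ₗ[ℂ] (fiber (p k)).obj E')
    (hs : ∀ i W (h : MemOpen (C i).s W) (h' : MemOpen (C i).s (φi i ⁻¹ᵁ W)) m,
      pval (G.s_eq i) (φi i ⁻¹ᵁ W) h' ((θ i).app W m) = f _ (pval (G.s_eq i) W h m))
    (ht : ∀ i W (h : MemOpen (C i).t W) (h' : MemOpen (C i).t (φi i ⁻¹ᵁ W)) m,
      pval (G.t_eq i) (φi i ⁻¹ᵁ W) h' ((θ i).app W m) = f _ (pval (G.t_eq i) W h m)) :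
    Nonempty (E ≅ (Scheme.Modules.pushforward φ).obj E') := by
  classical
  have hU : ∀ i (U : Z.Opens), ν i ⁻¹ᵁ φ ⁻¹ᵁ U = φi i ⁻¹ᵁ ν i ⁻¹ᵁ U := fun i U =>
    congr($(hφ i) ⁻¹ᵁ U)
  have hps : ∀ i, p (σ i) ≫ φ = p (σ i) := fun i => by
    rw [← G.s_eq, Category.assoc, hφ, reassoc_of% (hφs i)]
  have hpt : ∀ i, p (τ i) ≫ φ = p (τ i) := fun i => by
    rw [← G.t_eq, Category.assoc, hφ, reassoc_of% (hφt i)]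
  let R : ∀ U : Z.Opens, Γ(E, U) → Γ(E', φ ⁻¹ᵁ U) → Prop := fun U m n =>
    ∀ i, pb (ν i) (φ ⁻¹ᵁ U) n =
      res (hU i U).le ((θ i).app _ (pb (ν i) U m))
  have hex : ∀ U m, ∃! n, R U m n := by
    intro U m
    refine existsUnique_of_exists_of_unique ?_ ?_
    · refine G.exists_section hE'
        (fun i => res (hU i U).le
          ((θ i).app _ (pb (ν i) U m)))
        (fun k => if hk : MemOpen (p k) U then f k (val (p k) U hk m) else 0) ?_ ?_
      · intro i h
        have h1 : MemOpen (C i).s (ν i ⁻¹ᵁ U) := by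
          rw [hU] at h
          exact (memOpen_iff (hφs i)).1 h
        rw [pval_res, hs i _ h1, pval_pb, dif_pos]
      · intro i h
        have h1 : MemOpen (C i).t (ν i ⁻¹ᵁ U) := by
          rw [hU] at h
          exact (memOpen_iff (hφt i)).1 h
        rw [pval_res, ht i _ h1, pval_pb, dif_pos]
    · intro n n' hn hn'
      exact G.pb_injective hE' fun i => (hn i).trans (hn' i).symm
  obtain ⟨Θ, hΘ⟩ := SemiHom.exists_of_rel φ R hex
    (fun U m m' n n' h h' i => by
      rw [map_add, h, h', map_add, map_add, map_add])
    (fun U g m n h i => by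
      rw [pb_smul, h, pb_smul, SemiHom.app_smul, res_smul, ← pbF_comp, ← pbF_comp]
      congr 1
      exact pbF_congr (hφ i) U g)
    (fun {U V} h m n hmn i => by
      rw [pb_res, hmn, res_res, pb_res, SemiHom.app_res, res_res])
  have hbij : ∀ U, Function.Bijective (Θ.app U) := by
    intro U
    constructor
    · intro m m' h
      refine G.pb_injective hE fun i => (hθ i _).1 ?_
      have h1 := hΘ U m i
      rw [h, hΘ U m' i] at h1
      have h2 := congrArg (res (hU i U).ge) h1
      rw [res_res, res_res, res_self, res_self] at h2
      exact h2.symm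
    · intro n
      choose m hm using fun i => (hθ i (ν i ⁻¹ᵁ U)).2
        (res (hU i U).ge (pb (ν i) (φ ⁻¹ᵁ U) n))
      obtain ⟨m', hm'⟩ := G.exists_section hE m
        (fun k => if hk : MemOpen (p k) (φ ⁻¹ᵁ U) then (f k).symm (val (p k) _ hk n) else 0)
        (fun i h => by
          have h0 : MemOpen (C i).s (φi i ⁻¹ᵁ ν i ⁻¹ᵁ U) := (memOpen_iff (hφs i)).2 h
          have h1 : MemOpen (p (σ i)) (φ ⁻¹ᵁ U) :=
            (memOpen_iff (hps i)).2 ((memOpen_iff (G.s_eq i)).1 h)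
          rw [dif_pos h1, LinearEquiv.eq_symm_apply, ← hs i _ h h0, hm, pval_res, pval_pb])
        (fun i h => by
          have h0 : MemOpen (C i).t (φi i ⁻¹ᵁ ν i ⁻¹ᵁ U) := (memOpen_iff (hφt i)).2 h
          have h1 : MemOpen (p (τ i)) (φ ⁻¹ᵁ U) :=
            (memOpen_iff (hpt i)).2 ((memOpen_iff (G.t_eq i)).1 h)
          rw [dif_pos h1, LinearEquiv.eq_symm_apply, ← ht i _ h h0, hm, pval_res, pval_pb])
      refine ⟨m', (hex U m').unique (hΘ U m') fun i => ?_⟩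
      rw [hm', hm, res_res, res_self]
  exact Θ.nonempty_iso φ hbij

end IsNodalGluing

end Gieseker

end

noncomputable section

namespace Gieseker

/-! ### Chains of linear relations -/

section Chain

variable {n : ℕ} {E : Fin (n + 1) → Type} {H : Fin n → Type}
  [∀ k, AddCommGroup (E k)] [∀ k, Module ℂ (E k)] [∀ j, AddCommGroup (H j)] [∀ j, Module ℂ (H j)]
  (l : ∀ j, H j →ₗ[ℂ] E j.castSucc) (r : ∀ j, H j →ₗ[ℂ] E j.succ)

/-- Transport of `0 ⊆ E i` to the right. -/
def chainRight (i : Fin (n + 1)) : ∀ j : Fin (n + 1), Submodule ℂ (E j) :=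
  Fin.induction ⊥ (fun j V => if i ≤ j.castSucc then (V.comap (l j)).map (r j) else ⊥)

/-- Transport of `0 ⊆ E i` to the left. -/
def chainLeft (i : Fin (n + 1)) : ∀ j : Fin (n + 1), Submodule ℂ (E j) :=
  fun j => Fin.reverseInduction (motive := fun j : Fin (n + 1) => Submodule ℂ (E j)) ⊥
    (fun j V => if j.succ ≤ i then (V.comap (r j)).map (l j) else ⊥) j

lemma chainRight_succ (i : Fin (n + 1)) (j : Fin n) : chainRight l r i j.succ =
    if i ≤ j.castSucc then ((chainRight l r i j.castSucc).comap (l j)).map (r j) else ⊥ := by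
  rw [chainRight, Fin.induction_succ]; rfl

lemma chainRight_zero (i : Fin (n + 1)) : chainRight l r i 0 = ⊥ := rfl

lemma chainLeft_castSucc (i : Fin (n + 1)) (j : Fin n) : chainLeft l r i j.castSucc =
    if j.succ ≤ i then ((chainLeft l r i j.succ).comap (r j)).map (l j) else ⊥ := by
  rw [chainLeft, Fin.reverseInduction_castSucc]; rfl

lemma chainLeft_last (i : Fin (n + 1)) : chainLeft l r i (Fin.last n) = ⊥ := by
  rw [chainLeft, Fin.reverseInduction_last]

/-- The family `(e, w)` is compatible along the links in `S`. -/
def CompatOn (S : Fin n → Prop) (e : ∀ k, E k) (w : ∀ j, H j) : Prop :=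
  ∀ j, S j → l j (w j) = e j.castSucc ∧ r j (w j) = e j.succ

variable {l r}

lemma CompatOn.mono {A B : Fin n → Prop} {e : ∀ k, E k} {w : ∀ j, H j} (h : CompatOn l r A e w)
    (hBA : ∀ j, B j → A j) : CompatOn l r B e w := fun j hj => h j (hBA j hj)

/-- Each link lies entirely on one side of the vertex `k`, so two families may be cut at `k` and
exchanged as soon as they agree there. -/
lemma CompatOn.glue {A B : Fin n → Prop} {e₁ e₂ : ∀ k, E k} {w₁ w₂ : ∀ j, H j}
    (h₁ : CompatOn l r A e₁ w₁) (h₂ : CompatOn l r B e₂ w₂) (k : Fin (n + 1)) (hk : e₁ k = e₂ k) :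
    CompatOn l r (fun j => (j.succ ≤ k ∧ A j) ∨ (k ≤ j.castSucc ∧ B j))
      (fun m => if m ≤ k then e₁ m else e₂ m) (fun j => if j.succ ≤ k then w₁ j else w₂ j) := by
  rintro j (⟨hj, hA⟩ | ⟨hj, hB⟩)
  · have : j.castSucc ≤ k := (Fin.castSucc_lt_succ).le.trans hj
    simp only [hj, this, if_true]
    exact h₁ j hA
  · have h3 : ¬ j.succ ≤ k := fun h => absurd (hj.trans_lt Fin.castSucc_lt_succ) (not_lt.2 h)
    simp only [h3, if_false]
    refine ⟨?_, (h₂ j hB).2⟩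
    split_ifs with h
    · obtain rfl := le_antisymm h hj
      rw [hk]
      exact (h₂ j hB).1
    · exact (h₂ j hB).1

lemma compatOn_zero (S : Fin n → Prop) : CompatOn l r S 0 0 := fun j _ => by simp

lemma exists_compatOn_single (j : Fin n) (h : H j) :
    ∃ (e : ∀ k, E k) (w : ∀ j, H j), CompatOn l r (· = j) e w ∧ w j = h ∧
      e j.castSucc = l j h ∧ e j.succ = r j h := by
  classical
  have hne : j.castSucc ≠ j.succ := Fin.castSucc_lt_succ.ne
  refine ⟨Function.update (Function.update 0 j.castSucc (l j h)) j.succ (r j h),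
    Function.update 0 j h, ?_, by simp, ?_, by simp⟩
  · rintro i rfl
    simp [Function.update_of_ne hne]
  · simp [Function.update_of_ne hne]

/-- Elements of a right transport are the values of families vanishing before `i`. -/
lemma mem_chainRight_iff (i k : Fin (n + 1)) (hik : i ≤ k) (x : E k) :
    x ∈ chainRight l r i k ↔ ∃ (e : ∀ k, E k) (w : ∀ j, H j),
      CompatOn l r (fun j => j.succ ≤ k) e w ∧ (∀ m ≤ i, e m = 0) ∧
        (∀ j : Fin n, j.succ ≤ i → w j = 0) ∧ e k = x := by
  induction k using Fin.induction with
  | zero =>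
    obtain rfl : i = 0 := le_antisymm hik (Fin.zero_le _)
    rw [chainRight_zero, Submodule.mem_bot]
    constructor
    · rintro rfl
      exact ⟨0, 0, compatOn_zero _, fun _ _ => rfl, fun _ _ => rfl, rfl⟩
    · rintro ⟨e, w, -, h, -, rfl⟩
      exact h 0 le_rfl
  | succ k ih =>
    rcases hik.eq_or_lt with rfl | hlt
    -- At the starting vertex `i` itself the default value `⊥` of the recursion is the subspace 0 to
    -- be transported.
    · rw [chainRight_succ, if_neg (not_le.2 Fin.castSucc_lt_succ), Submodule.mem_bot]
      constructor
      · rintro rfl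
        exact ⟨0, 0, compatOn_zero _, fun _ _ => rfl, fun _ _ => rfl, rfl⟩
      · rintro ⟨e, w, -, h, -, rfl⟩
        exact h _ le_rfl
    · have hik' : i ≤ k.castSucc := Fin.le_castSucc_iff.2 hlt
      rw [chainRight_succ, if_pos hik', Submodule.mem_map]
      constructor
      · rintro ⟨h, hh, rfl⟩
        obtain ⟨e, w, hc, he, hw, hek⟩ := (ih hik' _).1 hh
        obtain ⟨e₂, w₂, hc₂, hw₂, he₂, he₂'⟩ := exists_compatOn_single (l := l) (r := r) k h
        refine ⟨_, _, (hc.glue hc₂ k.castSucc (hek.trans he₂.symm)).mono fun j hj => ?_, ?_, ?_, ?_⟩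
        · rcases (Fin.succ_le_succ_iff.1 hj).eq_or_lt with rfl | h
          · exact Or.inr ⟨le_rfl, rfl⟩
          · have : j.succ ≤ k.castSucc := Fin.succ_le_castSucc_iff.2 h
            exact Or.inl ⟨this, this⟩
        · intro m hm
          simp only [hm.trans hik', if_true]
          exact he m hm
        · intro j hj
          simp only [hj.trans hik', if_true]
          exact hw j hj
        · simp only [not_le.2 (Fin.castSucc_lt_succ : k.castSucc < k.succ), if_false]
          exact he₂'
      · rintro ⟨e, w, hc, he, hw, rfl⟩
        refine ⟨w k, ?_, (hc k le_rfl).2⟩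
        rw [Submodule.mem_comap, (hc k le_rfl).1]
        exact (ih hik' _).2 ⟨e, w, fun j hj => hc j (hj.trans Fin.castSucc_lt_succ.le), he, hw, rfl⟩

/-- Elements of a left transport are the values of families vanishing after `i`. -/
lemma mem_chainLeft_iff (i k : Fin (n + 1)) (hik : k ≤ i) (x : E k) :
    x ∈ chainLeft l r i k ↔ ∃ (e : ∀ k, E k) (w : ∀ j, H j),
      CompatOn l r (fun j => k ≤ j.castSucc) e w ∧ (∀ m, i ≤ m → e m = 0) ∧
        (∀ j : Fin n, i ≤ j.castSucc → w j = 0) ∧ e k = x := by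
  induction k using Fin.reverseInduction with
  | last =>
    obtain rfl : i = Fin.last n := le_antisymm (Fin.le_last _) hik
    rw [chainLeft_last, Submodule.mem_bot]
    constructor
    · rintro rfl
      exact ⟨0, 0, compatOn_zero _, fun _ _ => rfl, fun _ _ => rfl, rfl⟩
    · rintro ⟨e, w, -, h, -, rfl⟩
      exact h _ le_rfl
  | cast k ih =>
    rcases hik.eq_or_lt with rfl | hlt
    · rw [chainLeft_castSucc, if_neg (not_le.2 Fin.castSucc_lt_succ), Submodule.mem_bot]
      constructor
      · rintro rfl
        exact ⟨0, 0, compatOn_zero _, fun _ _ => rfl, fun _ _ => rfl, rfl⟩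
      · rintro ⟨e, w, -, h, -, rfl⟩
        exact h _ le_rfl
    · have hik' : k.succ ≤ i := Fin.castSucc_lt_iff_succ_le.1 hlt
      rw [chainLeft_castSucc, if_pos hik', Submodule.mem_map]
      constructor
      · rintro ⟨h, hh, rfl⟩
        obtain ⟨e, w, hc, he, hw, hek⟩ := (ih hik' _).1 hh
        obtain ⟨e₂, w₂, hc₂, hw₂, he₂, he₂'⟩ := exists_compatOn_single (l := l) (r := r) k h
        refine ⟨_, _, (hc₂.glue hc k.succ (he₂'.trans hek.symm)).mono fun j hj => ?_, ?_, ?_, ?_⟩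
        · rcases (Fin.castSucc_le_castSucc_iff.1 hj).eq_or_lt with rfl | h
          · exact Or.inl ⟨le_rfl, rfl⟩
          · have : k.succ ≤ j.castSucc := Fin.succ_le_castSucc_iff.2 h
            exact Or.inr ⟨this, this⟩
        · intro m hm
          split_ifs with h
          · obtain rfl := le_antisymm h (hik'.trans hm)
            rw [he₂', ← hek]
            exact he _ hm
          · exact he m hm
        · intro j hj
          have : ¬ j.succ ≤ k.succ := fun h =>
            absurd ((hik'.trans hj).trans_lt Fin.castSucc_lt_succ) (not_lt.2 h)
          simp only [this, if_false]
          exact hw j hj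
        · simp only [(Fin.castSucc_lt_succ : k.castSucc < k.succ).le, if_true]
          exact he₂
      · rintro ⟨e, w, hc, he, hw, rfl⟩
        refine ⟨w k, ?_, (hc k le_rfl).1⟩
        rw [Submodule.mem_comap, (hc k le_rfl).2]
        exact (ih hik' _).2 ⟨e, w, fun j hj => hc j (Fin.castSucc_lt_succ.le.trans hj), he, hw, rfl⟩

variable (l r)

/-- The space of compatible families. -/
def families : Submodule ℂ ((∀ k, E k) × (∀ j, H j)) where
  carrier := {x | CompatOn l r (fun _ => True) x.1 x.2}
  add_mem' := fun {a b} ha hb j _ => by simp [ha j trivial, hb j trivial]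
  zero_mem' := compatOn_zero _
  smul_mem' := fun c a ha j _ => by simp [ha j trivial]

variable {l r}

/-- At each link a preimage under `l` of the current value is chosen, and its image under `r` is the
next value. -/
lemma exists_extend_right (hl : ∀ j, Function.Surjective (l j)) (k : Fin (n + 1)) (y : E k) :
    ∃ (e : ∀ k, E k) (w : ∀ j, H j), CompatOn l r (fun j => k ≤ j.castSucc) e w ∧ e k = y := by
  classical
  induction k using Fin.reverseInduction with
  | last =>
    refine ⟨Function.update 0 _ y, 0, fun j hj => ?_, by simp⟩
    exact absurd (Fin.castSucc_lt_last j) (not_lt.2 hj)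
  | cast k ih =>
    obtain ⟨h, rfl⟩ := hl k y
    obtain ⟨e, w, hc, hek⟩ := ih (r k h)
    obtain ⟨e₂, w₂, hc₂, hw₂, he₂, he₂'⟩ := exists_compatOn_single (l := l) (r := r) k h
    refine ⟨_, _, (hc₂.glue hc k.succ (he₂'.trans hek.symm)).mono fun j hj => ?_, ?_⟩
    · rcases (Fin.castSucc_le_castSucc_iff.1 hj).eq_or_lt with rfl | h
      · exact Or.inl ⟨le_rfl, rfl⟩
      · have : k.succ ≤ j.castSucc := Fin.succ_le_castSucc_iff.2 h
        exact Or.inr ⟨this, this⟩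
    · simp only [(Fin.castSucc_lt_succ : k.castSucc < k.succ).le, if_true]
      exact he₂

lemma exists_extend_left (hr : ∀ j, Function.Surjective (r j)) (k : Fin (n + 1)) (y : E k) :
    ∃ (e : ∀ k, E k) (w : ∀ j, H j), CompatOn l r (fun j => j.succ ≤ k) e w ∧ e k = y := by
  classical
  induction k using Fin.induction with
  | zero =>
    refine ⟨Function.update 0 _ y, 0, fun j hj => ?_, by simp⟩
    exact absurd (Fin.succ_pos j) (not_lt.2 hj)
  | succ k ih =>
    obtain ⟨h, rfl⟩ := hr k y
    obtain ⟨e, w, hc, hek⟩ := ih (l k h)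
    obtain ⟨e₂, w₂, hc₂, hw₂, he₂, he₂'⟩ := exists_compatOn_single (l := l) (r := r) k h
    refine ⟨_, _, (hc.glue hc₂ k.castSucc (hek.trans he₂.symm)).mono fun j hj => ?_, ?_⟩
    · rcases (Fin.succ_le_succ_iff.1 hj).eq_or_lt with rfl | h
      · exact Or.inr ⟨le_rfl, rfl⟩
      · have : j.succ ≤ k.castSucc := Fin.succ_le_castSucc_iff.2 h
        exact Or.inl ⟨this, this⟩
    · simp only [not_le.2 (Fin.castSucc_lt_succ : k.castSucc < k.succ), if_false]
      exact he₂'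

lemma succ_le_or_le_castSucc (k : Fin (n + 1)) (j : Fin n) : j.succ ≤ k ∨ k ≤ j.castSucc := by
  rcases le_or_gt k j.castSucc with h | h
  · exact Or.inr h
  · exact Or.inl (Fin.castSucc_lt_iff_succ_le.1 h)

/-- Gluing of two families at `k`. -/
lemma exists_family_glue {k : Fin (n + 1)} {e₁ e₂ : ∀ k, E k} {w₁ w₂ : ∀ j, H j}
    (h₁ : CompatOn l r (fun j => j.succ ≤ k) e₁ w₁)
    (h₂ : CompatOn l r (fun j => k ≤ j.castSucc) e₂ w₂) (hk : e₁ k = e₂ k) :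
    ∃ x ∈ families l r, (∀ m ≤ k, x.1 m = e₁ m) ∧ (∀ m, k ≤ m → x.1 m = e₂ m) ∧
      (∀ j : Fin n, j.succ ≤ k → x.2 j = w₁ j) ∧ (∀ j : Fin n, k ≤ j.castSucc → x.2 j = w₂ j) := by
  have hmem : CompatOn l r (fun _ => True) _ _ := (h₁.glue h₂ k hk).mono fun j _ => by
    rcases succ_le_or_le_castSucc k j with h | h
    · exact Or.inl ⟨h, h⟩
    · exact Or.inr ⟨h, h⟩
  refine ⟨⟨fun m => if m ≤ k then e₁ m else e₂ m, fun j => if j.succ ≤ k then w₁ j else w₂ j⟩,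
    hmem, fun m hm => ?_, fun m hm => ?_, fun j hj => ?_, fun j hj => ?_⟩
  · simp only [hm, if_true]
  · dsimp only
    split_ifs with h
    · obtain rfl := le_antisymm h hm
      exact hk
    · rfl
  · simp only [hj, if_true]
  · have : ¬ j.succ ≤ k := fun h =>
      absurd (hj.trans_lt Fin.castSucc_lt_succ) (not_lt.2 h)
    simp only [this, if_false]

lemma exists_family_through (hl : ∀ j, Function.Surjective (l j))
    (hr : ∀ j, Function.Surjective (r j)) (k : Fin (n + 1)) (y : E k) :
    ∃ x ∈ families l r, x.1 k = y := by
  obtain ⟨e₁, w₁, h₁, rfl⟩ := exists_extend_left (l := l) hr k y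
  obtain ⟨e₂, w₂, h₂, hk⟩ := exists_extend_right (r := r) hl k (e₁ k)
  obtain ⟨x, hx, h, -⟩ := exists_family_glue h₁ h₂ hk.symm
  exact ⟨x, hx, h k le_rfl⟩

/-- Splices three pieces: a family up to the link, the prescribed element of the link, and a family
after it. With zero side pieces it extends link elements by zero. -/
lemma exists_family_link {j : Fin n} {h : H j} {e₁ e₂ : ∀ k, E k} {w₁ w₂ : ∀ j, H j}
    (h₁ : CompatOn l r (fun i => i.succ ≤ j.castSucc) e₁ w₁)
    (h₂ : CompatOn l r (fun i => j.succ ≤ i.castSucc) e₂ w₂)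
    (he₁ : e₁ j.castSucc = l j h) (he₂ : e₂ j.succ = r j h) :
    ∃ x ∈ families l r, (∀ m ≤ j.castSucc, x.1 m = e₁ m) ∧ (∀ m, j.succ ≤ m → x.1 m = e₂ m) ∧
      x.2 j = h := by
  obtain ⟨e, w, hc, hw, he, he'⟩ := exists_compatOn_single (l := l) (r := r) j h
  have h₃ := hc.glue h₂ j.succ (he'.trans he₂.symm)
  have h₄ : CompatOn l r (fun i => j.castSucc ≤ i.castSucc) _ _ := h₃.mono fun i hi => by
    rcases (Fin.castSucc_le_castSucc_iff.1 hi).eq_or_lt with rfl | h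
    · exact Or.inl ⟨le_rfl, rfl⟩
    · have : j.succ ≤ i.castSucc := Fin.succ_le_castSucc_iff.2 h
      exact Or.inr ⟨this, this⟩
  obtain ⟨x, hx, hx₁, hx₂, -, hx'⟩ := exists_family_glue (k := j.castSucc) h₁ h₄ (by
    simp only [(Fin.castSucc_lt_succ : j.castSucc < j.succ).le, if_true]; rw [he₁, he])
  refine ⟨x, hx, hx₁, fun m hm => ?_, ?_⟩
  · rw [hx₂ m (Fin.castSucc_lt_succ.le.trans hm)]
    split_ifs with hm'
    · obtain rfl := le_antisymm hm' hm
      rw [he', he₂]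
    · rfl
  · rw [hx' j le_rfl]
    simp [hw]

lemma exists_family_through_link (hl : ∀ j, Function.Surjective (l j))
    (hr : ∀ j, Function.Surjective (r j)) (j : Fin n) (h : H j) :
    ∃ x ∈ families l r, x.2 j = h := by
  obtain ⟨e₁, w₁, h₁, he₁⟩ := exists_extend_left (l := l) hr j.castSucc (l j h)
  obtain ⟨e₂, w₂, h₂, he₂⟩ := exists_extend_right (r := r) hl j.succ (r j h)
  obtain ⟨x, hx, -, -, h⟩ := exists_family_link h₁ h₂ he₁ he₂
  exact ⟨x, hx, h⟩

/-- A family vanishing at `i` can be replaced by zero beyond `i`, so partial and global families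
give the same end values. -/
lemma mem_chainLeft_zero_iff (i : Fin (n + 1)) (y : E 0) :
    y ∈ chainLeft l r i 0 ↔ ∃ x ∈ families l r, (∀ m, i ≤ m → x.1 m = 0) ∧ x.1 0 = y := by
  rw [mem_chainLeft_iff i 0 (Fin.zero_le _)]
  constructor
  · rintro ⟨e, w, hc, he, -, rfl⟩
    exact ⟨(e, w), hc.mono fun _ _ => Fin.zero_le _, he, rfl⟩
  · rintro ⟨x, hx, he, rfl⟩
    obtain ⟨x', hx', h1, h2, h3, h4⟩ := exists_family_glue (k := i) (l := l) (r := r)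
      (CompatOn.mono hx fun _ _ => trivial) (compatOn_zero _) (he i le_rfl)
    exact ⟨x'.1, x'.2, CompatOn.mono hx' fun _ _ => trivial, h2, h4, h1 0 (Fin.zero_le _)⟩

lemma mem_chainRight_last_iff (i : Fin (n + 1)) (y : E (Fin.last n)) :
    y ∈ chainRight l r i (Fin.last n) ↔
      ∃ x ∈ families l r, (∀ m ≤ i, x.1 m = 0) ∧ x.1 (Fin.last n) = y := by
  rw [mem_chainRight_iff i _ (Fin.le_last _)]
  constructor
  · rintro ⟨e, w, hc, he, -, rfl⟩
    exact ⟨(e, w), hc.mono fun _ _ => Fin.le_last _, he, rfl⟩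
  · rintro ⟨x, hx, he, rfl⟩
    obtain ⟨x', hx', h1, h2, h3, h4⟩ := exists_family_glue (k := i) (l := l) (r := r)
      (compatOn_zero _) (CompatOn.mono hx fun _ _ => trivial) (he i le_rfl).symm
    exact ⟨x'.1, x'.2, CompatOn.mono hx' fun _ _ => trivial, h1, h3, h2 _ (Fin.le_last _)⟩

variable (l r) in
/-- The linear algebra of a Gieseker bundle restricted to its chain of rational curves. -/
structure IsGiesekerChain : Prop where
  surjective_left : ∀ j, Function.Surjective (l j)
  surjective_right : ∀ j, Function.Surjective (r j)
  ker_left : ∀ j, LinearMap.ker (l j) ≠ ⊥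
  finite : ∀ k, Module.Finite ℂ (E k)
  finrank_eq : ∀ k, Module.finrank ℂ (E k) = n
  eq_zero : ∀ x ∈ families l r, x.1 0 = 0 → x.1 (Fin.last n) = 0 → x = 0

/-! ### The dimension count along the chain -/

namespace IsGiesekerChain

variable (h : IsGiesekerChain l r)
include h

/-- Such an element extends by zero to a family which vanishes at both ends. -/
lemma eq_zero_of_link {j : Fin n} {x : H j} (h₁ : l j x = 0) (h₂ : r j x = 0) : x = 0 := by
  obtain ⟨y, hy, hy₁, hy₂, rfl⟩ := exists_family_link (l := l) (r := r) (e₁ := 0) (e₂ := 0)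
    (w₁ := 0) (w₂ := 0) (h := x) (compatOn_zero _) (compatOn_zero _) h₁.symm h₂.symm
  rw [h.eq_zero y hy (hy₁ 0 (Fin.zero_le _)) (hy₂ _ (Fin.le_last _))]
  rfl

lemma finite_link (j : Fin n) : Module.Finite ℂ (H j) := by
  have := h.finite
  refine Module.Finite.of_injective ((l j).prod (r j)) ?_
  rw [← LinearMap.ker_eq_bot, LinearMap.ker_eq_bot']
  intro x hx
  exact h.eq_zero_of_link (congrArg Prod.fst hx) (congrArg Prod.snd hx)

/-- Write `T` for the transport at the left vertex. The map `l j` sends `l⁻¹ T` onto `T` with kernel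
`ker (l j)`. The map `r j` is injective on `l⁻¹ T`: an element which it kills continues to the left
to a family starting at 0 and to the right by zero, and such a family vanishes. -/
lemma finrank_chainRight (j : Fin n) :
    Module.finrank ℂ (chainRight l r 0 j.succ) =
      Module.finrank ℂ (chainRight l r 0 j.castSucc) + Module.finrank ℂ (LinearMap.ker (l j)) := by
  have := h.finite
  have := h.finite_link j
  rw [chainRight_succ, if_pos (Fin.zero_le _)]
  set T := chainRight l r 0 j.castSucc with hT
  have hinj : Function.Injective ((r j).domRestrict (T.comap (l j))) := by
    rw [← LinearMap.ker_eq_bot, LinearMap.ker_eq_bot']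
    rintro ⟨x, hx⟩ hx0
    have hx0 : r j x = 0 := hx0
    obtain ⟨e, w, hc, he, -, hek⟩ := (mem_chainRight_iff 0 _ (Fin.zero_le _) _).1 hx
    obtain ⟨y, hy, hy₁, hy₂, rfl⟩ := exists_family_link (l := l) (r := r) (e₂ := 0)
      (w₂ := 0) hc (compatOn_zero _) hek hx0.symm
    apply Subtype.ext
    change y.2 j = 0
    rw [h.eq_zero y hy ((hy₁ 0 (Fin.zero_le _)).trans (he 0 le_rfl)) (hy₂ _ (Fin.le_last _))]
    rfl
  have h1 : Module.finrank ℂ ((T.comap (l j)).map (r j)) =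
      Module.finrank ℂ (T.comap (l j)) := by
    rw [← LinearMap.range_domRestrict, LinearMap.finrank_range_of_inj hinj]
  have h2 := LinearMap.finrank_range_add_finrank_ker ((l j).domRestrict (T.comap (l j)))
  rw [LinearMap.range_domRestrict, Submodule.map_comap_eq_of_surjective (h.surjective_left j)] at h2
  have h3 : Module.finrank ℂ (LinearMap.ker ((l j).domRestrict (T.comap (l j)))) =
      Module.finrank ℂ (LinearMap.ker (l j)) := by
    rw [LinearMap.ker_domRestrict]
    exact (Submodule.comapSubtypeEquivOfLe (fun x hx => by
      rw [Submodule.mem_comap, LinearMap.mem_ker.1 hx]; exact zero_mem _)).finrank_eq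
  rw [h1, ← h2, h3]

lemma one_le_finrank_ker (j : Fin n) : 1 ≤ Module.finrank ℂ (LinearMap.ker (l j)) := by
  have := h.finite_link j
  rw [Nat.one_le_iff_ne_zero, Ne, Submodule.finrank_eq_zero]
  exact h.ker_left j

/-- Each kernel contributes at least one dimension. -/
lemma le_finrank_chainRight (k : Fin (n + 1)) : (k : ℕ) ≤ Module.finrank ℂ (chainRight l r 0 k) := by
  induction k using Fin.induction with
  | zero => simp
  | succ k ih =>
    rw [h.finrank_chainRight]
    have := h.one_le_finrank_ker k
    simp only [Fin.val_succ, Fin.val_castSucc] at *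
    omega

/-- Descending induction from the last fibre, whose dimension is only `n`. Together with the lower
bound this leaves exactly one new dimension per link. -/
lemma finrank_chainRight_le (k : Fin (n + 1)) : Module.finrank ℂ (chainRight l r 0 k) ≤ k := by
  have := h.finite
  induction k using Fin.reverseInduction with
  | last =>
    have := (chainRight l r 0 (Fin.last n)).finrank_le
    rwa [h.finrank_eq] at this
  | cast k ih =>
    rw [h.finrank_chainRight] at ih
    have := h.one_le_finrank_ker k
    simp only [Fin.val_succ, Fin.val_castSucc] at *
    omega

lemma finrank_ker_left (j : Fin n) : Module.finrank ℂ (LinearMap.ker (l j)) = 1 := by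
  have h1 := h.finrank_chainRight j
  have h2 := h.finrank_chainRight_le j.succ
  have h3 := h.le_finrank_chainRight j.castSucc
  have := h.one_le_finrank_ker j
  simp only [Fin.val_succ, Fin.val_castSucc] at *
  omega

/-- By surjectivity both kernels have dimension `dim (H j) - n`. -/
lemma finrank_ker_right (j : Fin n) : Module.finrank ℂ (LinearMap.ker (r j)) = 1 := by
  have := h.finite_link j
  have h1 := LinearMap.finrank_range_add_finrank_ker (l j)
  have h2 := LinearMap.finrank_range_add_finrank_ker (r j)
  rw [LinearMap.range_eq_top.2 (h.surjective_left j), finrank_top, h.finrank_eq,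
    h.finrank_ker_left] at h1
  rw [LinearMap.range_eq_top.2 (h.surjective_right j), finrank_top, h.finrank_eq] at h2
  omega

lemma chainRight_zero_last : chainRight l r 0 (Fin.last n) = ⊤ := by
  have := h.finite
  refine Submodule.eq_top_of_finrank_eq (le_antisymm (Submodule.finrank_le _) ?_)
  rw [h.finrank_eq]
  exact h.le_finrank_chainRight (Fin.last n)

/-- Any family through `y` may be corrected by a family vanishing at the first vertex, and the last
values of these fill the last fibre. -/
lemma exists_family_ends (y : E 0) (z : E (Fin.last n)) :
    ∃ x ∈ families l r, x.1 0 = y ∧ x.1 (Fin.last n) = z := by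
  obtain ⟨x, hx, hx0⟩ := exists_family_through h.surjective_left h.surjective_right 0 y
  have : z - x.1 (Fin.last n) ∈ chainRight l r 0 (Fin.last n) := by
    rw [h.chainRight_zero_last]; trivial
  obtain ⟨x', hx', h0, h1⟩ := (mem_chainRight_last_iff _ _).1 this
  refine ⟨x + x', add_mem hx hx', ?_, ?_⟩
  · simp [hx0, h0 0 le_rfl]
  · simp [h1]

end IsGiesekerChain

/-! ### Reconstruction of the chain from the two flags -/

section Iso

variable (l r) in
/-- The values at the ends of a family. -/
def families.ends : families l r →ₗ[ℂ] E 0 × E (Fin.last n) :=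
  (((LinearMap.proj 0).comp (LinearMap.fst ℂ _ _)).prod
    ((LinearMap.proj (Fin.last n)).comp (LinearMap.fst ℂ _ _))).comp (families l r).subtype

lemma IsGiesekerChain.bijective_ends (h : IsGiesekerChain l r) :
    Function.Bijective (families.ends l r) := by
  constructor
  · rw [← LinearMap.ker_eq_bot, LinearMap.ker_eq_bot']
    rintro ⟨x, hx⟩ h0
    ext1
    exact h.eq_zero x hx (congrArg Prod.fst h0) (congrArg Prod.snd h0)
  · rintro ⟨y, z⟩
    obtain ⟨x, hx, rfl, rfl⟩ := h.exists_family_ends y z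
    exact ⟨⟨x, hx⟩, rfl⟩

lemma exists_linearEquiv_of_surjective {W W' A A' : Type} [AddCommGroup W] [Module ℂ W]
    [AddCommGroup W'] [Module ℂ W'] [AddCommGroup A] [Module ℂ A] [AddCommGroup A'] [Module ℂ A']
    (p : W →ₗ[ℂ] A) (p' : W' →ₗ[ℂ] A') (hp : Function.Surjective p) (hp' : Function.Surjective p')
    (Ω : W ≃ₗ[ℂ] W') (hΩ : ∀ w, p w = 0 ↔ p' (Ω w) = 0) :
    ∃ f : A ≃ₗ[ℂ] A', ∀ w, f (p w) = p' (Ω w) := by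
  have hk : (LinearMap.ker p).map (Ω : W →ₗ[ℂ] W') = LinearMap.ker p' := by
    ext y
    simp only [Submodule.mem_map, LinearMap.mem_ker]
    constructor
    · rintro ⟨x, hx, rfl⟩
      exact (hΩ x).1 hx
    · intro hy
      exact ⟨Ω.symm y, (hΩ _).2 (by simpa using hy), by simp⟩
  refine ⟨(p.quotKerEquivOfSurjective hp).symm ≪≫ₗ Submodule.Quotient.equiv _ _ Ω hk ≪≫ₗ
    p'.quotKerEquivOfSurjective hp', fun w => ?_⟩
  have : (p.quotKerEquivOfSurjective hp).symm (p w) = Submodule.Quotient.mk w := by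
    rw [LinearEquiv.symm_apply_eq]; rfl
  simp only [LinearEquiv.trans_apply, this]
  rfl

variable {E' : Fin (n + 1) → Type} {H' : Fin n → Type}
  [∀ k, AddCommGroup (E' k)] [∀ k, Module ℂ (E' k)] [∀ j, AddCommGroup (H' j)]
  [∀ j, Module ℂ (H' j)] {l' : ∀ j, H' j →ₗ[ℂ] E' j.castSucc} {r' : ∀ j, H' j →ₗ[ℂ] E' j.succ}

/-- A compatible family whose ends lie in the flags vanishes at the corresponding vertex. -/
lemma IsGiesekerChain.value_eq_zero (h : IsGiesekerChain l r) {x} (hx : x ∈ families l r)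
    (i : Fin (n + 1)) (h₁ : x.1 0 ∈ chainLeft l r i 0)
    (h₂ : x.1 (Fin.last n) ∈ chainRight l r i (Fin.last n)) : x.1 i = 0 := by
  obtain ⟨u, hu, hu0, hu1⟩ := (mem_chainLeft_zero_iff _ _).1 h₁
  obtain ⟨v, hv, hv0, hv1⟩ := (mem_chainRight_last_iff _ _).1 h₂
  -- `u` and `v` are families with the prescribed end values, supported to the left and to the right
  -- of `i`; their sum has the same ends as `x`, hence equals it.
  have : x - (u + v) = 0 := by
    refine h.eq_zero _ (sub_mem hx (add_mem hu hv)) ?_ ?_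
    · simp [hu1, hv0 0 (Fin.zero_le _)]
    · simp [hv1, hu0 _ (Fin.le_last _)]
  rw [sub_eq_zero] at this
  rw [this]
  simp [hu0 i le_rfl, hv0 i le_rfl]

/-- Cut the family at `i` and replace one of the halves by zero. -/
lemma ends_mem_of_value_eq_zero {x} (hx : x ∈ families l r) (i : Fin (n + 1)) (hi : x.1 i = 0) :
    x.1 0 ∈ chainLeft l r i 0 ∧ x.1 (Fin.last n) ∈ chainRight l r i (Fin.last n) := by
  obtain ⟨u, hu, hu1, hu2, -⟩ := exists_family_glue (k := i) (l := l) (r := r)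
      (CompatOn.mono hx fun _ _ => trivial) (compatOn_zero _) hi
  obtain ⟨v, hv, hv1, hv2, -⟩ := exists_family_glue (k := i) (l := l) (r := r)
      (compatOn_zero _) (CompatOn.mono hx fun _ _ => trivial) hi.symm
  exact ⟨(mem_chainLeft_zero_iff _ _).2 ⟨u, hu, hu2, hu1 _ (Fin.zero_le _)⟩,
    (mem_chainRight_last_iff _ _).2 ⟨v, hv, hv1, hv2 _ (Fin.le_last _)⟩⟩

/-- Families are pairs of end values, so `ψ₀` and `ψ₁` give an isomorphism `Ω` of the spaces of
families. Every `E k` and `H j` is a quotient of families, since a family passes through each of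
their elements. The kernels correspond under `Ω`: vanishing at a vertex is read off from the flags,
and vanishing on a link means vanishing at both of its vertices. -/
theorem IsGiesekerChain.exists_iso (h : IsGiesekerChain l r) (h' : IsGiesekerChain l' r')
    (ψ₀ : E 0 ≃ₗ[ℂ] E' 0) (ψ₁ : E (Fin.last n) ≃ₗ[ℂ] E' (Fin.last n))
    (hF : ∀ i y, y ∈ chainLeft l r i 0 ↔ ψ₀ y ∈ chainLeft l' r' i 0)
    (hG : ∀ i y, y ∈ chainRight l r i (Fin.last n) ↔ ψ₁ y ∈ chainRight l' r' i (Fin.last n)) :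
    ∃ (f : ∀ k, E k ≃ₗ[ℂ] E' k) (g : ∀ j, H j ≃ₗ[ℂ] H' j), f 0 = ψ₀ ∧ f (Fin.last n) = ψ₁ ∧
      ∀ j x, f j.castSucc (l j x) = l' j (g j x) ∧ f j.succ (r j x) = r' j (g j x) := by
  let Ω : families l r ≃ₗ[ℂ] families l' r' :=
    LinearEquiv.ofBijective _ h.bijective_ends ≪≫ₗ ψ₀.prodCongr ψ₁ ≪≫ₗ
      (LinearEquiv.ofBijective _ h'.bijective_ends).symm
  have hΩ : ∀ x, families.ends l' r' (Ω x) = (ψ₀ (x.1.1 0), ψ₁ (x.1.1 (Fin.last n))) := by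
    intro x
    exact (LinearEquiv.ofBijective _ h'.bijective_ends).apply_symm_apply _
  have hΩ₀ : ∀ x, (Ω x).1.1 0 = ψ₀ (x.1.1 0) := fun x => congrArg Prod.fst (hΩ x)
  have hΩ₁ : ∀ x, (Ω x).1.1 (Fin.last n) = ψ₁ (x.1.1 (Fin.last n)) :=
    fun x => congrArg Prod.snd (hΩ x)
  have hker : ∀ k x, x.1.1 k = 0 ↔ (Ω x).1.1 k = 0 := by
    intro k x
    constructor
    · intro hx
      obtain ⟨h1, h2⟩ := ends_mem_of_value_eq_zero x.2 k hx
      refine h'.value_eq_zero (Ω x).2 k ?_ ?_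
      · rw [hΩ₀]; exact (hF _ _).1 h1
      · rw [hΩ₁]; exact (hG _ _).1 h2
    · intro hx
      obtain ⟨h1, h2⟩ := ends_mem_of_value_eq_zero (Ω x).2 k hx
      rw [hΩ₀] at h1
      rw [hΩ₁] at h2
      exact h.value_eq_zero x.2 k ((hF _ _).2 h1) ((hG _ _).2 h2)
  have hf : ∀ k, ∃ f : E k ≃ₗ[ℂ] E' k, ∀ x : families l r, f (x.1.1 k) = (Ω x).1.1 k := fun k =>
    exists_linearEquiv_of_surjective
      ((LinearMap.proj k ∘ₗ LinearMap.fst ℂ _ _) ∘ₗ (families l r).subtype)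
      ((LinearMap.proj k ∘ₗ LinearMap.fst ℂ _ _) ∘ₗ (families l' r').subtype)
      (fun y => by
        obtain ⟨x, hx, rfl⟩ := exists_family_through h.surjective_left h.surjective_right k y
        exact ⟨⟨x, hx⟩, rfl⟩)
      (fun y => by
        obtain ⟨x, hx, rfl⟩ := exists_family_through h'.surjective_left h'.surjective_right k y
        exact ⟨⟨x, hx⟩, rfl⟩) Ω (hker k)
  have hg : ∀ j, ∃ g : H j ≃ₗ[ℂ] H' j, ∀ x : families l r, g (x.1.2 j) = (Ω x).1.2 j := fun j =>
    exists_linearEquiv_of_surjective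
      ((LinearMap.proj j ∘ₗ LinearMap.snd ℂ _ _) ∘ₗ (families l r).subtype)
      ((LinearMap.proj j ∘ₗ LinearMap.snd ℂ _ _) ∘ₗ (families l' r').subtype)
      (fun y => by
        obtain ⟨x, hx, rfl⟩ := exists_family_through_link h.surjective_left h.surjective_right j y
        exact ⟨⟨x, hx⟩, rfl⟩)
      (fun y => by
        obtain ⟨x, hx, rfl⟩ := exists_family_through_link h'.surjective_left h'.surjective_right j y
        exact ⟨⟨x, hx⟩, rfl⟩) Ω (fun x => by
        change x.1.2 j = 0 ↔ (Ω x).1.2 j = 0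
        have hx := x.2 j trivial
        have hx' := (Ω x).2 j trivial
        constructor
        · intro h0
          rw [h0, map_zero, map_zero] at hx
          refine h'.eq_zero_of_link ?_ ?_
          · rw [hx'.1]; exact (hker _ _).1 hx.1.symm
          · rw [hx'.2]; exact (hker _ _).1 hx.2.symm
        · intro h0
          rw [h0, map_zero, map_zero] at hx'
          refine h.eq_zero_of_link ?_ ?_
          · rw [hx.1]; exact (hker _ _).2 hx'.1.symm
          · rw [hx.2]; exact (hker _ _).2 hx'.2.symm)
  choose f hf using hf
  choose g hg using hg
  refine ⟨f, g, ?_, ?_, fun j y => ?_⟩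
  · ext y
    obtain ⟨x, hx, rfl⟩ := exists_family_through h.surjective_left h.surjective_right 0 y
    exact (hf 0 ⟨x, hx⟩).trans (hΩ₀ _)
  · ext y
    obtain ⟨x, hx, rfl⟩ := exists_family_through h.surjective_left h.surjective_right (Fin.last n) y
    exact (hf _ ⟨x, hx⟩).trans (hΩ₁ _)
  · obtain ⟨x, hx, rfl⟩ := exists_family_through_link h.surjective_left h.surjective_right j y
    have h1 := hx j trivial
    have h2 := (Ω ⟨x, hx⟩).2 j trivial
    rw [h1.1, h1.2, hg j ⟨x, hx⟩, h2.1, h2.2]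
    exact ⟨hf _ ⟨x, hx⟩, hf _ ⟨x, hx⟩⟩

end Iso

end Chain
end Gieseker

end

noncomputable section

namespace Gieseker

open TopologicalSpace Opposite

/-! ### Constants -/

section Constants

variable {S T : Scheme.{0}} (f : S ⟶ pt)

lemma le_preimage_top (f : S ⟶ T) (U : S.Opens) : U ≤ f ⁻¹ᵁ ⊤ := fun _ _ => trivial

/-- Constant functions on a scheme over `ℂ`. -/
def const (U : S.Opens) : ℂ →+* Γ(S, U) :=
  ((resF (le_preimage_top f U)).comp (pbF f ⊤)).comp (Scheme.ΓSpecIso (CommRingCat.of ℂ)).inv.hom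

lemma resF_const {U V : S.Opens} (h : V ≤ U) (c : ℂ) : resF h (const f U c) = const f V c :=
  resF_resF _ _ _

lemma evF_pbF_str {s : pt ⟶ S} (hs : s ≫ f = 𝟙 pt) {U : S.Opens} (h : MemOpen s U)
    (z : Γ(pt, ⊤)) : evF s U h (resF (le_preimage_top f U) (pbF f ⊤ z)) =
      (Scheme.ΓSpecIso (CommRingCat.of ℂ)).hom z := by
  rw [evF_res, evF_comp (s := 𝟙 pt) f s hs _ le_rfl]
  change (Scheme.ΓSpecIso (CommRingCat.of ℂ)).hom (resF le_rfl (Scheme.Hom.app (𝟙 pt) ⊤ z)) = _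
  rw [Scheme.Hom.id_app]
  exact congrArg _ (resF_self _ _)

lemma evF_const {s : pt ⟶ S} (hs : s ≫ f = 𝟙 pt) {U : S.Opens} (h : MemOpen s U) (c : ℂ) :
    evF s U h (const f U c) = c :=
  (evF_pbF_str f hs h _).trans (Iso.inv_hom_id_apply (Scheme.ΓSpecIso (CommRingCat.of ℂ)) _)

lemma mem_basicOpen_of_evF_ne_zero {s : pt ⟶ S} {U : S.Opens} (h : MemOpen s U) {g : Γ(S, U)}
    (h0 : evF s U h g ≠ 0) : s pt₀ ∈ S.basicOpen g := by
  have h1 : IsUnit (resF h (pbF s U g)) :=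
    (MulEquiv.isUnit_map (Scheme.ΓSpecIso (CommRingCat.of ℂ)).commRingCatIsoToRingEquiv).1
      (isUnit_iff_ne_zero.2 h0)
  have h2 : pt.basicOpen (resF h (pbF s U g)) = ⊤ := Scheme.basicOpen_of_isUnit _ h1
  have h3 : pt₀ ∈ pt.basicOpen (resF h (pbF s U g)) := h2.ge trivial
  have h4 : pt₀ ∈ pt.basicOpen (pbF s U g) := ((pt.basicOpen_res _ _).le h3).2
  have h5 := Scheme.preimage_basicOpen s g
  exact h5.ge h4

lemma pbF_const (φ : T ⟶ S) (g : T ⟶ pt) (h : φ ≫ f = g) (U : S.Opens) (c : ℂ) :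
    pbF φ U (const f U c) = const g (φ ⁻¹ᵁ U) c := by
  subst h
  exact pbF_res φ _ _

lemma hom_pt_ext {f g : S ⟶ pt} (h : ∀ c, const f ⊤ c = const g ⊤ c) : f = g := by
  apply ext_to_Spec
  ext c
  have := h c
  simp only [const, RingHom.comp_apply] at this
  erw [resF_self, resF_self] at this
  exact this

lemma H0_smul (M : S.Modules) (c : ℂ) (m : Γ(M, ⊤)) :
    @HSMul.hSMul ℂ (H0 f M) (H0 f M) _ c m = const f ⊤ c • m := by
  exact congrArg (fun g : Γ(S, ⊤) => g • m)
    (resF_self (le_preimage_top f ⊤) (pbF f ⊤ ((Scheme.ΓSpecIso (CommRingCat.of ℂ)).inv c) : Γ(S, ⊤))).symm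

end Constants

/-! ### Functions on the projective line -/

section ProjectiveLine

attribute [local instance] MvPolynomial.gradedAlgebra

open MvPolynomial

/-- The point `x` of `ℙ¹` as a homogeneous prime ideal. -/
abbrev P1.ideal (x : P1) : Ideal (MvPolynomial (Fin 2) ℂ) :=
  HomogeneousIdeal.toIdeal (ProjectiveSpectrum.asHomogeneousIdeal (𝒜 := grading) x)

instance (x : P1) : (P1.ideal x).IsPrime := ProjectiveSpectrum.isPrime (𝒜 := grading) x

/-- The germ of a function on `ℙ¹` as a fraction. -/
def P1.germ (U : P1.Opens) (x : P1) (hx : x ∈ U) :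
    Γ(P1, U) →+* Localization.AtPrime (P1.ideal x) :=
  (algebraMap (HomogeneousLocalization.AtPrime grading (P1.ideal x)) _).comp
    (openToLocalization grading U x hx).hom

variable {U V : P1.Opens} {x : P1}

lemma P1.germ_ext {g g' : Γ(P1, U)} (h : ∀ x hx, P1.germ U x hx g = P1.germ U x hx g') : g = g' :=
  Subtype.ext (funext fun y => HomogeneousLocalization.val_injective _ (h y.1 y.2))

lemma P1.germ_resF (h : V ≤ U) (hx : x ∈ V) (g : Γ(P1, U)) :
    P1.germ V x hx (resF h g) = P1.germ U x (h hx) g := rfl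

lemma basicOpenToSpec_app {g : MvPolynomial (Fin 2) ℂ} (w : HomogeneousLocalization.Away grading g) :
    (Proj.basicOpenToSpec grading g).app ⊤ ((Scheme.ΓSpecIso _).inv w) =
      (Proj.basicOpen grading g).topIso.inv (Proj.awayToSection grading g w) := by
  rw [Proj.basicOpenToSpec_app_top]
  refine congrArg (fun z => (Proj.basicOpen grading g).topIso.inv (Proj.awayToSection grading g z))
    (?_ : (Scheme.ΓSpecIso (CommRingCat.of (HomogeneousLocalization.Away grading g))).hom _ = w)
  exact Iso.inv_hom_id_apply
    (Scheme.ΓSpecIso (CommRingCat.of (HomogeneousLocalization.Away grading g))) w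

/-- The basic open set of `1` is everything, and on it the morphism is `Spec` of the inclusion of
the degree 0 part. -/
lemma toSpecZero_app (c : grading 0) (U : P1.Opens) (hx : x ∈ U) :
    P1.germ U x hx (resF (le_preimage_top _ _) (pbF (Proj.toSpecZero grading) ⊤ ((Scheme.ΓSpecIso _).inv c))) =
      algebraMap _ _ (c : MvPolynomial (Fin 2) ℂ) := by
  have h1 : (Proj.basicOpen grading 1).ι ≫ Proj.toSpecZero grading =
      Proj.basicOpenToSpec grading 1 ≫
        Spec.map (CommRingCat.ofHom (HomogeneousLocalization.fromZeroRingHom grading _)) := by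
    rw [Proj.toSpecZero, ← Category.assoc, ← Category.assoc,
      show ((Proj.basicOpen grading 1).ι ≫ (Scheme.topIso _).inv) ≫
        (Scheme.isoOfEq _ (Proj.basicOpen_one _)).inv = 𝟙 _ by simp [← cancel_mono (Proj.basicOpen grading 1).ι] ]
    simp
  have h2 := congr(($h1).appTop ((Scheme.ΓSpecIso _).inv c))
  have h3 := congr($(Scheme.ΓSpecIso_inv_naturality (CommRingCat.ofHom (HomogeneousLocalization.fromZeroRingHom grading (Submonoid.powers (1 : MvPolynomial (Fin 2) ℂ))))) c)
  have h4 := basicOpenToSpec_app (g := 1) (HomogeneousLocalization.fromZeroRingHom grading _ c)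
  have h5 := h2.trans ((congrArg ((Proj.basicOpenToSpec grading 1).app ⊤).hom h3.symm).trans h4)
  have hx' : x ∈ (Proj.basicOpen grading 1).ι ''ᵁ ⊤ := by
    rw [Scheme.Opens.ι_image_top, Proj.basicOpen_one]; trivial
  exact congrArg (fun g : Γ(P1, (Proj.basicOpen grading 1).ι ''ᵁ ⊤) => P1.germ _ x hx' g) h5

lemma P1.germ_const (hx : x ∈ U) (c : ℂ) :
    P1.germ U x hx (const P1.str U c) = algebraMap _ _ (C c : MvPolynomial (Fin 2) ℂ) := by
  rw [← MvPolynomial.algebraMap_eq]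
  refine Eq.trans ?_ (toSpecZero_app (algebraMap ℂ (grading 0) c) U hx)
  refine congrArg (fun g => P1.germ U x hx (resF (le_preimage_top _ _) g)) ?_
  have h := ConcreteCategory.congr_hom (Scheme.ΓSpecIso_inv_naturality
    (CommRingCat.ofHom (algebraMap ℂ (grading 0)))) c
  have h2 : (Scheme.ΓSpecIso (CommRingCat.of (grading 0))).inv (algebraMap ℂ (grading 0) c) =
    pbF (Spec.map (CommRingCat.ofHom (algebraMap ℂ (grading 0)))) ⊤ ((Scheme.ΓSpecIso (CommRingCat.of ℂ)).inv c) := h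
  rw [h2]
  exact pbF_comp (Proj.toSpecZero grading) (Spec.map (CommRingCat.ofHom (algebraMap ℂ (grading 0)))) _

lemma P1.mem_chart {i : Fin 2} : x ∈ P1.chart i ↔ X i ∉ P1.ideal x := Iff.rfl

/-- The coordinate `x_m / x_i` on the chart `{x_i ≠ 0}`. -/
def P1.ratio (i m : Fin 2) : Γ(P1, P1.chart i) :=
  Proj.awayToSection grading (X i)
    (HomogeneousLocalization.Away.mk grading (d := 1) (isHomogeneous_X ℂ i) 1
      (X m) (by simpa using isHomogeneous_X ℂ m))

lemma P1.germ_away {f g : MvPolynomial (Fin 2) ℂ} {d : ℕ} (hf : f ∈ grading d)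
    (hg : g ∈ grading (1 • d)) (hx : x ∈ Proj.basicOpen grading f) :
    P1.germ (Proj.basicOpen grading f) x hx
      (Proj.awayToSection grading f (HomogeneousLocalization.Away.mk grading hf 1 g hg)) *
        algebraMap _ _ f = algebraMap _ _ g := by
  have h : P1.germ (Proj.basicOpen grading f) x hx
      (Proj.awayToSection grading f (HomogeneousLocalization.Away.mk grading hf 1 g hg)) =
    Localization.mk g (⟨f, hx⟩ : (P1.ideal x).primeCompl) := by
    refine Eq.trans (b := Localization.mk g (⟨f ^ 1, _⟩ : (P1.ideal x).primeCompl)) rfl ?_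
    simp only [pow_one]
  rw [h, Localization.mk_eq_mk']
  exact IsLocalization.mk'_spec _ _ _

lemma P1.germ_ratio {i : Fin 2} (hx : x ∈ P1.chart i) (m : Fin 2) :
    P1.germ _ x hx (P1.ratio i m) * algebraMap _ _ (X i : MvPolynomial (Fin 2) ℂ) =
      algebraMap _ _ (X m : MvPolynomial (Fin 2) ℂ) :=
  P1.germ_away _ _ hx

/-- Dehomogenization. -/
def P1.dehom (i : Fin 2) : MvPolynomial (Fin 2) ℂ →+* Γ(P1, P1.chart i) :=
  eval₂Hom (const P1.str _) (P1.ratio i)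

lemma eval₂_mul_of_isHomogeneous {R A : Type*} [CommRing R] [CommRing A] {σ : Type*}
    {f : MvPolynomial σ R} {d : ℕ} (hf : f.IsHomogeneous d) (g : R →+* A) (y : σ → A) (c : A) :
    eval₂ g (fun m => y m * c) f = eval₂ g y f * c ^ d := by
  rw [eval₂_eq, eval₂_eq, Finset.sum_mul]
  refine Finset.sum_congr rfl fun m hm => ?_
  simp_rw [mul_pow, Finset.prod_mul_distrib, Finset.prod_pow_eq_pow_sum]
  rw [← hf (mem_support_iff.1 hm), mul_assoc]
  simp [Finsupp.weight_apply, Finsupp.sum]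

lemma P1.hom_dehom {A : Type*} [CommRing A] {i : Fin 2} (φ : Γ(P1, P1.chart i) →+* A)
    {f : MvPolynomial (Fin 2) ℂ} {d : ℕ} (hf : f.IsHomogeneous d) (g : ℂ →+* A)
    (hg : ∀ c, φ (const P1.str _ c) = g c) (a : A) (y : Fin 2 → A)
    (hy : ∀ m, φ (P1.ratio i m) * a = y m) : φ (P1.dehom i f) * a ^ d = eval₂ g y f := by
  obtain rfl : φ.comp (const P1.str _) = g := RingHom.ext hg
  change φ (eval₂ _ _ f) * _ = _
  rw [hom_eval₂, ← eval₂_mul_of_isHomogeneous hf]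
  exact congrArg (fun y => eval₂ _ y f) (funext hy)

/-- Clears denominators. Identities between functions on `ℙ¹` can be checked on polynomials, since
`X i` is a unit in the local rings on its chart. -/
lemma P1.germ_dehom {i : Fin 2} (hx : x ∈ P1.chart i) {f : MvPolynomial (Fin 2) ℂ} {d : ℕ}
    (hf : f.IsHomogeneous d) :
    P1.germ _ x hx (P1.dehom i f) * algebraMap _ _ (X i : MvPolynomial (Fin 2) ℂ) ^ d =
      algebraMap _ _ f := by
  rw [P1.hom_dehom (P1.germ _ x hx) hf ((algebraMap _ _).comp C) (P1.germ_const _) _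
    (fun m => algebraMap _ _ (X m)) (P1.germ_ratio hx)]
  exact (hom_eval₂ f C (algebraMap _ _) X).symm.trans (by rw [eval₂_eta])

lemma P1.isUnit_algebraMap {f : MvPolynomial (Fin 2) ℂ} (hf : f ∉ P1.ideal x) :
    IsUnit (algebraMap _ (Localization.AtPrime (P1.ideal x)) f) :=
  IsLocalization.map_units _ (⟨f, hf⟩ : (P1.ideal x).primeCompl)

lemma P1.dehom_ne_zero {i : Fin 2} (hx : x ∈ P1.chart i) {f : MvPolynomial (Fin 2) ℂ} {d : ℕ}
    (hf : f.IsHomogeneous d) (h0 : f ≠ 0) : P1.dehom i f ≠ 0 := by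
  intro h
  have := P1.germ_dehom hx hf
  rw [h, map_zero, zero_mul] at this
  exact h0 ((IsLocalization.to_map_eq_zero_iff (Localization.AtPrime (P1.ideal x))
    (Ideal.primeCompl_le_nonZeroDivisors (P1.ideal x))).1 this.symm)

lemma P1.dehom_X (i m : Fin 2) : P1.dehom i (X m) = P1.ratio i m := eval₂_X _ _ _

lemma P1.dehom_C (i : Fin 2) (c : ℂ) : P1.dehom i (C c) = const P1.str _ c := eval₂_C _ _ _

lemma P1.ratio_self (i : Fin 2) : P1.ratio i i = 1 :=
  P1.germ_ext fun x hx => (P1.isUnit_algebraMap hx).mul_right_cancel (by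
    rw [P1.germ_ratio, map_one, one_mul])

lemma P1.resF_dehom (i k : Fin 2) {f : MvPolynomial (Fin 2) ℂ} {d : ℕ} (hf : f.IsHomogeneous d)
    (hi : U ≤ P1.chart i) (hk : U ≤ P1.chart k) :
    resF hi (P1.dehom i f) = resF hi (P1.ratio i k) ^ d * resF hk (P1.dehom k f) :=
  P1.germ_ext fun x hx => ((P1.isUnit_algebraMap (hi hx)).pow d).mul_right_cancel (by
    rw [map_mul, map_pow, P1.germ_resF, P1.germ_resF, P1.germ_resF, P1.germ_dehom _ hf,
      mul_right_comm, ← mul_pow, P1.germ_ratio, mul_comm, P1.germ_dehom _ hf])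

lemma P1.exists_mem_chart (x : P1) : ∃ i, x ∈ P1.chart i := by
  by_contra! h
  have h0 : ∀ i, (X i : MvPolynomial (Fin 2) ℂ) ∈ P1.ideal x := fun i => by
    have := h i
    rwa [P1.mem_chart, not_not] at this
  refine ProjectiveSpectrum.not_irrelevant_le (𝒜 := grading) x
    ((HomogeneousIdeal.toIdeal_irrelevant_le (𝒜 := grading) (I := P1.ideal x)).2 ?_)
  intro d hd f hf
  rw [f.as_sum]
  refine Ideal.sum_mem _ fun m hm => ?_
  have hm0 : m ≠ 0 := by
    rintro rfl
    have := hf (mem_support_iff.1 hm)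
    simp at this
    omega
  obtain ⟨i, hi⟩ := Finsupp.ne_iff.1 hm0
  exact Ideal.mem_of_dvd _ (X_dvd_monomial.2 (Or.inr hi)) (h0 i)

lemma P1.ext_of_homogeneous {x y : P1} (h : ∀ {f : MvPolynomial (Fin 2) ℂ} {d : ℕ},
    f.IsHomogeneous d → (f ∈ P1.ideal x ↔ f ∈ P1.ideal y)) : x = y := by
  have hh := fun x : P1 => HomogeneousIdeal.isHomogeneous (𝒜 := grading)
    (ProjectiveSpectrum.asHomogeneousIdeal (𝒜 := grading) x)
  refine ProjectiveSpectrum.ext (𝒜 := grading) (HomogeneousIdeal.ext (Ideal.ext fun f => ?_))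
  rw [mem_iff_homogeneousComponent_mem (hh _), mem_iff_homogeneousComponent_mem (hh _)]
  exact forall_congr' fun n => h (homogeneousComponent_isHomogeneous n f)

/-! ### Points of the projective line -/

section Points

variable {s : pt ⟶ P1} {v : Fin 2 → ℂ}

/-- If `f` is not in the prime of the point, then `x_i ^ d / f` is a function near the point and
inverse to `f / x_i ^ d`. Conversely, a nonvanishing function has invertible germ. -/
lemma P1.evF_dehom_ne_zero_iff {i : Fin 2} (h : MemOpen s (P1.chart i))
    {f : MvPolynomial (Fin 2) ℂ} {d : ℕ} (hf : f.IsHomogeneous d) :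
    evF s _ h (P1.dehom i f) ≠ 0 ↔ f ∉ P1.ideal (s pt₀) := by
  have hs : s pt₀ ∈ P1.chart i := memOpen_iff_mem.1 h
  constructor
  · intro h0
    have hx : s pt₀ ∈ P1.basicOpen (P1.dehom i f) :=
      mem_basicOpen_of_evF_ne_zero h h0
    have hu : IsUnit (resF (P1.basicOpen_le (P1.dehom i f)) (P1.dehom i f)) :=
      RingedSpace.isUnit_res_basicOpen _ _
    have := (hu.map (P1.germ _ _ hx)).mul ((P1.isUnit_algebraMap hs).pow d)
    rw [P1.germ_resF, P1.germ_dehom _ hf] at this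
    exact (IsLocalization.AtPrime.isUnit_to_map_iff _ (P1.ideal (s pt₀)) f).1 this
  · intro h0 he
    let D : P1.Opens := Proj.basicOpen grading f
    have hU : MemOpen s (P1.chart i ⊓ D) := memOpen_iff_mem.2 ⟨hs, h0⟩
    let g : Γ(P1, D) :=
      Proj.awayToSection grading f (HomogeneousLocalization.Away.mk grading hf 1 (X i ^ d)
        (by rw [one_smul]; exact isHomogeneous_X_pow i d))
    have hg : resF inf_le_left (P1.dehom i f) *
        (resF inf_le_right g : Γ(P1, P1.chart i ⊓ D)) = 1 := by
      refine P1.germ_ext fun x hx => ((P1.isUnit_algebraMap hx.1).pow d).mul_right_cancel ?_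
      rw [map_mul, map_one, one_mul, P1.germ_resF, P1.germ_resF, mul_right_comm,
        P1.germ_dehom _ hf, mul_comm, ← map_pow]
      exact P1.germ_away _ _ hx.2
    have := congrArg (evF s _ hU) hg
    rw [map_mul, evF_res, he, zero_mul, map_one] at this
    exact zero_ne_one this

/-- The `ℂ`-point `s` of `ℙ¹` has the homogeneous coordinates `v`. -/
structure HasCoords (s : pt ⟶ P1) (v : Fin 2 → ℂ) : Prop where
  str : s ≫ P1.str = 𝟙 pt
  memOpen_iff : ∀ i, MemOpen s (P1.chart i) ↔ v i ≠ 0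
  evF_ratio : ∀ i (h : MemOpen s (P1.chart i)) m, evF s _ h (P1.ratio i m) * v i = v m

lemma HasCoords.evF_dehom (hs : HasCoords s v) {i : Fin 2} (h : MemOpen s (P1.chart i))
    {f : MvPolynomial (Fin 2) ℂ} {d : ℕ} (hf : f.IsHomogeneous d) :
    evF s _ h (P1.dehom i f) * v i ^ d = eval v f := by
  rw [P1.hom_dehom (evF s _ h) hf (RingHom.id ℂ) (evF_const _ hs.str h) _ v (hs.evF_ratio i h)]
  rfl

lemma HasCoords.exists_memOpen (s : pt ⟶ P1) : ∃ i, MemOpen s (P1.chart i) := by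
  obtain ⟨i, hi⟩ := P1.exists_mem_chart (s pt₀)
  exact ⟨i, memOpen_iff_mem.2 hi⟩

lemma HasCoords.evF_dehom_eq_zero_iff (hs : HasCoords s v) {i : Fin 2}
    (h : MemOpen s (P1.chart i)) {f : MvPolynomial (Fin 2) ℂ} {d : ℕ} (hf : f.IsHomogeneous d) :
    evF s _ h (P1.dehom i f) = 0 ↔ eval v f = 0 := by
  rw [← hs.evF_dehom h hf, mul_eq_zero, or_iff_left (pow_ne_zero _ ((hs.memOpen_iff i).1 h))]

lemma HasCoords.mem_ideal_iff (hs : HasCoords s v) {f : MvPolynomial (Fin 2) ℂ} {d : ℕ}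
    (hf : f.IsHomogeneous d) : f ∈ P1.ideal (s pt₀) ↔ eval v f = 0 := by
  obtain ⟨i, hi⟩ := HasCoords.exists_memOpen s
  rw [← hs.evF_dehom_eq_zero_iff hi hf, ← not_iff_not, ← P1.evF_dehom_ne_zero_iff hi hf]

/-- Choose a chart `i` containing the point and take the values of `x_m / x_i` as coordinates. -/
lemma exists_hasCoords (hs : s ≫ P1.str = 𝟙 pt) : ∃ v, HasCoords s v := by
  obtain ⟨i, hi⟩ := HasCoords.exists_memOpen s
  have key : ∀ k (hk : MemOpen s (P1.chart k)) m, evF s _ hi (P1.ratio i m) =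
      evF s _ hi (P1.ratio i k) * evF s _ hk (P1.ratio k m) := by
    intro k hk m
    have hU : MemOpen s (P1.chart i ⊓ P1.chart k) := le_inf hi hk
    have := congrArg (evF s _ hU)
      (P1.resF_dehom i k (isHomogeneous_X ℂ m) inf_le_left inf_le_right)
    rwa [map_mul, pow_one, evF_res, evF_res, evF_res, P1.dehom_X, P1.dehom_X] at this
  refine ⟨fun m => evF s _ hi (P1.ratio i m), hs, fun k => ⟨fun hk h0 => ?_, fun h0 => ?_⟩,
    fun k hk m => ?_⟩
  · have := key k hk i
    rw [h0, P1.ratio_self, zero_mul, map_one] at this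
    exact one_ne_zero this
  · rw [← P1.dehom_X, P1.evF_dehom_ne_zero_iff hi (isHomogeneous_X ℂ k)] at h0
    exact memOpen_iff_mem.2 h0
  · rw [key k hk m, mul_comm]

/-- Proportional coordinates annihilate the same forms, hence define the same homogeneous prime;
`point_ext` passes from points to morphisms. -/
lemma HasCoords.eq {t : pt ⟶ P1} {w : Fin 2 → ℂ} (hs : HasCoords s v) (ht : HasCoords t w)
    {c : ℂ} (hc : w = c • v) : s = t := by
  have hc0 : c ≠ 0 := by
    rintro rfl
    obtain ⟨i, hi⟩ := HasCoords.exists_memOpen t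
    exact (ht.memOpen_iff i).1 hi (by simp [hc])
  refine point_ext P1.str hs.str ht.str ?_
  have key : ∀ {f : MvPolynomial (Fin 2) ℂ} {d : ℕ}, f.IsHomogeneous d →
      (f ∈ P1.ideal (s pt₀) ↔ f ∈ P1.ideal (t pt₀)) := by
    intro f d hf
    rw [hs.mem_ideal_iff hf, ht.mem_ideal_iff hf]
    have h1 : eval w f = eval v f * c ^ d := by
      have := eval₂_mul_of_isHomogeneous hf (RingHom.id ℂ) v c
      rw [hc]
      rw [show c • v = fun m => v m * c from _root_.funext fun m => mul_comm _ _]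
      exact this
    rw [h1, mul_eq_zero, or_iff_left (pow_ne_zero _ hc0)]
  exact P1.ext_of_homogeneous key

end Points

end ProjectiveLine

end Gieseker

end

noncomputable section

namespace Gieseker

open TopologicalSpace Opposite

/-! ### Automorphisms of the projective line -/

section Automorphisms

attribute [local instance] MvPolynomial.gradedAlgebra

open MvPolynomial

/-- A linear change of coordinates, as a map of graded rings. -/
def gradedAeval (y : Fin 2 → MvPolynomial (Fin 2) ℂ) (hy : ∀ m, (y m).IsHomogeneous 1) :
    grading →+*ᵍ grading where
  toRingHom := (aeval y).toRingHom
  map_mem {d f} hf := by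
    have := IsHomogeneous.aeval (n := 1) (m := d) (φ := f) hf y hy
    rwa [one_mul] at this

/-- A right inverse makes every form of positive degree an image. This is the condition for
`Proj.map` to be defined everywhere. -/
lemma irrelevant_le_map {σ τ : grading →+*ᵍ grading} (h : ∀ f, σ (τ f) = f) :
    HomogeneousIdeal.irrelevant grading ≤ (HomogeneousIdeal.irrelevant grading).map σ := by
  refine (HomogeneousIdeal.toIdeal_irrelevant_le (𝒜 := grading)
    (I := ((HomogeneousIdeal.irrelevant grading).map σ).toIdeal)).2 fun i hi x hx => ?_
  have hx' : σ (τ x) ∈ Ideal.map σ (HomogeneousIdeal.irrelevant grading).toIdeal :=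
    Ideal.mem_map_of_mem _ (HomogeneousIdeal.mem_irrelevant_of_mem grading hi (τ.map_mem hx))
  rwa [h] at hx'

variable {σ τ : grading →+*ᵍ grading} (h : ∀ f, σ (τ f) = f)

/-- The automorphism of the projective line defined by a change of coordinates. -/
def P1.map : P1 ⟶ P1 := Proj.map σ (irrelevant_le_map h)

lemma P1.mem_ideal_map {x : P1} {f : MvPolynomial (Fin 2) ℂ} :
    f ∈ P1.ideal (P1.map h x) ↔ σ f ∈ P1.ideal x := Iff.rfl

lemma P1.ideal_map (x : P1) : P1.ideal (P1.map h x) = (P1.ideal x).comap σ.toRingHom := rfl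

/-- The map of local rings induced by a change of coordinates. -/
def P1.localMap (x : P1) : Localization.AtPrime (P1.ideal (P1.map h x)) →+*
    Localization.AtPrime (P1.ideal x) :=
  Localization.localRingHom _ _ σ.toRingHom (P1.ideal_map h x)

lemma P1.localMap_algebraMap (x : P1) (f : MvPolynomial (Fin 2) ℂ) :
    P1.localMap h x (algebraMap _ _ f) = algebraMap _ _ (σ f) :=
  Localization.localRingHom_to_map _ _ _ _ _

lemma P1.germ_pbF_map {U : P1.Opens} {x : P1} (hx : x ∈ P1.map h ⁻¹ᵁ U) (g : Γ(P1, U)) :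
    P1.germ _ x hx (pbF (P1.map h) U g) = P1.localMap h x (P1.germ U (P1.map h x) hx g) :=
  HomogeneousLocalization.val_localRingHom ..

lemma isHomogeneous_map (σ : grading →+*ᵍ grading) {f : MvPolynomial (Fin 2) ℂ} {d : ℕ}
    (hf : f.IsHomogeneous d) : (σ f).IsHomogeneous d := σ.map_mem hf

/-- The pullback of `f / x_k ^ d` is `σ f / (σ x_k) ^ d`; the equation is written without
denominators, on the chart `i` of the source. -/
lemma P1.pbF_map_dehom (i k : Fin 2) {U : P1.Opens} (hi : U ≤ P1.chart i)
    (hk : U ≤ P1.map h ⁻¹ᵁ P1.chart k) {f : MvPolynomial (Fin 2) ℂ} {d : ℕ}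
    (hf : f.IsHomogeneous d) :
    resF hk (pbF (P1.map h) _ (P1.dehom k f)) * resF hi (P1.dehom i (σ (X k))) ^ d =
      resF hi (P1.dehom i (σ f)) := by
  refine P1.germ_ext fun x hx => ((P1.isUnit_algebraMap (hi hx)).pow d).mul_right_cancel ?_
  have h1 := congrArg (P1.localMap h x) (P1.germ_dehom (hk hx) hf)
  rw [map_mul, map_pow, P1.localMap_algebraMap, P1.localMap_algebraMap,
    ← P1.germ_pbF_map h (hk hx)] at h1
  have h2 := P1.germ_dehom (hi hx) (isHomogeneous_map σ (isHomogeneous_X ℂ k))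
  rw [pow_one] at h2
  rw [map_mul, map_pow, P1.germ_resF, P1.germ_resF, P1.germ_resF, mul_assoc, ← mul_pow,
    P1.germ_dehom (hi hx) (isHomogeneous_map σ hf), h2]
  exact h1

lemma P1.map_str (hc : ∀ c, σ (C c) = C c) : P1.map h ≫ P1.str = P1.str := by
  refine hom_pt_ext fun c => ?_
  refine (pbF_const P1.str (P1.map h) _ rfl ⊤ c).symm.trans (P1.germ_ext fun x hx => ?_)
  refine (P1.germ_pbF_map h (U := ⊤) hx _).trans ?_
  refine (congrArg (P1.localMap h x) (P1.germ_const (x := P1.map h x) (U := ⊤) trivial c)).trans ?_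
  rw [P1.localMap_algebraMap, hc]
  exact (P1.germ_const _ c).symm

lemma P1.map_comp_map (h' : ∀ f, τ (σ f) = f) : P1.map h ≫ P1.map h' = 𝟙 P1 := by
  have h1 : σ.comp τ = GradedRingHom.id grading := by
    ext f : 1
    exact h f
  have h2 := Proj.map_comp τ σ (irrelevant_le_map h') (irrelevant_le_map h)
  refine h2.symm.trans ?_
  simp only [h1]
  exact Proj.map_id (𝒜 := grading)

lemma HasCoords.comp_map {s : pt ⟶ P1} {v : Fin 2 → ℂ} (hs : HasCoords s v)
    (hc : ∀ c, σ (C c) = C c) (hv : ∀ {f : MvPolynomial (Fin 2) ℂ} {d : ℕ}, f.IsHomogeneous d →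
      (eval v (σ f) = 0 ↔ eval v f = 0)) : s ≫ P1.map h = s := by
  refine point_ext P1.str ?_ hs.str ?_
  · rw [Category.assoc, P1.map_str h hc, hs.str]
  · refine P1.ext_of_homogeneous fun {f d} hf => ?_
    rw [Scheme.Hom.comp_apply, P1.mem_ideal_map, hs.mem_ideal_iff hf,
      hs.mem_ideal_iff (isHomogeneous_map σ hf), hv hf]

variable {v w : Fin 2 → ℂ}

/-- The linear form vanishing at the point with coordinates `v`. -/
def vanishing (v : Fin 2 → ℂ) : MvPolynomial (Fin 2) ℂ := C (v 1) * X 0 - C (v 0) * X 1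

lemma vanishing_isHomogeneous (v : Fin 2 → ℂ) : (vanishing v).IsHomogeneous 1 :=
  (isHomogeneous_C_mul_X _ _).sub (isHomogeneous_C_mul_X _ _)

lemma eval_vanishing (v w : Fin 2 → ℂ) : eval w (vanishing v) = v 1 * w 0 - v 0 * w 1 := by
  simp [vanishing]

lemma eval_vanishing_self (v : Fin 2 → ℂ) : eval v (vanishing v) = 0 := by
  rw [eval_vanishing]; ring

/-- The change of coordinates which fixes `vanishing w` and multiplies `vanishing v` by `κ`. -/
def scaling (v w : Fin 2 → ℂ) (κ : ℂ) : grading →+*ᵍ grading :=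
  gradedAeval (fun m => C (v m / eval v (vanishing w)) * vanishing w +
    C (κ * (w m / eval w (vanishing v))) * vanishing v)
    (fun _ => ((vanishing_isHomogeneous w).C_mul _).add ((vanishing_isHomogeneous v).C_mul _))

lemma scaling_C (κ c : ℂ) : scaling v w κ (C c) = C c := aeval_C _ _

lemma scaling_X (κ : ℂ) (m : Fin 2) :
    scaling v w κ (X m) = C (v m / eval v (vanishing w)) * vanishing w +
      C (κ * (w m / eval w (vanishing v))) * vanishing v := aeval_X _ _

lemma scaling_vanishing_right (κ : ℂ) (h : eval v (vanishing w) ≠ 0) :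
    scaling v w κ (vanishing w) = vanishing w := by
  have h' : eval w (vanishing v) ≠ 0 := by
    rw [eval_vanishing] at h ⊢
    exact fun h0 => h (by linear_combination -h0)
  conv_lhs => rw [vanishing, map_sub, map_mul, map_mul, scaling_C, scaling_C, scaling_X, scaling_X]
  have e : ∀ a b c d e f : ℂ, C a * (C b * vanishing w + C c * vanishing v) -
      C d * (C e * vanishing w + C f * vanishing v) =
      C (a * b - d * e) * vanishing w + C (a * c - d * f) * vanishing v := by
    intros; simp only [map_sub, map_mul]; ring
  rw [e, show w 1 * (v 0 / eval v (vanishing w)) - w 0 * (v 1 / eval v (vanishing w)) = 1 by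
      field_simp; rw [eval_vanishing],
    show w 1 * (κ * (w 0 / eval w (vanishing v))) - w 0 * (κ * (w 1 / eval w (vanishing v))) = 0
      by field_simp; ring, map_one, map_zero]
  ring

lemma scaling_vanishing_left (κ : ℂ) (h : eval v (vanishing w) ≠ 0) :
    scaling v w κ (vanishing v) = C κ * vanishing v := by
  have h' : eval w (vanishing v) ≠ 0 := by
    rw [eval_vanishing] at h ⊢
    exact fun h0 => h (by linear_combination -h0)
  conv_lhs => rw [vanishing, map_sub, map_mul, map_mul, scaling_C, scaling_C, scaling_X, scaling_X]
  have e : ∀ a b c d e f : ℂ, C a * (C b * vanishing w + C c * vanishing v) -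
      C d * (C e * vanishing w + C f * vanishing v) =
      C (a * b - d * e) * vanishing w + C (a * c - d * f) * vanishing v := by
    intros; simp only [map_sub, map_mul]; ring
  rw [e, show v 1 * (v 0 / eval v (vanishing w)) - v 0 * (v 1 / eval v (vanishing w)) = 0 by
      field_simp; ring,
    show v 1 * (κ * (w 0 / eval w (vanishing v))) - v 0 * (κ * (w 1 / eval w (vanishing v))) = κ
      by field_simp; rw [eval_vanishing], map_zero]
  ring

/-- The two linear forms are a basis because the points are distinct. This is the expansion of the
coordinates that `scaling` deforms by `κ`. -/
lemma sum_vanishing (h : eval v (vanishing w) ≠ 0) (m : Fin 2) :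
    C (v m / eval v (vanishing w)) * vanishing w +
      C (w m / eval w (vanishing v)) * vanishing v = X m := by
  have h1 : eval v (vanishing w) = w 1 * v 0 - w 0 * v 1 := eval_vanishing _ _
  have h2 : eval w (vanishing v) = -(w 1 * v 0 - w 0 * v 1) := by rw [eval_vanishing]; ring
  rw [h2, h1]
  rw [h1] at h
  have e : ∀ a b : ℂ, C a * vanishing w + C b * vanishing v =
      C (a * w 1 + b * v 1) * X 0 - C (a * w 0 + b * v 0) * X 1 := by
    intros; simp only [vanishing, map_add, map_mul]; ring
  rw [e]
  fin_cases m
  · have e1 : v 0 / (w 1 * v 0 - w 0 * v 1) * w 1 + w 0 / -(w 1 * v 0 - w 0 * v 1) * v 1 = 1 := by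
      rw [div_neg, neg_mul, div_mul_eq_mul_div, div_mul_eq_mul_div, ← sub_eq_add_neg, ← sub_div,
        div_eq_one_iff_eq h]
      ring
    have e2 : v 0 / (w 1 * v 0 - w 0 * v 1) * w 0 + w 0 / -(w 1 * v 0 - w 0 * v 1) * v 0 = 0 := by
      field_simp; ring
    simp only [Fin.zero_eta, Fin.isValue]
    rw [e1, e2]; simp
  · have e1 : v 1 / (w 1 * v 0 - w 0 * v 1) * w 1 + w 1 / -(w 1 * v 0 - w 0 * v 1) * v 1 = 0 := by
      field_simp; ring
    have e2 : v 1 / (w 1 * v 0 - w 0 * v 1) * w 0 + w 1 / -(w 1 * v 0 - w 0 * v 1) * v 0 = -1 := by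
      rw [div_neg, neg_mul, div_mul_eq_mul_div, div_mul_eq_mul_div, ← sub_eq_add_neg, ← sub_div,
        div_eq_iff h]
      ring
    simp only [Fin.mk_one, Fin.isValue]
    rw [e1, e2]; simp

lemma scaling_scaling {κ κ' : ℂ} (hκ : κ * κ' = 1) (h : eval v (vanishing w) ≠ 0)
    (f : MvPolynomial (Fin 2) ℂ) : scaling v w κ (scaling v w κ' f) = f := by
  have key : ∀ m, scaling v w κ (scaling v w κ' (X m)) = X m := by
    intro m
    rw [scaling_X, map_add, map_mul, map_mul, scaling_C, scaling_C, scaling_vanishing_right κ h,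
      scaling_vanishing_left κ h, ← sum_vanishing h m, ← mul_assoc, ← map_mul, mul_right_comm,
      mul_comm κ' κ, hκ, one_mul]
  induction f using MvPolynomial.induction_on with
  | C a => rw [scaling_C, scaling_C]
  | add p q hp hq => rw [map_add, map_add, hp, hq]
  | mul_X p m hp => rw [map_mul, map_mul, hp, key]

/-- The scaled form `vanishing v` is zero at `v`, so the change of coordinates is not seen there. -/
lemma eval_scaling_left (κ : ℂ) (h : eval v (vanishing w) ≠ 0) (f : MvPolynomial (Fin 2) ℂ) :
    eval v (scaling v w κ f) = eval v f := by
  have : (eval v).comp (scaling v w κ).toRingHom = eval v := by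
    refine MvPolynomial.ringHom_ext (fun c => congrArg (eval v) (scaling_C κ c)) fun m => ?_
    refine (congrArg (eval v) (scaling_X κ m)).trans ?_
    simp [eval_vanishing_self, h]
  exact congr($this f)

/-- At `w` only the scaled term survives, so homogeneous coordinates are multiplied by `κ`; the
point is still fixed. -/
lemma eval_scaling_right {κ : ℂ} (h : eval w (vanishing v) ≠ 0)
    {f : MvPolynomial (Fin 2) ℂ} {d : ℕ} (hf : f.IsHomogeneous d) :
    eval w (scaling v w κ f) = eval w f * κ ^ d := by
  have : (eval w).comp (scaling v w κ).toRingHom = eval fun m => w m * κ := by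
    refine MvPolynomial.ringHom_ext (fun c => ?_) fun m => ?_
    · refine (congrArg (eval w) (scaling_C κ c)).trans ?_
      simp
    · refine (congrArg (eval w) (scaling_X κ m)).trans ?_
      simp [eval_vanishing_self]
      field_simp
  exact (congr($this f)).trans (eval₂_mul_of_isHomogeneous hf (RingHom.id ℂ) w κ)

end Automorphisms

end Gieseker

end

noncomputable section

namespace Gieseker

open TopologicalSpace Opposite

/-! ### Maps of modules defined on generators -/

section Generators

variable {S T : Scheme.{0}} {f : S ⟶ T} {M : T.Modules} {P : S.Modules} {κ : Type} [Fintype κ]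

/-- Linear combinations of global sections. -/
def lin (g : κ → Γ(M, ⊤)) (W : T.Opens) (c : κ → Γ(T, W)) : Γ(M, W) :=
  ∑ k, c k • res le_top (g k)

lemma res_lin (g : κ → Γ(M, ⊤)) {W V : T.Opens} (h : V ≤ W) (c : κ → Γ(T, W)) :
    res h (lin g W c) = lin g V (fun k => resF h (c k)) := by
  simp [lin]

lemma lin_add (g : κ → Γ(M, ⊤)) {W : T.Opens} (c d : κ → Γ(T, W)) :
    lin g W (c + d) = lin g W c + lin g W d := by
  simp [lin, add_smul, Finset.sum_add_distrib]

lemma lin_sub (g : κ → Γ(M, ⊤)) {W : T.Opens} (c d : κ → Γ(T, W)) :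
    lin g W (c - d) = lin g W c - lin g W d := by
  simp [lin, sub_smul, Finset.sum_sub_distrib]

lemma lin_smul (g : κ → Γ(M, ⊤)) {W : T.Opens} (a : Γ(T, W)) (c : κ → Γ(T, W)) :
    lin g W (a • c) = a • lin g W c := by
  simp [lin, Finset.smul_sum, mul_smul]

/-- The global sections `g` generate `M` locally. -/
def Generates (g : κ → Γ(M, ⊤)) : Prop :=
  ∀ x : T, ∃ V : T.Opens, x ∈ V ∧ ∀ W ≤ V, Function.Surjective (lin g W)

variable (f) in
/-- The pullback of a family of functions. -/
abbrev pbC {W : T.Opens} (c : κ → Γ(T, W)) : κ → Γ(S, f ⁻¹ᵁ W) := fun k => pbF f W (c k)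

lemma SemiHom.app_lin_congr {g : κ → Γ(M, ⊤)} {g' : κ → Γ(P, ⊤)}
    (hrel : ∀ W c, lin g W c = 0 → lin g' (f ⁻¹ᵁ W) (pbC f c) = 0) {W : T.Opens}
    {c d : κ → Γ(T, W)} (h : lin g W c = lin g W d) :
    lin g' (f ⁻¹ᵁ W) (pbC f c) = lin g' (f ⁻¹ᵁ W) (pbC f d) := by
  have := hrel W (c - d) (by rw [lin_sub, h, sub_self])
  rw [show pbC f (c - d) = pbC f c - pbC f d from _root_.funext fun k => map_sub _ _ _,
    lin_sub, sub_eq_zero] at this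
  exact this

lemma res_lin_pbC (g' : κ → Γ(P, ⊤)) {W V : T.Opens} (h : V ≤ W) (c : κ → Γ(T, W)) :
    res (preimage_mono f h) (lin g' (f ⁻¹ᵁ W) (pbC f c)) =
      lin g' (f ⁻¹ᵁ V) (pbC f fun k => resF h (c k)) := by
  rw [res_lin]
  exact congrArg _ (_root_.funext fun k => (pbF_res f h (c k)).symm)

/-- A map of modules is given by the images of local generators, subject to the relations. -/
lemma SemiHom.exists_of_generators {g : κ → Γ(M, ⊤)} {g' : κ → Γ(P, ⊤)} (hgen : Generates g)
    (hrel : ∀ W c, lin g W c = 0 → lin g' (f ⁻¹ᵁ W) (pbC f c) = 0) :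
    ∃ θ : SemiHom f M P, ∀ W c, θ.app W (lin g W c) = lin g' (f ⁻¹ᵁ W) (pbC f c) := by
  -- The image of a section is characterized locally: wherever the section is a combination of
  -- generators, its image is the same combination of the `g'`. The hypothesis on relations makes
  -- this independent of the combination.
  let R : ∀ U : T.Opens, Γ(M, U) → Γ(P, f ⁻¹ᵁ U) → Prop := fun U m n =>
    ∀ x ∈ U, ∃ (W : T.Opens) (hW : W ≤ U), x ∈ W ∧ ∃ c, res hW m = lin g W c ∧
      res (preimage_mono f hW) n = lin g' (f ⁻¹ᵁ W) (pbC f c)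
  have hR : ∀ U c n, R U (lin g U c) n → n = lin g' (f ⁻¹ᵁ U) (pbC f c) := by
    intro U c n hn
    refine section_ext fun x hx => ?_
    obtain ⟨W, hW, hxW, d, hd, hd'⟩ := hn (f x) hx
    refine ⟨f ⁻¹ᵁ W, preimage_mono f hW, hxW, ?_⟩
    rw [hd', res_lin_pbC]
    exact app_lin_congr hrel (by rw [← hd, res_lin])
  have hres : ∀ {U V : T.Opens} (h : V ≤ U) m n, R U m n →
      R V (res h m) (res (preimage_mono f h) n) := by
    intro U V h m n hmn x hx
    obtain ⟨W, hW, hxW, c, hc, hc'⟩ := hmn x (h hx)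
    refine ⟨W ⊓ V, inf_le_right, ⟨hxW, hx⟩, fun k => resF inf_le_left (c k), ?_, ?_⟩
    · rw [res_res, ← res_lin, ← hc, res_res]
    · rw [res_res, ← res_lin_pbC, ← hc', res_res]
  refine (SemiHom.exists_of_rel f (M := M) (P := P) R ?_ ?_ ?_ hres).imp
    fun θ hθ W c => hR W c _ (hθ _ _)
  · intro U m
    choose V hxV hV using hgen
    have hs : ∀ x : U, ∃ c, lin g (U ⊓ V x) c = res inf_le_left m := fun x =>
      hV x _ inf_le_right _
    choose c hc using hs
    obtain ⟨n, hn, -⟩ := existsUnique_glue (M := P) (U := f ⁻¹ᵁ U)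
      (fun x : U => f ⁻¹ᵁ (U ⊓ V x)) (fun x => preimage_mono f inf_le_left)
      (fun x hx => Opens.mem_iSup.2 ⟨⟨f x, hx⟩, hx, hxV _⟩)
      (fun x => lin g' _ (pbC f (c x))) (fun x y => by
        have h : U ⊓ V x ⊓ (U ⊓ V y) ≤ U ⊓ V x := inf_le_left
        have h' : U ⊓ V x ⊓ (U ⊓ V y) ≤ U ⊓ V y := inf_le_right
        refine (res_lin_pbC g' h (c x)).trans (Eq.trans ?_ (res_lin_pbC g' h' (c y)).symm)
        refine app_lin_congr hrel ?_
        rw [← res_lin, ← res_lin, hc, hc, res_res, res_res])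
    have hmn : R U m n := fun x hx =>
      ⟨U ⊓ V x, inf_le_left, ⟨hx, hxV x⟩, c ⟨x, hx⟩, (hc ⟨x, hx⟩).symm, hn ⟨x, hx⟩⟩
    refine ⟨n, hmn, fun n' hn' => section_ext fun x hx => ?_⟩
    refine ⟨f ⁻¹ᵁ (U ⊓ V (f x)), preimage_mono f inf_le_left, ⟨hx, hxV _⟩, ?_⟩
    have h1 := hres (inf_le_left : U ⊓ V (f x) ≤ U) _ _ hn'
    have h2 := hres (inf_le_left : U ⊓ V (f x) ≤ U) _ _ hmn
    rw [← hc ⟨f x, hx⟩] at h1 h2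
    rw [hR _ _ _ h1, hR _ _ _ h2]
  · intro U m m' n n' h h' x hx
    obtain ⟨W, hW, hxW, c, hc, hc'⟩ := h x hx
    obtain ⟨W', hW', hxW', d, hd, hd'⟩ := h' x hx
    refine ⟨W ⊓ W', inf_le_left.trans hW, ⟨hxW, hxW'⟩,
      (fun k => resF inf_le_left (c k)) + fun k => resF inf_le_right (d k), ?_, ?_⟩
    · rw [lin_add, ← res_lin, ← res_lin, ← hc, ← hd, res_res, res_res, map_add]
    · rw [show pbC f ((fun k => resF inf_le_left (c k)) + fun k => resF inf_le_right (d k)) =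
        pbC f (fun k => resF inf_le_left (c k)) + pbC f (fun k => resF inf_le_right (d k)) from
          _root_.funext fun k => map_add _ _ _, lin_add, ← res_lin_pbC, ← res_lin_pbC, ← hc',
        ← hd', res_res, res_res, map_add]
  · intro U r m n h x hx
    obtain ⟨W, hW, hxW, c, hc, hc'⟩ := h x hx
    refine ⟨W, hW, hxW, resF hW r • c, ?_, ?_⟩
    · rw [lin_smul, ← hc, res_smul]
    · rw [show pbC f (resF hW r • c) = pbF f W (resF hW r) • pbC f c from
        _root_.funext fun k => map_mul _ _ _, lin_smul, ← hc', res_smul, pbF_res]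

end Generators

end Gieseker

end

noncomputable section

namespace Gieseker

open TopologicalSpace Opposite

lemma val_const_smul {S : Scheme.{0}} {M : S.Modules} (f : S ⟶ pt) {s : pt ⟶ S}
    (hs : s ≫ f = 𝟙 pt) {U : S.Opens} (h : MemOpen s U) (c : ℂ) (m : Γ(M, U)) :
    val s U h (const f U c • m) = c • val s U h m := by
  rw [val_smul, evF_const f hs]

/-! ### Split bundles on the projective line -/

section Splittings

open MvPolynomial

/-- Frames of `M` on the two charts of the projective line which identify `M` with `⨁ⱼ 𝒪(aⱼ)`. -/
structure Splitting {r : ℕ} (a : Fin r → ℕ) (M : P1.Modules) where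
  e : ∀ i, Fin r → Γ(M, P1.chart i)
  isFrame : ∀ i, IsFrame M (P1.chart i) (e i)
  res_eq : ∀ i k {U : P1.Opens} (hi : U ≤ P1.chart i) (hk : U ≤ P1.chart k) j,
    res hk (e k j) = resF hi (P1.ratio i k) ^ a j • res hi (e i j)

variable {r : ℕ} {a : Fin r → ℕ} {M N : P1.Modules} {U : P1.Opens}

lemma P1.ratio_mul_ratio (i k : Fin 2) (hi : U ≤ P1.chart i) (hk : U ≤ P1.chart k) :
    resF hi (P1.ratio i k) * resF hk (P1.ratio k i) = 1 := by
  have := P1.resF_dehom i k (isHomogeneous_X ℂ i) hi hk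
  rw [P1.dehom_X, P1.dehom_X, P1.ratio_self, map_one, pow_one] at this
  exact this.symm

lemma SplitsAs.nonempty_splitting (h : SplitsAs a M) : Nonempty (Splitting a M) := by
  obtain ⟨e₀, e₁, h₀, h₁, h⟩ := h
  have h01 : ∀ {U : P1.Opens} (hi : U ≤ P1.chart 0) (hk : U ≤ P1.chart 1) j,
      res hk (e₁ j) = resF hi (P1.ratio 0 1) ^ a j • res hi (e₀ j) := by
    intro U hi hk j
    have h2 := congrArg (res (le_inf hi hk)) (h j)
    have h3 : res (le_inf hi hk) (res inf_le_right (e₁ j)) = res (le_inf hi hk)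
      (resF inf_le_left (P1.ratio 0 1) ^ a j • res inf_le_left (e₀ j)) := h2
    rwa [res_smul, map_pow, res_res, res_res, resF_resF] at h3
  refine ⟨⟨fun | 0 => e₀ | 1 => e₁, fun i => ?_, fun i k U hi hk j => ?_⟩⟩
  · fin_cases i
    · exact h₀
    · exact h₁
  · fin_cases i <;> fin_cases k
    · change res hk (e₀ j) = resF hi (P1.ratio 0 0) ^ a j • res hi (e₀ j)
      rw [P1.ratio_self, map_one, one_pow, one_smul]
    · exact h01 hi hk j
    · change res hk (e₀ j) = resF hi (P1.ratio 1 0) ^ a j • res hi (e₁ j)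
      rw [h01 hk hi, smul_smul, ← mul_pow,
        show resF hi (P1.ratio 1 0) * resF hk (P1.ratio 0 1) = 1 from P1.ratio_mul_ratio 1 0 hi hk,
        one_pow, one_smul]
    · change res hk (e₁ j) = resF hi (P1.ratio 1 1) ^ a j • res hi (e₁ j)
      rw [P1.ratio_self, map_one, one_pow, one_smul]

namespace Splitting

variable (σ : Splitting a M)

/-- The form and the frame change between charts by reciprocal powers of the ratio of coordinates,
so the local sections agree on overlaps. -/
lemma exists_sec (j : Fin r) {f : MvPolynomial (Fin 2) ℂ} (hf : f.IsHomogeneous (a j)) :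
    ∃ s : Γ(M, ⊤), ∀ i, res le_top s = P1.dehom i f • σ.e i j := by
  obtain ⟨s, hs, -⟩ := existsUnique_glue (M := M) (U := ⊤) (fun i => P1.chart i) (fun _ => le_top)
    (fun x _ => Opens.mem_iSup.2 (P1.exists_mem_chart x)) (fun i => P1.dehom i f • σ.e i j)
    (fun i k => by
      rw [res_smul, res_smul, σ.res_eq i k inf_le_left inf_le_right, smul_smul,
        P1.resF_dehom i k hf inf_le_left inf_le_right, mul_comm])
  exact ⟨s, hs⟩

/-- The global section of the `j`-th summand `𝒪(aⱼ)` given by a form of degree `aⱼ`. -/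
def sec (j : Fin r) {f : MvPolynomial (Fin 2) ℂ} (hf : f.IsHomogeneous (a j)) : Γ(M, ⊤) :=
  (σ.exists_sec j hf).choose

lemma res_sec (j : Fin r) {f : MvPolynomial (Fin 2) ℂ} (hf : f.IsHomogeneous (a j)) {i : Fin 2}
    (hU : U ≤ P1.chart i) :
    res le_top (σ.sec j hf) = resF hU (P1.dehom i f) • res hU (σ.e i j) := by
  rw [← res_smul, ← (σ.exists_sec j hf).choose_spec i, res_res]; rfl

lemma sec_ne_zero (j : Fin r) {f : MvPolynomial (Fin 2) ℂ} (hf : f.IsHomogeneous (a j))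
    (h0 : f ≠ 0) {x : P1} : σ.sec j hf ≠ 0 := by
  intro h
  obtain ⟨i, hi⟩ := P1.exists_mem_chart x
  have h1 := σ.res_sec j hf (le_refl (P1.chart i))
  rw [h, map_zero, resF_self] at h1
  have h2 := congrArg (fun m => (σ.isFrame i).repr le_rfl m j) h1
  simp only [map_zero, map_smul, Pi.zero_apply, Pi.smul_apply, (σ.isFrame i).repr_self,
    Pi.single_eq_same, smul_eq_mul, mul_one] at h2
  exact P1.dehom_ne_zero hi hf h0 h2.symm

variable {s : pt ⟶ P1} {v : Fin 2 → ℂ}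

lemma exists_basis (hs : HasCoords s v) : ∃ b : Module.Basis (Fin r) ℂ ((fiber s).obj M),
    ∀ j {f : MvPolynomial (Fin 2) ℂ} (hf : f.IsHomogeneous (a j)),
      val s ⊤ memOpen_top (σ.sec j hf) = eval v f • b j := by
  obtain ⟨i, hi⟩ := HasCoords.exists_memOpen s
  have hv : v i ≠ 0 := (hs.memOpen_iff i).1 hi
  -- The factor `(v i ^ a j)⁻¹` turns the value of `f / x_i ^ a_j` into `eval v f`, so no chart
  -- appears in the formula.
  refine ⟨((σ.isFrame i).fiberBasis s hi).isUnitSMul (w := fun j => (v i ^ a j)⁻¹)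
    (fun j => (isUnit_iff_ne_zero.2 (inv_ne_zero (pow_ne_zero _ hv)))), fun j f hf => ?_⟩
  rw [Module.Basis.isUnitSMul_apply, IsFrame.fiberBasis_apply, smul_smul, ← hs.evF_dehom hi hf,
    mul_assoc, mul_inv_cancel₀ (pow_ne_zero _ hv), mul_one]
  have := val_res s hi le_top (σ.sec j hf)
  rw [← this, σ.res_sec j hf le_rfl, val_smul, resF_self, res_self]

variable {s t : pt ⟶ P1} {v w : Fin 2 → ℂ}

lemma eval_vanishing_ne_zero (hs : HasCoords s v) (ht : HasCoords t w) (hst : s ≠ t) :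
    eval v (vanishing w) ≠ 0 := by
  rw [eval_vanishing]
  intro h
  obtain ⟨i, hi⟩ := HasCoords.exists_memOpen s
  have hv : v i ≠ 0 := (hs.memOpen_iff i).1 hi
  refine hst (hs.eq ht (c := w i / v i) ?_)
  ext m
  rw [Pi.smul_apply, smul_eq_mul, div_mul_eq_mul_div, eq_div_iff hv]
  have h := sub_eq_zero.1 h
  fin_cases i <;> fin_cases m
  exacts [rfl, h, h.symm, rfl]

include σ in
/-- On a bundle none of whose nonzero sections vanishes at both marked points, and such that the
sections vanishing at the first one form a line, one summand is `𝒪(1)` and the others are trivial. -/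
lemma exists_eq_single (hs : HasCoords s v) (ht : HasCoords t w) (hst : s ≠ t)
    (h0 : ∀ m : Γ(M, ⊤), val s ⊤ memOpen_top m = 0 → val t ⊤ memOpen_top m = 0 → m = 0)
    (h1 : ∀ m m' : Γ(M, ⊤), val s ⊤ memOpen_top m = 0 → val s ⊤ memOpen_top m' = 0 → m ≠ 0 →
      ∃ c : ℂ, m' = const P1.str ⊤ c • m) (hpos : ∃ j, 0 < a j) :
    ∃ j₀, a = Pi.single j₀ 1 := by
  obtain ⟨b, hb⟩ := σ.exists_basis hs
  obtain ⟨b', hb'⟩ := σ.exists_basis ht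
  have hvw := eval_vanishing_ne_zero hs ht hst
  have hwv := eval_vanishing_ne_zero ht hs hst.symm
  have hne : ∀ {v w : Fin 2 → ℂ}, eval v (vanishing w) ≠ 0 → vanishing w ≠ 0 := by
    rintro v w h h'
    exact h (by rw [h', map_zero])
  have hle : ∀ j, a j ≤ 1 := by
    intro j
    by_contra! hj
    -- If `a j ≥ 2`, this form of degree `a j` vanishes at both points and gives a forbidden
    -- section.
    have hf : (vanishing v * vanishing w ^ (a j - 1)).IsHomogeneous (a j) := by
      have := (vanishing_isHomogeneous v).mul ((vanishing_isHomogeneous w).pow (a j - 1))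
      rwa [one_mul, Nat.add_sub_cancel' (by omega)] at this
    refine σ.sec_ne_zero j hf (x := s pt₀)
      (mul_ne_zero (hne hwv) (pow_ne_zero _ (hne hvw))) (h0 _ ?_ ?_)
    · rw [hb, map_mul, eval_vanishing_self, zero_mul, zero_smul]
    · rw [hb', map_mul, map_pow, eval_vanishing_self, zero_pow (by omega), mul_zero, zero_smul]
  obtain ⟨j₀, hj₀⟩ := hpos
  have hone : ∀ {j}, 0 < a j → (vanishing v).IsHomogeneous (a j) := fun {j} hj => by
    rw [le_antisymm (hle j) hj]; exact vanishing_isHomogeneous v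
  refine ⟨j₀, _root_.funext fun j => ?_⟩
  rcases eq_or_ne j j₀ with rfl | hj
  · rw [Pi.single_eq_same]; exact le_antisymm (hle j) hj₀
  · rw [Pi.single_eq_of_ne hj]
    by_contra hj1
    have hj1 := Nat.pos_of_ne_zero hj1
    -- Two summands `𝒪(1)` would give two sections vanishing at `s` which must be proportional;
    -- their values at `t` lie on different basis vectors.
    obtain ⟨c, hc⟩ := h1 (σ.sec j₀ (hone hj₀)) (σ.sec j (hone hj1))
      (by rw [hb, eval_vanishing_self, zero_smul]) (by rw [hb, eval_vanishing_self, zero_smul])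
      (σ.sec_ne_zero j₀ _ (x := s pt₀) (hne hwv))
    have h2 := congrArg (fun m => b'.repr m j) (congrArg (val t ⊤ memOpen_top) hc)
    have h3 := val_const_smul (M := M) P1.str ht.str memOpen_top c (σ.sec j₀ (hone hj₀))
    rw [hb'] at h2 h3
    replace h2 := h2.trans (congrArg (fun m => b'.repr m j) h3)
    simp only [map_smul, Module.Basis.repr_self, Finsupp.smul_apply, Finsupp.single_eq_same,
      Finsupp.single_eq_of_ne hj, smul_eq_mul, mul_one, mul_zero] at h2
    exact hwv h2

end Splitting

/-! ### Generators and relations of `𝒪(1) ⊕ 𝒪ʳ⁻¹` -/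

section Generators

variable {j₀ : Fin r} (σ : Splitting (Pi.single j₀ 1) M) (v w : Fin 2 → ℂ)

/-- Global sections generating `𝒪(1) ⊕ 𝒪ʳ⁻¹`: a trivialization of `𝒪ʳ⁻¹` and the two sections of
`𝒪(1)` which vanish at the points with coordinates `w` and `v`. -/
def Splitting.gens : Option (Fin r) → Γ(M, ⊤)
  | some j => σ.sec j (f := vanishing w ^ (Pi.single j₀ 1 : Fin r → ℕ) j)
      (by simpa using (vanishing_isHomogeneous w).pow ((Pi.single j₀ 1 : Fin r → ℕ) j))
  | none => σ.sec j₀ (f := vanishing v)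
      (by rw [Pi.single_eq_same]; exact vanishing_isHomogeneous v)

variable {v w}

lemma Splitting.lin_gens {i : Fin 2} (hU : U ≤ P1.chart i) (c : Option (Fin r) → Γ(P1, U)) :
    lin (σ.gens v w) U c = ∑ j, (if j = j₀ then c (some j₀) * resF hU (P1.dehom i (vanishing w)) +
      c none * resF hU (P1.dehom i (vanishing v)) else c (some j)) • res hU (σ.e i j) := by
  have h1 : ∀ j, c (some j) • res le_top (σ.gens v w (some j)) =
      (c (some j) * resF hU (P1.dehom i (vanishing w)) ^ (Pi.single j₀ 1 : Fin r → ℕ) j) •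
        res hU (σ.e i j) := by
    intro j
    rw [gens, σ.res_sec _ _ hU, smul_smul, map_pow, map_pow]
  have h2 : c none • res le_top (σ.gens v w none) =
      (c none * resF hU (P1.dehom i (vanishing v))) • res hU (σ.e i j₀) := by
    rw [gens, σ.res_sec _ _ hU, smul_smul]
  rw [lin, Fintype.sum_option, h2, Finset.sum_congr rfl fun j _ => h1 j]
  rw [← Finset.add_sum_erase _ _ (Finset.mem_univ j₀),
    ← Finset.add_sum_erase Finset.univ (fun j => (if j = j₀ then _ else _) • _)
      (Finset.mem_univ j₀), ← add_assoc]
  congr 1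
  · rw [if_pos rfl, Pi.single_eq_same, pow_one, add_smul, add_comm]
  · refine Finset.sum_congr rfl fun j hj => ?_
    have hj := Finset.ne_of_mem_erase hj
    rw [if_neg hj, Pi.single_eq_of_ne hj, pow_zero, mul_one]

/-- The two linear forms have no common zero: dividing the expansion of `x_i` by `x_i` gives `1 = p
* w-form + q * v-form` on the chart, and `p`, `q` are the coefficients needed in the summand `𝒪(1)`.
-/
lemma Splitting.generates_gens (h : eval v (vanishing w) ≠ 0) : Generates (σ.gens v w) := by
  intro x
  obtain ⟨i, hi⟩ := P1.exists_mem_chart x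
  refine ⟨P1.chart i, hi, fun W hW m => ?_⟩
  have h1 := congrArg (fun f => resF hW (P1.dehom i f)) (sum_vanishing h i)
  simp only [map_add, map_mul, P1.dehom_X, P1.ratio_self, map_one] at h1
  let q := resF hW (P1.dehom i (C (w i / eval w (vanishing v))))
  let p := resF hW (P1.dehom i (C (v i / eval v (vanishing w))))
  let d := (σ.isFrame i).repr hW m
  refine ⟨fun | some j => if j = j₀ then p * d j₀ else d j | none => q * d j₀, ?_⟩
  rw [σ.lin_gens hW, ← (σ.isFrame i).sum_repr hW m]
  refine Finset.sum_congr rfl fun j _ => ?_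
  congr 1
  change (if j = j₀ then (if j₀ = j₀ then p * d j₀ else d j₀) * _ + q * d j₀ * _ else
    if j = j₀ then p * d j₀ else d j) = d j
  rw [if_pos (rfl : j₀ = j₀)]
  split_ifs with hj
  · rw [hj]
    linear_combination (d j₀) * h1
  · rfl

/-- Coefficients are compared in the frames. The trivial summands carry no relation, so the only one
is between the two sections of `𝒪(1)`. -/
lemma Splitting.gens_relation {W : P1.Opens} {c : Option (Fin r) → Γ(P1, W)}
    (h : lin (σ.gens v w) W c = 0) : (∀ j ≠ j₀, c (some j) = 0) ∧
      ∀ k (U : P1.Opens) (hUW : U ≤ W) (hU : U ≤ P1.chart k),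
        resF hUW (c (some j₀)) * resF hU (P1.dehom k (vanishing w)) +
          resF hUW (c none) * resF hU (P1.dehom k (vanishing v)) = 0 := by
  have h1 : ∀ k (U : P1.Opens) (hUW : U ≤ W) (hU : U ≤ P1.chart k) j,
      (if j = j₀ then resF hUW (c (some j₀)) * resF hU (P1.dehom k (vanishing w)) +
      resF hUW (c none) * resF hU (P1.dehom k (vanishing v)) else resF hUW (c (some j))) = 0 := by
    intro k U hUW hU j
    have h2 := congrArg (res hUW) h
    rw [res_lin, σ.lin_gens hU, map_zero] at h2
    have h3 := (σ.isFrame k).ext hU (h2.trans (by simp :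
      (0 : Γ(M, U)) = ∑ j, (fun _ => (0 : Γ(P1, U))) j • res hU (σ.e k j)))
    exact congrFun h3 j
  refine ⟨fun j hj => function_ext fun x hx => ?_, fun k U hUW hU => ?_⟩
  · obtain ⟨k, hk⟩ := P1.exists_mem_chart x
    refine ⟨W ⊓ P1.chart k, inf_le_left, ⟨hx, hk⟩, ?_⟩
    have := h1 k _ (inf_le_left : W ⊓ P1.chart k ≤ W) inf_le_right j
    rw [if_neg hj] at this
    rw [this, map_zero]
  · have := h1 k U hUW hU j₀
    rwa [if_pos rfl] at this

end Generators

end Splittings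

end Gieseker

end

/-! ### From a map of global sections to a map of bundles on the line -/

noncomputable section

namespace Gieseker

open TopologicalSpace Opposite

section SemiHomOfSections

open MvPolynomial

variable {r : ℕ} {j₀ j₀' : Fin r} {M N : P1.Modules} (σ : Splitting (Pi.single j₀ 1) M)
  (σ' : Splitting (Pi.single j₀' 1) N) {v w : Fin 2 → ℂ} (hvw : eval v (vanishing w) ≠ 0)
  {κ κ' : ℂ} (hκ : κ * κ' = 1)

include σ σ' in
/-- A map on global sections which scales the two sections of `𝒪(1)` vanishing at the marked points
is induced by a map of modules over an automorphism of the projective line. -/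
lemma exists_semiHom_of_gens (g : Γ(M, ⊤) →+ Γ(N, ⊤))
    (hg : ∀ c m, g (const P1.str ⊤ c • m) = const P1.str ⊤ c • g m) {α : ℂ}
    (hg₀ : g (σ.gens v w (some j₀)) = const P1.str ⊤ α • σ'.gens v w (some j₀'))
    (hg₁ : g (σ.gens v w none) = const P1.str ⊤ (α * κ) • σ'.gens v w none)
    (hspan : ∀ m : Γ(M, ⊤), ∃ c : Option (Fin r) → ℂ,
      m = lin (σ.gens v w) ⊤ fun k => const P1.str ⊤ (c k)) :
    ∃ θ : SemiHom (P1.map (scaling_scaling hκ hvw)) M N, ∀ W m,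
      θ.app W (res le_top m) = res le_top (g m) := by
  set φ := P1.map (scaling_scaling hκ hvw) with hφ
  have hφs : φ ≫ P1.str = P1.str := P1.map_str _ (scaling_C κ)
  refine (SemiHom.exists_of_generators (f := φ) (g := σ.gens v w)
    (g' := fun k => g (σ.gens v w k)) (σ.generates_gens hvw) ?_).imp ?_
  · intro W c hc
    obtain ⟨h0, hrel⟩ := σ.gens_relation hc
    refine section_ext fun x hx => ?_
    obtain ⟨i, hi⟩ := P1.exists_mem_chart x
    obtain ⟨k, hk⟩ := P1.exists_mem_chart (φ x)
    let U : P1.Opens := φ ⁻¹ᵁ (W ⊓ P1.chart k) ⊓ P1.chart i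
    have hU : U ≤ φ ⁻¹ᵁ W := inf_le_left.trans (preimage_mono φ inf_le_left)
    have hUi : U ≤ P1.chart i := inf_le_right
    have hUk : U ≤ φ ⁻¹ᵁ P1.chart k := inf_le_left.trans (preimage_mono φ inf_le_right)
    refine ⟨U, hU, ⟨⟨hx, hk⟩, hi⟩, ?_⟩
    -- The relation pulled back by `φ`. Both forms acquire the same denominator, from `σ (X k)`,
    -- which is cleared; the form `vanishing v` also acquires the factor `κ`. This matches the ratio
    -- of the scalars in `hg₀` and `hg₁`.
    have h1 : resF hU (pbF φ W (c (some j₀))) * resF hUi (P1.dehom i (vanishing w)) +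
        resF hU (pbF φ W (c none)) *
          (const P1.str U κ * resF hUi (P1.dehom i (vanishing v))) = 0 := by
      have h2 := congrArg (fun z => resF (inf_le_left : U ≤ _) (pbF φ _ z))
        (hrel k (W ⊓ P1.chart k) inf_le_left inf_le_right)
      simp only [map_add, map_mul, map_zero, pbF_res, resF_resF] at h2
      have h3 := P1.pbF_map_dehom (scaling_scaling hκ hvw) i k hUi hUk (vanishing_isHomogeneous w)
      have h4 := P1.pbF_map_dehom (scaling_scaling hκ hvw) i k hUi hUk (vanishing_isHomogeneous v)
      rw [scaling_vanishing_right κ hvw, pow_one] at h3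
      rw [scaling_vanishing_left κ hvw, pow_one, map_mul, P1.dehom_C, map_mul, resF_const] at h4
      rw [← h3, ← h4]
      linear_combination (resF hUi (P1.dehom i (scaling v w κ (X k)))) * h2
    -- The coefficients of the other generators are zero in a relation, so nothing has to be known
    -- about their images.
    have h5 : ∀ j ∈ Finset.univ.erase j₀,
        pbF φ W (c (some j)) • (res le_top (g (σ.gens v w (some j))) : Γ(N, φ ⁻¹ᵁ W)) = 0 := fun j hj => by
      rw [h0 j (Finset.ne_of_mem_erase hj), map_zero, zero_smul]
    have e₀ : (res le_top (g (σ.gens v w (some j₀))) : Γ(N, U)) =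
        (const P1.str U α * resF hUi (P1.dehom i (vanishing w))) • res hUi (σ'.e i j₀') := by
      rw [hg₀, res_smul, Splitting.gens, σ'.res_sec _ _ hUi, resF_const, Pi.single_eq_same,
        pow_one, smul_smul]
    have e₁ : (res le_top (g (σ.gens v w none)) : Γ(N, U)) =
        (const P1.str U (α * κ) * resF hUi (P1.dehom i (vanishing v))) •
          res hUi (σ'.e i j₀') := by
      rw [hg₁, res_smul, Splitting.gens, σ'.res_sec _ _ hUi, resF_const, smul_smul]
    rw [lin, Fintype.sum_option, ← Finset.add_sum_erase _ _ (Finset.mem_univ j₀),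
      Finset.sum_eq_zero h5, add_zero, map_zero, map_add, res_smul, res_smul, res_res, res_res,
      e₀, e₁, smul_smul, smul_smul, ← add_smul]
    convert zero_smul Γ(P1, U) _
    rw [map_mul]
    linear_combination (const P1.str U α) * h1
  · rintro θ hθ W m
    obtain ⟨c, hc⟩ := hspan m
    have h1 : res le_top m = lin (σ.gens v w) W fun k => const P1.str W (c k) := by
      rw [hc, res_lin]
      exact congrArg _ (_root_.funext fun k => resF_const _ _ _)
    have h2 : g m = lin (fun k => g (σ.gens v w k)) ⊤ fun k => const P1.str ⊤ (c k) := by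
      have : ∀ f : Option (Fin r) → Γ(P1, ⊤), lin (σ.gens v w) ⊤ f = ∑ k, f k • σ.gens v w k :=
        fun f => Finset.sum_congr rfl fun k _ => by rw [res_self]
      rw [hc, this, map_sum]
      exact Finset.sum_congr rfl fun k _ => by rw [hg, res_self]
    rw [h1, hθ, h2, res_lin]
    exact congrArg _ (_root_.funext fun k =>
      (pbF_const P1.str φ _ hφs W _).trans (resF_const _ _ _).symm)

end SemiHomOfSections

end Gieseker

end

/-! ### Maps of modules determined on generating global sections -/

noncomputable section

namespace Gieseker

open TopologicalSpace Opposite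

section SemiHomGenerated

variable {S T : Scheme.{0}} {φ : S ⟶ T} {ψ : T ⟶ S} {M : T.Modules} {N : S.Modules} {κ : Type}
  [Fintype κ] {e : κ → Γ(M, ⊤)}

lemma le_preimage_of_eq_id {f : T ⟶ T} (h : f = 𝟙 T) (U : T.Opens) : f ⁻¹ᵁ U ≤ U := by
  subst h; exact le_rfl

lemma pbF_of_eq_id {f : T ⟶ T} (h : f = 𝟙 T) (U : T.Opens) (c : Γ(T, U)) :
    pbF f U c = resF (le_preimage_of_eq_id h U) c := by
  subst h
  change Scheme.Hom.app (𝟙 T) U c = _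
  rw [Scheme.Hom.id_app]
  exact (resF_self _ _).symm

lemma preimage_preimage_le (h : ψ ≫ φ = 𝟙 T) (W : T.Opens) : ψ ⁻¹ᵁ φ ⁻¹ᵁ W ≤ W :=
  le_preimage_of_eq_id h W

lemma pbF_pbF_of_eq_id (h : ψ ≫ φ = 𝟙 T) (W : T.Opens) (c : Γ(T, W)) :
    pbF ψ _ (pbF φ W c) = resF (preimage_preimage_le h W) c :=
  pbF_of_eq_id h W c

lemma SemiHom.app_lin (θ : SemiHom φ M N) (W : T.Opens) (c : κ → Γ(T, W)) :
    θ.app W (lin e W c) = ∑ k, pbF φ W (c k) • θ.app W (res le_top (e k)) := by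
  rw [lin, map_sum]
  exact Finset.sum_congr rfl fun k _ => θ.app_smul _ _ _

/-- Locally a section is a combination of global generators. On these the maps act through `g` and
`g'`, and the coefficients are pulled back along the identity. -/
lemma SemiHom.app_app_eq (hψ : ψ ≫ φ = 𝟙 T) (he : Generates e) (θ : SemiHom φ M N)
    (θ' : SemiHom ψ N M) (g : Γ(M, ⊤) → Γ(N, ⊤)) (g' : Γ(N, ⊤) → Γ(M, ⊤)) (hg : ∀ m, g' (g m) = m)
    (hθ : ∀ W m, θ.app W (res le_top m) = res le_top (g m))
    (hθ' : ∀ W m, θ'.app W (res le_top m) = res le_top (g' m)) (W : T.Opens) (m : Γ(M, W)) :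
    θ'.app _ (θ.app W m) = res (preimage_preimage_le hψ W) m := by
  refine section_ext fun x hx => ?_
  obtain ⟨V, hxV, hV⟩ := he (φ (ψ x))
  obtain ⟨c, hc⟩ := hV (W ⊓ V) inf_le_right (res inf_le_left m)
  refine ⟨ψ ⁻¹ᵁ φ ⁻¹ᵁ (W ⊓ V), preimage_mono ψ (preimage_mono φ inf_le_left), ⟨hx, hxV⟩, ?_⟩
  have h1 : res (preimage_mono ψ (preimage_mono φ inf_le_left)) (θ'.app _ (θ.app W m)) =
      θ'.app _ (θ.app (W ⊓ V) (lin e (W ⊓ V) c)) := by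
    rw [hc, θ.app_res, θ'.app_res]
  have h2 : res (preimage_preimage_le hψ (W ⊓ V)) (lin e (W ⊓ V) c) =
      ∑ k, pbF ψ _ (pbF φ _ (c k)) • res le_top (e k) := by
    rw [res_lin]
    exact Finset.sum_congr rfl fun k _ =>
      congrArg (fun z : Γ(T, ψ ⁻¹ᵁ φ ⁻¹ᵁ (W ⊓ V)) =>
        z • (res le_top (e k) : Γ(M, ψ ⁻¹ᵁ φ ⁻¹ᵁ (W ⊓ V)))) (pbF_pbF_of_eq_id hψ _ (c k)).symm
  rw [h1, app_lin, map_sum, res_res]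
  rw [hc, res_res] at h2
  refine Eq.trans (Finset.sum_congr rfl fun k _ => ?_) h2.symm
  rw [θ'.app_smul, hθ, hθ', hg]

lemma SemiHom.bijective_app (hφ : φ ≫ ψ = 𝟙 S) (hψ : ψ ≫ φ = 𝟙 T) (he : Generates e)
    {κ' : Type} [Fintype κ'] {e' : κ' → Γ(N, ⊤)} (he' : Generates e') (θ : SemiHom φ M N)
    (θ' : SemiHom ψ N M) (g : Γ(M, ⊤) ≃ Γ(N, ⊤))
    (hθ : ∀ W m, θ.app W (res le_top m) = res le_top (g m))
    (hθ' : ∀ W m, θ'.app W (res le_top m) = res le_top (g.symm m)) (W : T.Opens) :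
    Function.Bijective (θ.app W) := by
  have hW : W ≤ ψ ⁻¹ᵁ φ ⁻¹ᵁ W := fun x hx => by
    change (ψ ≫ φ) x ∈ W
    rw [hψ]
    exact hx
  constructor
  · intro m m' h
    have h1 := congrArg (fun n => res hW (θ'.app _ n)) h
    simp only [app_app_eq hψ he θ θ' g g.symm g.symm_apply_apply hθ hθ', res_res] at h1
    rwa [res_self, res_self] at h1
  · intro n
    refine ⟨res hW (θ'.app _ n), ?_⟩
    rw [θ.app_res, app_app_eq hφ he' θ' θ g.symm g g.apply_symm_apply hθ' hθ, res_res, res_self]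

/-- Both sides have the same linearity in the coefficients, so agreement on global sections spreads
to all sections near the point. -/
lemma SemiHom.val_app (he : Generates e) (θ : SemiHom φ M N) {s : pt ⟶ S} {t : pt ⟶ T}
    (h : s ≫ φ = t) (g : Γ(M, ⊤) → Γ(N, ⊤))
    (hθ : ∀ W m, θ.app W (res le_top m) = res le_top (g m))
    (f : (fiber t).obj M →ₗ[ℂ] (fiber s).obj N)
    (hf : ∀ m, f (val t ⊤ memOpen_top m) = val s ⊤ memOpen_top (g m)) (W : T.Opens) (hW : MemOpen t W)
    (hW' : MemOpen s (φ ⁻¹ᵁ W)) (m : Γ(M, W)) :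
    val s (φ ⁻¹ᵁ W) hW' (θ.app W m) = f (val t W hW m) := by
  obtain ⟨V, hxV, hV⟩ := he (t pt₀)
  obtain ⟨c, hc⟩ := hV (W ⊓ V) inf_le_right (res inf_le_left m)
  have ht : MemOpen t (W ⊓ V) := le_inf hW (memOpen_iff_mem.2 hxV)
  have hs : MemOpen s (φ ⁻¹ᵁ (W ⊓ V)) := (memOpen_iff h).2 ht
  rw [← val_res t ht (inf_le_left : W ⊓ V ≤ W) m, ← val_res s hs (preimage_mono φ (inf_le_left : W ⊓ V ≤ W)),
    ← θ.app_res inf_le_left, ← hc,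
    app_lin, lin, map_sum, map_sum, map_sum]
  refine Finset.sum_congr rfl fun k _ => ?_
  rw [val_smul, val_smul, hθ, val_res, val_res, map_smul, hf, evF_comp (s := t) φ s h hs ht]

end SemiHomGenerated

/-! ### Isomorphisms over automorphisms fixing two points -/

section MainP1

open MvPolynomial

/-- The global sections of `M` are determined by their values at `s` and `t`, and the sections
vanishing at one of these points form at most a line. -/
structure IsLinked (s t : pt ⟶ P1) (M : P1.Modules) : Prop where
  eq_zero : ∀ m : Γ(M, ⊤), val s ⊤ memOpen_top m = 0 → val t ⊤ memOpen_top m = 0 → m = 0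
  left : ∀ m m' : Γ(M, ⊤), val s ⊤ memOpen_top m = 0 → val s ⊤ memOpen_top m' = 0 → m ≠ 0 →
    ∃ c : ℂ, m' = const P1.str ⊤ c • m
  right : ∀ m m' : Γ(M, ⊤), val t ⊤ memOpen_top m = 0 → val t ⊤ memOpen_top m' = 0 → m ≠ 0 →
    ∃ c : ℂ, m' = const P1.str ⊤ c • m

variable {r : ℕ} {s t : pt ⟶ P1} {v w : Fin 2 → ℂ}

section

variable {j₀ : Fin r} {M : P1.Modules} (σ : Splitting (Pi.single j₀ 1) M) (hs : HasCoords s v)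
  (ht : HasCoords t w)
include hs

lemma Splitting.val_gens_none : val s ⊤ memOpen_top (σ.gens v w none) = 0 := by
  obtain ⟨b, hb⟩ := σ.exists_basis hs
  rw [gens, hb, eval_vanishing_self, zero_smul]

include ht in
omit hs in
lemma Splitting.val_gens_some : val t ⊤ memOpen_top (σ.gens v w (some j₀)) = 0 := by
  obtain ⟨b, hb⟩ := σ.exists_basis ht
  rw [gens, hb, map_pow, eval_vanishing_self, Pi.single_eq_same, pow_one, zero_smul]

omit hs in
lemma Splitting.gens_ne_zero (x : P1) (hvw : eval v (vanishing w) ≠ 0) (k : Option (Fin r)) :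
    σ.gens v w k ≠ 0 := by
  have h1 : vanishing w ≠ 0 := fun h => hvw (by rw [h, map_zero])
  have h2 : vanishing v ≠ 0 := fun h => by
    have := eval_vanishing v w
    rw [h, map_zero] at this
    rw [eval_vanishing] at hvw
    exact hvw (by linear_combination this)
  rcases k with _ | j
  · exact σ.sec_ne_zero j₀ (by rw [Pi.single_eq_same]; exact vanishing_isHomogeneous v) h2
      (x := x)
  · exact σ.sec_ne_zero j
      (by simpa using (vanishing_isHomogeneous w).pow ((Pi.single j₀ 1 : Fin r → ℕ) j))
      (pow_ne_zero _ h1) (x := x)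

/-- The generators `some j` have values at `s` forming a basis of the fibre. Subtracting the
combination with the same value leaves a section vanishing at `s`, which is a multiple of the
generator `none`. -/
lemma Splitting.exists_eq_lin (hvw : eval v (vanishing w) ≠ 0) (hM : IsLinked s t M)
    (m : Γ(M, ⊤)) : ∃ c : Option (Fin r) → ℂ,
      m = lin (σ.gens v w) ⊤ fun k => const P1.str ⊤ (c k) := by
  obtain ⟨b, hb⟩ := σ.exists_basis hs
  let a : Fin r → ℂ := fun j => eval v (vanishing w ^ (Pi.single j₀ 1 : Fin r → ℕ) j)
  have ha : ∀ j, a j ≠ 0 := fun j => by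
    simp only [a, map_pow]
    exact pow_ne_zero _ hvw
  let x : Fin r → ℂ := fun j => b.repr (val s ⊤ memOpen_top m) j / a j
  obtain ⟨c, hc⟩ := hM.left (σ.gens v w none)
    (m - ∑ j, const P1.str ⊤ (x j) • σ.gens v w (some j)) (σ.val_gens_none hs)
    (by
      rw [map_sub, map_sum, sub_eq_zero]
      conv_lhs => rw [← b.sum_repr (val s ⊤ memOpen_top m)]
      refine Finset.sum_congr rfl fun j _ => ?_
      have h3 := val_const_smul (M := M) P1.str hs.str memOpen_top (x j) (σ.gens v w (some j))
      refine Eq.trans ?_ h3.symm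
      rw [gens, hb, smul_smul, div_mul_cancel₀ _ (ha j)])
    (σ.gens_ne_zero (s pt₀) hvw none)
  refine ⟨fun | some j => x j | none => c, ?_⟩
  rw [lin, Fintype.sum_option]
  simp only [res_self]
  rw [← hc, sub_add_cancel]

end

variable {M N : P1.Modules}

/-- A compatible system of isomorphisms of the fibres at two points and of the global sections is
induced by an isomorphism over an automorphism of the projective line. -/
theorem exists_semiHom (hst : s ≠ t) (hs : s ≫ P1.str = 𝟙 pt) (ht : t ≫ P1.str = 𝟙 pt)
    (hM : IsStrictlyPositive r M) (hN : IsStrictlyPositive r N) (hM' : IsLinked s t M)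
    (hN' : IsLinked s t N) (g : Γ(M, ⊤) ≃+ Γ(N, ⊤))
    (hg : ∀ c m, g (const P1.str ⊤ c • m) = const P1.str ⊤ c • g m)
    (fs : (fiber s).obj M ≃ₗ[ℂ] (fiber s).obj N) (ft : (fiber t).obj M ≃ₗ[ℂ] (fiber t).obj N)
    (hfs : ∀ m, fs (val s ⊤ memOpen_top m) = val s ⊤ memOpen_top (g m))
    (hft : ∀ m, ft (val t ⊤ memOpen_top m) = val t ⊤ memOpen_top (g m)) :
    ∃ φ : P1 ≅ P1, φ.hom ≫ P1.str = P1.str ∧ s ≫ φ.hom = s ∧ t ≫ φ.hom = t ∧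
      ∃ θ : SemiHom φ.hom M N, (∀ W, Function.Bijective (θ.app W)) ∧
        (∀ W (h : MemOpen s W) (h' : MemOpen s (φ.hom ⁻¹ᵁ W)) m,
          val s (φ.hom ⁻¹ᵁ W) h' (θ.app W m) = fs (val s W h m)) ∧
        (∀ W (h : MemOpen t W) (h' : MemOpen t (φ.hom ⁻¹ᵁ W)) m,
          val t (φ.hom ⁻¹ᵁ W) h' (θ.app W m) = ft (val t W h m)) := by
  obtain ⟨v, hs⟩ := exists_hasCoords hs
  obtain ⟨w, ht⟩ := exists_hasCoords ht
  obtain ⟨a, hM, hpos⟩ := hM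
  obtain ⟨a', hN, hpos'⟩ := hN
  obtain ⟨σ⟩ := hM.nonempty_splitting
  obtain ⟨σ'⟩ := hN.nonempty_splitting
  obtain ⟨j₀, rfl⟩ := σ.exists_eq_single hs ht hst hM'.eq_zero hM'.left hpos
  obtain ⟨j₀', rfl⟩ := σ'.exists_eq_single hs ht hst hN'.eq_zero hN'.left hpos'
  have hvw := Splitting.eval_vanishing_ne_zero hs ht hst
  -- By compatibility with `ft` and `fs`, the map `g` preserves vanishing at each point. The
  -- sections vanishing there form a line, hence the scalars `α` and `β`.
  obtain ⟨α, hα⟩ := hN'.right (σ'.gens v w (some j₀')) (g (σ.gens v w (some j₀)))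
    (σ'.val_gens_some ht) (by rw [← hft, σ.val_gens_some ht, map_zero])
    (σ'.gens_ne_zero (s pt₀) hvw _)
  obtain ⟨β, hβ⟩ := hN'.left (σ'.gens v w none) (g (σ.gens v w none))
    (σ'.val_gens_none hs) (by rw [← hfs, σ.val_gens_none hs, map_zero])
    (σ'.gens_ne_zero (s pt₀) hvw _)
  have hα0 : α ≠ 0 := by
    rintro rfl
    rw [map_zero, zero_smul, map_eq_zero_iff g g.injective] at hα
    exact σ.gens_ne_zero (s pt₀) hvw _ hα
  have hβ0 : β ≠ 0 := by
    rintro rfl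
    rw [map_zero, zero_smul, map_eq_zero_iff g g.injective] at hβ
    exact σ.gens_ne_zero (s pt₀) hvw _ hβ
  -- The automorphism must scale one form relative to the other as `g` does, so `κ = β / α`.
  have hκ : (β / α) * (α / β) = 1 := by field_simp
  have hκ' : (α / β) * (β / α) = 1 := by field_simp
  obtain ⟨θ, hθ⟩ := exists_semiHom_of_gens σ σ' hvw hκ g.toAddMonoidHom hg hα
    (by rw [mul_div_cancel₀ _ hα0]; exact hβ) (σ.exists_eq_lin hs hvw hM')
  have hg' : ∀ c n, g.symm (const P1.str ⊤ c • n) = const P1.str ⊤ c • g.symm n := fun c n => by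
    rw [AddEquiv.symm_apply_eq, hg, AddEquiv.apply_symm_apply]
  have hinv : ∀ {c : ℂ} {m : Γ(M, ⊤)} {n : Γ(N, ⊤)}, c ≠ 0 → g m = const P1.str ⊤ c • n →
      g.symm n = const P1.str ⊤ c⁻¹ • m := fun {c m n} hc h => by
    rw [AddEquiv.symm_apply_eq, hg, h, smul_smul, ← map_mul, inv_mul_cancel₀ hc, map_one, one_smul]
  obtain ⟨θ', hθ'⟩ := exists_semiHom_of_gens σ' σ hvw hκ' g.symm.toAddMonoidHom hg' (hinv hα0 hα)
    (by rw [show α⁻¹ * (α / β) = β⁻¹ by field_simp]; exact hinv hβ0 hβ)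
    (σ'.exists_eq_lin hs hvw hN')
  have h1 := P1.map_comp_map (scaling_scaling hκ hvw) (scaling_scaling hκ' hvw)
  have h2 := P1.map_comp_map (scaling_scaling hκ' hvw) (scaling_scaling hκ hvw)
  have hs' : s ≫ P1.map (scaling_scaling hκ hvw) = s :=
    hs.comp_map _ (scaling_C _) fun hf => by rw [eval_scaling_left _ hvw]
  have ht' : t ≫ P1.map (scaling_scaling hκ hvw) = t :=
    ht.comp_map _ (scaling_C _) fun hf => by
      rw [eval_scaling_right (Splitting.eval_vanishing_ne_zero ht hs hst.symm) hf, mul_eq_zero,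
        or_iff_left (pow_ne_zero _ (div_ne_zero hβ0 hα0))]
  exact ⟨⟨P1.map (scaling_scaling hκ hvw), P1.map (scaling_scaling hκ' hvw), h1, h2⟩,
    P1.map_str (scaling_scaling hκ hvw) (scaling_C _), hs', ht', θ,
    SemiHom.bijective_app h1 h2 (σ.generates_gens hvw) (σ'.generates_gens hvw) θ θ' g.toEquiv hθ hθ',
    SemiHom.val_app (σ.generates_gens hvw) θ hs' g hθ fs.toLinearMap hfs,
    SemiHom.val_app (σ.generates_gens hvw) θ ht' g hθ ft.toLinearMap hft⟩

end MainP1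

end Gieseker

end

/-! ### Torsion-freeness and positivity as conditions on the chain -/

noncomputable section

namespace Gieseker

open TopologicalSpace Opposite

section Separation

variable {S : Scheme.{0}} {s t : pt ⟶ S} {U : S.Opens}

lemma pbF_eq_zero_iff_evF (h : MemOpen s U) (g : Γ(S, U)) : pbF s U g = 0 ↔ evF s U h g = 0 := by
  constructor
  · intro h0
    change (Scheme.ΓSpecIso (CommRingCat.of ℂ)).hom (resF h (pbF s U g)) = 0
    rw [h0, map_zero, map_zero]
  · intro h0
    have h1 : resF h (pbF s U g) = 0 := ΓSpecIso_bijective.1 (h0.trans (map_zero _).symm)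
    have h2 := congrArg (resF (le_top : s ⁻¹ᵁ U ≤ ⊤)) h1
    rwa [resF_resF, resF_self, map_zero] at h2

lemma mem_basicOpen_iff_evF (h : MemOpen s U) (g : Γ(S, U)) :
    s pt₀ ∈ S.basicOpen g ↔ evF s U h g ≠ 0 := by
  refine ⟨fun hx h0 => ?_, mem_basicOpen_of_evF_ne_zero h⟩
  have h1 : pt₀ ∈ s ⁻¹ᵁ S.basicOpen g := hx
  rw [Scheme.preimage_basicOpen] at h1
  rw [show (Scheme.Hom.app s U) g = 0 from (pbF_eq_zero_iff_evF h g).2 h0,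
    Scheme.basicOpen_zero] at h1
  exact h1

/-- Functions on an affine open subset separate its points. -/
lemma exists_evF_ne (str : S ⟶ pt) (hU : IsAffineOpen U) (hs : s ≫ str = 𝟙 pt)
    (ht : t ≫ str = 𝟙 pt) (hst : s ≠ t) (hsU : MemOpen s U) (htU : MemOpen t U) :
    ∃ g : Γ(S, U), evF s U hsU g ≠ evF t U htU g := by
  by_contra! h
  refine hst (point_ext str hs ht ?_)
  have h1 : ∀ g : Γ(S, U), s pt₀ ∈ S.basicOpen g ↔ t pt₀ ∈ S.basicOpen g := fun g => by
    rw [mem_basicOpen_iff_evF hsU, mem_basicOpen_iff_evF htU, h]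
  by_contra hne
  -- In an affine open set the basic open sets form a basis, so points not separated by functions
  -- are topologically inseparable.
  have key : ∀ {x y : S}, x ∈ U → (∀ g : Γ(S, U), x ∈ S.basicOpen g → y ∈ S.basicOpen g) →
      ∀ V : S.Opens, x ∈ V → y ∈ V := by
    intro x y hx hxy V hV
    obtain ⟨g, hg, hg'⟩ := hU.exists_basicOpen_le (V := V) ⟨x, hV⟩ hx
    exact hg (hxy g hg')
  rcases (t0Space_iff_not_inseparable S).1 inferInstance hne with h2
  refine h2 ((inseparable_iff_forall_isOpen).2 fun V hV => ⟨fun hx => ?_, fun hx => ?_⟩)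
  · exact key (memOpen_iff_mem.1 hsU) (fun g => (h1 g).1) ⟨V, hV⟩ hx
  · exact key (memOpen_iff_mem.1 htU) (fun g => (h1 g).2) ⟨V, hV⟩ hx

/-- On an integral scheme there is a nonzero function on an affine open subset vanishing at two
given points. -/
lemma exists_ne_zero_evF_eq_zero [IsIntegral S] (str : S ⟶ pt) (hU : IsAffineOpen U)
    (hs : s ≫ str = 𝟙 pt) (ht : t ≫ str = 𝟙 pt) (hst : s ≠ t) (hsU : MemOpen s U)
    (htU : MemOpen t U) : ∃ g : Γ(S, U), g ≠ 0 ∧ evF s U hsU g = 0 ∧ evF t U htU g = 0 := by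
  obtain ⟨h, hne⟩ := exists_evF_ne str hU hs ht hst hsU htU
  have : Nonempty U := ⟨⟨s pt₀, memOpen_iff_mem.1 hsU⟩⟩
  -- Each factor vanishes at one of the points. Neither factor is zero, because `h` takes different
  -- values at the two points.
  refine ⟨(h - const str U (evF s U hsU h)) * (h - const str U (evF t U htU h)),
    mul_ne_zero (fun h0 => hne ?_) (fun h0 => hne ?_), ?_, ?_⟩
  · have := congrArg (evF t U htU) h0
    rw [map_sub, evF_const str ht, map_zero, sub_eq_zero] at this
    exact this.symm
  · have := congrArg (evF s U hsU) h0
    rwa [map_sub, evF_const str hs, map_zero, sub_eq_zero] at this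
  · rw [map_mul, map_sub, evF_const str hs, sub_self, zero_mul]
  · rw [map_mul, map_sub _ h (const str U (evF t U htU h)), evF_const str ht, sub_self, mul_zero]

end Separation

section PositiveBundles

open MvPolynomial

variable {r : ℕ} {M : P1.Modules} {s t : pt ⟶ P1}

lemma IsStrictlyPositive.surjective_val (hM : IsStrictlyPositive r M)
    (hs : s ≫ P1.str = 𝟙 pt) : Function.Surjective (val (M := M) s ⊤ memOpen_top) := by
  obtain ⟨v, hs⟩ := exists_hasCoords hs
  obtain ⟨a, hM, -⟩ := hM
  obtain ⟨σ⟩ := hM.nonempty_splitting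
  obtain ⟨b, hb⟩ := σ.exists_basis hs
  obtain ⟨i, hi⟩ := HasCoords.exists_memOpen s
  have hv : v i ≠ 0 := (hs.memOpen_iff i).1 hi
  have hX : ∀ j, (X i ^ a j : MvPolynomial (Fin 2) ℂ).IsHomogeneous (a j) := fun j => by
    simpa using (isHomogeneous_X ℂ i).pow (a j)
  intro y
  -- The coordinate `x_i` is nonzero at the point, so its power of degree `a j` gives a section of
  -- the `j`-th summand which does not vanish there.
  refine ⟨∑ j, const P1.str ⊤ (b.repr y j / v i ^ a j) • σ.sec j (hX j), ?_⟩
  rw [map_sum]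
  conv_rhs => rw [← b.sum_repr y]
  refine Finset.sum_congr rfl fun j _ => ?_
  refine (val_const_smul (M := M) P1.str hs.str memOpen_top _ _).trans ?_
  rw [hb, map_pow, eval_X, smul_smul, div_mul_cancel₀ _ (pow_ne_zero _ hv)]

lemma IsStrictlyPositive.exists_val_eq_zero (hM : IsStrictlyPositive r M)
    (hs : s ≫ P1.str = 𝟙 pt) : ∃ m : Γ(M, ⊤), m ≠ 0 ∧ val s ⊤ memOpen_top m = 0 := by
  obtain ⟨v, hs⟩ := exists_hasCoords hs
  obtain ⟨a, hM, j, hj⟩ := hM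
  obtain ⟨σ⟩ := hM.nonempty_splitting
  obtain ⟨b, hb⟩ := σ.exists_basis hs
  obtain ⟨i, hi⟩ := HasCoords.exists_memOpen s
  have hv : v i ≠ 0 := (hs.memOpen_iff i).1 hi
  -- Any nonzero form of degree `a j > 0` vanishing at the point would do.
  have hf : (vanishing v * X i ^ (a j - 1)).IsHomogeneous (a j) := by
    have := (vanishing_isHomogeneous v).mul ((isHomogeneous_X ℂ i).pow (a j - 1))
    rwa [one_mul, Nat.add_sub_cancel' (by omega)] at this
  refine ⟨σ.sec j hf, σ.sec_ne_zero j hf (mul_ne_zero (fun h => ?_)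
    (pow_ne_zero _ (X_ne_zero i))) (x := s pt₀), ?_⟩
  · have h0 : v 1 = 0 := by simpa [h] using (eval_vanishing v (Pi.single 0 1)).symm
    have h1 : v 0 = 0 := by simpa [h] using (eval_vanishing v (Pi.single 1 1)).symm
    fin_cases i
    exacts [hv h1, hv h0]
  · rw [hb, map_mul, eval_vanishing_self, zero_mul, zero_smul]

end PositiveBundles

/-- There is a nonzero function near the node which vanishes there. -/
lemma NodalCurve.exists_function_eq_zero (Y : NodalCurve) :
    ∃ (U : Y.Y.Opens) (_ : MemOpen Y.node U) (f : Γ(Y.Y, U)), f ≠ 0 ∧ pbF Y.node U f = 0 := by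
  obtain ⟨U, hU, hxU, -⟩ := exists_isAffineOpen_mem_and_subset (X := Y.Y) (x := Y.node pt₀)
    (U := ⊤) trivial
  have hnode : MemOpen Y.node U := memOpen_iff_mem.2 hxU
  have hs := Y.gluing.s_eq ()
  have ht := Y.gluing.t_eq ()
  have := Y.gluing.finite ()
  have := Y.integral
  have hsU : MemOpen Y.X.s (Y.q ⁻¹ᵁ U) := (memOpen_iff hs).2 hnode
  have htU : MemOpen Y.X.t (Y.q ⁻¹ᵁ U) := (memOpen_iff ht).2 hnode
  obtain ⟨g, hg, hgs, hgt⟩ := exists_ne_zero_evF_eq_zero Y.X.str (hU.preimage Y.q) Y.X.s_str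
    Y.X.t_str Y.X.s_ne_t hsU htU
  -- A function on the normalization with the same value 0 at both points over the node descends to
  -- `Y`.
  obtain ⟨f, hf⟩ := Y.gluing.exists_function (U := U) (fun _ => g) (fun _ => 0) (fun _ _ => hgs)
    (fun _ _ => hgt)
  refine ⟨U, hnode, f, ?_, ?_⟩
  · rintro rfl
    exact hg ((hf ()).symm.trans (map_zero _))
  · rw [pbF_eq_zero_iff_evF hnode, ← evF_comp (s := Y.node) Y.q Y.X.s hs hsU hnode]
    exact (congrArg _ (hf ())).trans hgs

lemma pval_eq_zero_iff {S T : Scheme.{0}} {M : S.Modules} {s : pt ⟶ S} {t : pt ⟶ T} {f : T ⟶ S}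
    (h : t ≫ f = s) {V : T.Opens} (hV : MemOpen t V)
    (m : Γ((Scheme.Modules.pullback f).obj M, V)) : pval h V hV m = 0 ↔ val t V hV m = 0 := by
  rw [pval_apply]
  exact map_eq_zero_iff (fiberPullback f t s h M).toLinearEquiv
    (fiberPullback f t s h M).toLinearEquiv.injective

lemma IsStrictlyPositive.surjective_pval {S : Scheme.{0}} {E : S.Modules} {f : P1 ⟶ S}
    {t : pt ⟶ P1} {s : pt ⟶ S} (h : t ≫ f = s) {r : ℕ}
    (hM : IsStrictlyPositive r ((Scheme.Modules.pullback f).obj E)) (ht : t ≫ P1.str = 𝟙 pt) :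
    Function.Surjective (pval (M := E) h ⊤ memOpen_top) := fun y => by
  obtain ⟨x, hx⟩ := (fiberPullback f t s h E).toLinearEquiv.surjective y
  obtain ⟨m, rfl⟩ := hM.surjective_val ht x
  exact ⟨m, (pval_apply h memOpen_top m).trans hx⟩

/-! ### The chain of linear relations of a Gieseker bundle -/

namespace GiesekerCurve

variable {Y : NodalCurve} {n : ℕ} (Z : GiesekerCurve Y n) {E : Z.Z.Modules}

lemma evalLeft_apply (j : Fin n) (w : Z.sections E j) :
    (Z.evalLeft E j).hom w = pval (Z.a_jR j) ⊤ memOpen_top w :=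
  (congrArg (fiberPullback (Z.jR j) _ _ (Z.a_jR j) E).hom
    (evalAt_eq (Z.a j) P1.str (Z.a_str j) w)).trans (pval_apply (Z.a_jR j) memOpen_top w).symm

lemma evalRight_apply (j : Fin n) (w : Z.sections E j) :
    (Z.evalRight E j).hom w = pval (Z.b_jR j) ⊤ memOpen_top w :=
  (congrArg (fiberPullback (Z.jR j) _ _ (Z.b_jR j) E).hom
    (evalAt_eq (Z.b j) P1.str (Z.b_str j) w)).trans (pval_apply (Z.b_jR j) memOpen_top w).symm

/-- The section `m` of the pullback to a component has values `es` and `et` at the marked points. -/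
def HasValues {S : Scheme.{0}} (C : TwoPointed) (ν : C.C ⟶ S) {s t : pt ⟶ S} (hs : C.s ≫ ν = s)
    (ht : C.t ≫ ν = t) {M : S.Modules} (es : (fiber s).obj M) (et : (fiber t).obj M) (V : C.C.Opens)
    (m : Γ((Scheme.Modules.pullback ν).obj M, V)) : Prop :=
  (∀ h, pval hs V h m = es) ∧ ∀ h, pval ht V h m = et

lemma hasValues_zero {S : Scheme.{0}} {C : TwoPointed} {ν : C.C ⟶ S} {s t : pt ⟶ S}
    (hs : C.s ≫ ν = s) (ht : C.t ≫ ν = t) {M : S.Modules} {es : (fiber s).obj M}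
    {et : (fiber t).obj M} (h0 : es = 0) (h1 : et = 0) (V : C.C.Opens) :
    HasValues C ν hs ht es et V 0 :=
  ⟨fun _ => (map_zero _).trans h0.symm, fun _ => (map_zero _).trans h1.symm⟩

lemma hasValues_res {S : Scheme.{0}} {C : TwoPointed} {ν : C.C ⟶ S} {s t : pt ⟶ S}
    (hs : C.s ≫ ν = s) (ht : C.t ≫ ν = t) {M : S.Modules} {es : (fiber s).obj M}
    {et : (fiber t).obj M} {m : Γ((Scheme.Modules.pullback ν).obj M, ⊤)}
    (h0 : pval hs ⊤ memOpen_top m = es) (h1 : pval ht ⊤ memOpen_top m = et) (V : C.C.Opens) :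
    HasValues C ν hs ht es et V (res le_top m) :=
  ⟨fun h => (pval_res hs h le_top m).trans h0, fun h => (pval_res ht h le_top m).trans h1⟩

/-- Extension by zero to `X`: the zero section fits the chain at both of its ends because the end
values vanish. -/
lemma exists_section_of_chain (hE : Z.IsGiesekerBundle n E)
    (e : ∀ k, (fiber (Z.p k)).obj E)
    (w : ∀ j, Γ((Scheme.Modules.pullback (Z.jR j)).obj E, ⊤))
    (hl : ∀ j, pval (Z.a_jR j) ⊤ memOpen_top (w j) = e j.castSucc)
    (hr : ∀ j, pval (Z.b_jR j) ⊤ memOpen_top (w j) = e j.succ) (h0 : e 0 = 0) (h1 : e (Fin.last n) = 0)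
    (V : Z.Z.Opens) : ∃ m : Γ(E, V), pb Z.jX V m = 0 ∧ ∀ j, pb (Z.jR j) V m = res le_top (w j) := by
  let ν : ∀ o, (components Y.X Z.a Z.b Z.a_str Z.b_str Z.a_ne_b o).C ⟶ Z.Z := inclusions Z.jX Z.jR
  let w' : ∀ o, Γ((Scheme.Modules.pullback (ν o)).obj E, ν o ⁻¹ᵁ V) :=
    fun | none => 0 | some j => res (U := (⊤ : P1.Opens)) le_top (w j)
  have hw : ∀ o, HasValues (components Y.X Z.a Z.b Z.a_str Z.b_str Z.a_ne_b o) (ν o) (Z.gluing.s_eq o) (Z.gluing.t_eq o) (e _) (e _) _ (w' o) := by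
    rintro (_ | j)
    · exact hasValues_zero Z.s_jX Z.t_jX h0 h1 _
    · exact hasValues_res
        (C := ⟨P1, P1.str, Z.a j, Z.b j, Z.a_str j, Z.b_str j, Z.a_ne_b j⟩) (Z.a_jR j) (Z.b_jR j)
        (hl j) (hr j) _
  obtain ⟨m, hm⟩ := Z.gluing.exists_section (U := V) hE.isVectorBundle w' e (fun o => (hw o).1)
    fun o => (hw o).2
  exact ⟨m, hm none, fun j => hm (some j)⟩

lemma pb_ext {r : ℕ} (hE : IsVectorBundle r E) {V : Z.Z.Opens} {m m' : Γ(E, V)}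
    (h : pb Z.jX V m = pb Z.jX V m') (h' : ∀ j, pb (Z.jR j) V m = pb (Z.jR j) V m') : m = m' :=
  Z.gluing.pb_injective hE fun | none => h | some j => h' j

/-- A compatible family of sections on the chain vanishing at its two ends gives a torsion section
of the direct image. -/
lemma IsGiesekerBundle.eq_zero (hE : Z.IsGiesekerBundle n E)
    (e : ∀ k, (fiber (Z.p k)).obj E)
    (w : ∀ j, Γ((Scheme.Modules.pullback (Z.jR j)).obj E, ⊤))
    (hl : ∀ j, pval (Z.a_jR j) ⊤ memOpen_top (w j) = e j.castSucc)
    (hr : ∀ j, pval (Z.b_jR j) ⊤ memOpen_top (w j) = e j.succ) (h0 : e 0 = 0) (h1 : e (Fin.last n) = 0)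
    (j : Fin n) : w j = 0 := by
  obtain ⟨U, hnode, f, hf0, hfn⟩ := Y.exists_function_eq_zero
  obtain ⟨m, hmX, hm⟩ := Z.exists_section_of_chain hE e w hl hr h0 h1 (Z.π ⁻¹ᵁ U)
  -- On `X` the section `m` is zero; on each line the function pulls back to its value at the node,
  -- which is zero.
  have hfm : pbF Z.π U f • m = 0 := by
    refine Z.pb_ext hE.isVectorBundle ?_ fun j => ?_
    · rw [map_zero, pb_smul, hmX, smul_zero]
    · have h3 : pbF (P1.str ≫ Y.node) U f = 0 := (congrArg (pbF P1.str _) hfn).trans (map_zero _)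
      have h2 : pbF (Z.jR j) _ (pbF Z.π U f) = 0 := by
        rw [← pbF_comp, pbF_congr (Z.jR_π j), h3]
        exact map_zero _
      rw [map_zero, pb_smul, h2, zero_smul]
  have hm0 : m = 0 := hE.isTorsionFree U f m hf0 hfm
  -- Each line is contracted to the node, so it lies entirely over `U`.
  have htop : (⊤ : P1.Opens) ≤ Z.jR j ⁻¹ᵁ Z.π ⁻¹ᵁ U := by
    change ⊤ ≤ (Z.jR j ≫ Z.π) ⁻¹ᵁ U
    rw [Z.jR_π]
    exact fun x _ => hnode (x := P1.str x) trivial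
  have h3 := congrArg (res htop) (hm j)
  rwa [res_res, res_self, hm0, map_zero, map_zero, eq_comm] at h3

/-- Strict positivity gives the statements about the evaluations, local frames give the dimension
`n`, and torsion-freeness kills the families vanishing at both ends. -/
lemma IsGiesekerBundle.isGiesekerChain (hE : Z.IsGiesekerBundle n E) :
    IsGiesekerChain (E := fun k => (fiber (Z.p k)).obj E) (H := fun j => Z.sections E j)
      (fun j => (Z.evalLeft E j).hom) (fun j => (Z.evalRight E j).hom) where
  surjective_left j y :=
    ((hE.isStrictlyPositive j).surjective_pval (Z.a_jR j) (Z.a_str j) y).imp fun m hm =>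
      (Z.evalLeft_apply j m).trans hm
  surjective_right j y :=
    ((hE.isStrictlyPositive j).surjective_pval (Z.b_jR j) (Z.b_str j) y).imp fun m hm =>
      (Z.evalRight_apply j m).trans hm
  ker_left j h := by
    obtain ⟨m, hm, hm0⟩ := (hE.isStrictlyPositive j).exists_val_eq_zero (Z.a_str j)
    refine hm ((Submodule.eq_bot_iff _).1 h m ?_)
    exact (Z.evalLeft_apply j m).trans ((pval_eq_zero_iff _ _ m).2 hm0)
  finite k := by
    obtain ⟨U, hU, e, he⟩ := hE.isVectorBundle (Z.p k pt₀)
    exact Module.Finite.of_basis (he.fiberBasis (Z.p k) (memOpen_iff_mem.2 hU))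
  finrank_eq k := by
    obtain ⟨U, hU, e, he⟩ := hE.isVectorBundle (Z.p k pt₀)
    rw [Module.finrank_eq_card_basis (he.fiberBasis (Z.p k) (memOpen_iff_mem.2 hU)),
      Fintype.card_fin]
  eq_zero x hx h0 h1 := by
    have hx2 : x.2 = 0 := funext fun j => hE.eq_zero Z x.1 x.2
      (fun j => (Z.evalLeft_apply j _).symm.trans (hx j trivial).1)
      (fun j => (Z.evalRight_apply j _).symm.trans (hx j trivial).2) h0 h1 j
    refine Prod.ext (funext fun k => ?_) hx2
    induction k using Fin.lastCases with
    | last => exact h1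
    | cast j =>
      refine (hx j trivial).1.symm.trans ?_
      rw [hx2]
      exact map_zero _

end GiesekerCurve

end Gieseker

end

/-! ### From isomorphic parabolic triples to equivalent bundles -/

noncomputable section

namespace Gieseker

open TopologicalSpace Opposite

section Chain

variable {n : ℕ} {E : Fin (n + 1) → Type} {H : Fin n → Type}
  [∀ k, AddCommGroup (E k)] [∀ k, Module ℂ (E k)] [∀ j, AddCommGroup (H j)] [∀ j, Module ℂ (H j)]
  (l : ∀ j, H j →ₗ[ℂ] E j.castSucc) (r : ∀ j, H j →ₗ[ℂ] E j.succ)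

/-- The flag `F` of a triple records only transports from vertices with positive index; this
supplies the remaining one. -/
lemma chainLeft_zero_zero (hn : 0 < n) : chainLeft l r 0 0 = ⊥ := by
  obtain ⟨n, rfl⟩ := Nat.exists_eq_succ_of_ne_zero hn.ne'
  exact (chainLeft_castSucc l r 0 0).trans (if_neg (Fin.not_le.2 (Fin.succ_pos 0)))

lemma chainRight_last_last (hn : 0 < n) : chainRight l r (Fin.last n) (Fin.last n) = ⊥ := by
  obtain ⟨n, rfl⟩ := Nat.exists_eq_succ_of_ne_zero hn.ne'
  exact (chainRight_succ l r (Fin.last _) (Fin.last n)).trans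
    (if_neg (Fin.not_le.2 (Fin.castSucc_lt_last _)))

end Chain

section Fibers

variable {S T : Scheme.{0}} {s : pt ⟶ S} {t : pt ⟶ T} {f : T ⟶ S} {M M' : S.Modules}

/-- The isomorphism of fibres at the image point induced by an isomorphism of pullbacks. -/
def fiberIso (h : t ≫ f = s)
    (ψ : (Scheme.Modules.pullback f).obj M ≅ (Scheme.Modules.pullback f).obj M') :
    (fiber s).obj M ≃ₗ[ℂ] (fiber s).obj M' :=
  ((fiberPullback f t s h M).symm ≪≫ (fiber t).mapIso ψ ≪≫ fiberPullback f t s h M').toLinearEquiv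

lemma fiberIso_fiberPullback (h : t ≫ f = s)
    (ψ : (Scheme.Modules.pullback f).obj M ≅ (Scheme.Modules.pullback f).obj M')
    (x : (fiber t).obj ((Scheme.Modules.pullback f).obj M)) :
    fiberIso h ψ ((fiberPullback f t s h M).hom x) =
      (fiberPullback f t s h M').hom ((fiber t).map ψ.hom x) :=
  congrArg (fun z => (fiberPullback f t s h M').hom ((fiber t).map ψ.hom z))
    ((fiberPullback f t s h M).toLinearEquiv.symm_apply_apply x)

lemma pval_iso (h : t ≫ f = s)
    (ψ : (Scheme.Modules.pullback f).obj M ≅ (Scheme.Modules.pullback f).obj M') {V : T.Opens}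
    (hV : MemOpen t V) (m : Γ((Scheme.Modules.pullback f).obj M, V)) :
    pval h V hV (ψ.hom.app V m) = fiberIso h ψ (pval h V hV m) := by
  rw [pval_apply, pval_apply, fiberIso_fiberPullback, fiber_map_val]

lemma mem_iff_fiberIso_mem (h : t ≫ f = s)
    (ψ : (Scheme.Modules.pullback f).obj M ≅ (Scheme.Modules.pullback f).obj M')
    {F : Submodule ℂ ((fiber s).obj M)} {F' : Submodule ℂ ((fiber s).obj M')}
    (hF : (F.comap (fiberPullback f t s h M).hom.hom).map ((fiber t).map ψ.hom).hom =
      F'.comap (fiberPullback f t s h M').hom.hom) (y : (fiber s).obj M) :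
    y ∈ F ↔ fiberIso h ψ y ∈ F' := by
  obtain ⟨x, rfl⟩ := (fiberPullback f t s h M).toLinearEquiv.surjective y
  have h1 : fiberIso h ψ ((fiberPullback f t s h M).toLinearEquiv x) =
    (fiberPullback f t s h M').hom ((fiber t).map ψ.hom x) := fiberIso_fiberPullback h ψ x
  rw [h1]
  change x ∈ F.comap (fiberPullback f t s h M).hom.hom ↔
    (fiber t).map ψ.hom x ∈ F'.comap (fiberPullback f t s h M').hom.hom
  rw [← hF]
  exact (((fiber t).mapIso ψ).toLinearEquiv.injective.mem_set_image
    (s := ((F.comap (fiberPullback f t s h M).hom.hom : Submodule ℂ _) : Set _))).symm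

end Fibers

/-- Version of `exists_semiHom` for pullbacks, with values in the fibres at the image points. -/
lemma exists_semiHom_pval {S : Scheme.{0}} {E E' : S.Modules} {f : P1 ⟶ S} {r : ℕ}
    {s t : pt ⟶ P1} {s' t' : pt ⟶ S} (hs' : s ≫ f = s') (ht' : t ≫ f = t') (hst : s ≠ t)
    (hs : s ≫ P1.str = 𝟙 pt) (ht : t ≫ P1.str = 𝟙 pt)
    (hE : IsStrictlyPositive r ((Scheme.Modules.pullback f).obj E))
    (hE' : IsStrictlyPositive r ((Scheme.Modules.pullback f).obj E'))
    (hl : IsLinked s t ((Scheme.Modules.pullback f).obj E))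
    (hl' : IsLinked s t ((Scheme.Modules.pullback f).obj E'))
    (g : H0 P1.str ((Scheme.Modules.pullback f).obj E) ≃ₗ[ℂ]
      H0 P1.str ((Scheme.Modules.pullback f).obj E'))
    (fs : (fiber s').obj E ≃ₗ[ℂ] (fiber s').obj E') (ft : (fiber t').obj E ≃ₗ[ℂ] (fiber t').obj E')
    (hfs : ∀ m, fs (pval hs' ⊤ memOpen_top m) = pval hs' ⊤ memOpen_top (g m))
    (hft : ∀ m, ft (pval ht' ⊤ memOpen_top m) = pval ht' ⊤ memOpen_top (g m)) :
    ∃ φ : P1 ≅ P1, φ.hom ≫ P1.str = P1.str ∧ s ≫ φ.hom = s ∧ t ≫ φ.hom = t ∧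
      ∃ θ : SemiHom φ.hom ((Scheme.Modules.pullback f).obj E) ((Scheme.Modules.pullback f).obj E'),
        (∀ W, Function.Bijective (θ.app W)) ∧
        (∀ W h h' m, pval hs' (φ.hom ⁻¹ᵁ W) h' (θ.app W m) = fs (pval hs' W h m)) ∧
        (∀ W h h' m, pval ht' (φ.hom ⁻¹ᵁ W) h' (θ.app W m) = ft (pval ht' W h m)) := by
  let A := fun M => (fiberPullback f s s' hs' M).toLinearEquiv
  let B := fun M => (fiberPullback f t t' ht' M).toLinearEquiv
  let g' : Γ((Scheme.Modules.pullback f).obj E, ⊤) ≃+ Γ((Scheme.Modules.pullback f).obj E', ⊤) :=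
    g.toAddEquiv
  have hg : ∀ c (m : Γ((Scheme.Modules.pullback f).obj E, ⊤)),
      g' (const P1.str ⊤ c • m) = const P1.str ⊤ c • g' m := fun c m =>
    (congrArg g (H0_smul P1.str _ c m)).symm.trans
      ((g.map_smul c m).trans (H0_smul P1.str _ c (g' m)))
  obtain ⟨φ, hφ, hφs, hφt, θ, hθ, hθs, hθt⟩ := exists_semiHom hst hs ht hE hE' hl hl' g' hg
    (A E ≪≫ₗ fs ≪≫ₗ (A E').symm) (B E ≪≫ₗ ft ≪≫ₗ (B E').symm)
    (fun m => (A E').symm_apply_eq.2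
      ((congrArg fs (pval_apply hs' memOpen_top m)).symm.trans
        ((hfs m).trans (pval_apply hs' memOpen_top (g m)))))
    (fun m => (B E').symm_apply_eq.2
      ((congrArg ft (pval_apply ht' memOpen_top m)).symm.trans
        ((hft m).trans (pval_apply ht' memOpen_top (g m)))))
  refine ⟨φ, hφ, hφs, hφt, θ, hθ, fun W h h' m => ?_, fun W h h' m => ?_⟩
  · rw [pval_apply, pval_apply]
    exact (congrArg (A E') (hθs W h h' m)).trans ((A E').apply_symm_apply _)
  · rw [pval_apply, pval_apply]
    exact (congrArg (B E') (hθt W h h' m)).trans ((B E').apply_symm_apply _)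

/-- A morphism of modules as a map over the identity. -/
def SemiHom.ofHom {S : Scheme.{0}} {M N : S.Modules} (ψ : M ⟶ N) : SemiHom (𝟙 S) M N where
  app V := (ψ.app V).hom
  app_smul _ g m := Scheme.Modules.Hom.app_smul ψ g m
  app_res h m := Gieseker.app_res ψ h m

lemma SemiHom.bijective_ofHom {S : Scheme.{0}} {M N : S.Modules} (ψ : M ≅ N) (W : S.Opens) :
    Function.Bijective ((SemiHom.ofHom ψ.hom).app W) :=
  (ConcreteCategory.isIso_iff_bijective (ψ.hom.app W)).1
    (Scheme.Modules.Hom.isIso_iff_isIso_app.1 inferInstance W)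

lemma ParabolicTriple.Isomorphic.symm {X : TwoPointed} {n : ℕ} {T T' : ParabolicTriple X n}
    (h : T.Isomorphic T') : T'.Isomorphic T := by
  obtain ⟨ψ, hF, hG⟩ := h
  refine ⟨ψ.symm, fun i => ?_, fun i => ?_⟩
  · rw [← hF, ← Submodule.map_comp, ← ModuleCat.hom_comp, ← Functor.map_comp, Iso.symm_hom,
      Iso.hom_inv_id, CategoryTheory.Functor.map_id, ModuleCat.hom_id, Submodule.map_id]
  · rw [← hG, ← Submodule.map_comp, ← ModuleCat.hom_comp, ← Functor.map_comp, Iso.symm_hom,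
      Iso.hom_inv_id, CategoryTheory.Functor.map_id, ModuleCat.hom_id, Submodule.map_id]

/-- Gluing of isomorphisms of the components and of the restricted bundles. -/
lemma IsNodalGluing.exists_iso {ι K : Type} [Finite ι] {C : ι → TwoPointed} {σ τ : ι → K}
    {Z : Scheme.{0}} {ν : ∀ i, (C i).C ⟶ Z} {p : K → (pt ⟶ Z)} (G : IsNodalGluing C σ τ ν p)
    (hp : ∀ k l, p k pt₀ = p l pt₀ → k = l) {E E' : Z.Modules} {r : ℕ} (hE : IsVectorBundle r E)
    (hE' : IsVectorBundle r E') (f : ∀ k, (fiber (p k)).obj E ≃ₗ[ℂ] (fiber (p k)).obj E')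
    (φ : ∀ i, (C i).C ≅ (C i).C) (hφs : ∀ i, (C i).s ≫ (φ i).hom = (C i).s)
    (hφt : ∀ i, (C i).t ≫ (φ i).hom = (C i).t)
    (θ : ∀ i, SemiHom (φ i).hom ((Scheme.Modules.pullback (ν i)).obj E)
      ((Scheme.Modules.pullback (ν i)).obj E'))
    (hθ : ∀ i W, Function.Bijective ((θ i).app W))
    (hs : ∀ i W (h : MemOpen (C i).s W) (h' : MemOpen (C i).s ((φ i).hom ⁻¹ᵁ W)) m,
      pval (G.s_eq i) ((φ i).hom ⁻¹ᵁ W) h' ((θ i).app W m) = f _ (pval (G.s_eq i) W h m))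
    (ht : ∀ i W (h : MemOpen (C i).t W) (h' : MemOpen (C i).t ((φ i).hom ⁻¹ᵁ W)) m,
      pval (G.t_eq i) ((φ i).hom ⁻¹ᵁ W) h' ((θ i).app W m) = f _ (pval (G.t_eq i) W h m)) :
    ∃ Φ : Z ≅ Z, (∀ i, ν i ≫ Φ.hom = (φ i).hom ≫ ν i) ∧
      Nonempty (E' ≅ (Scheme.Modules.pullback Φ.hom).obj E) := by
  -- The automorphisms of the components fix the marked points, so they and their inverses descend
  -- to `Z`, fixing the nodes.
  obtain ⟨Φ, hΦ⟩ := G.exists_desc hp (fun i => (φ i).hom ≫ ν i) p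
    (fun i => by rw [reassoc_of% (hφs i), G.s_eq]) (fun i => by rw [reassoc_of% (hφt i), G.t_eq])
  obtain ⟨Ψ, hΨ⟩ := G.exists_desc hp (fun i => (φ i).inv ≫ ν i) p
    (fun i => by rw [← Category.assoc, (Iso.eq_comp_inv (φ i)).2 (hφs i) |>.symm, G.s_eq])
    (fun i => by rw [← Category.assoc, (Iso.eq_comp_inv (φ i)).2 (hφt i) |>.symm, G.t_eq])
  obtain ⟨e, rfl⟩ : ∃ e : Z ≅ Z, e.hom = Φ := ⟨⟨Φ, Ψ, G.hom_ext fun i => by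
      rw [reassoc_of% (hΦ i), hΨ, Iso.hom_inv_id_assoc, Category.comp_id],
    G.hom_ext fun i => by
      rw [reassoc_of% (hΨ i), hΦ, Iso.inv_hom_id_assoc, Category.comp_id]⟩, rfl⟩
  obtain ⟨ε⟩ := G.exists_iso_pushforward hE hE' e.hom (fun i => (φ i).hom) hΦ hφs hφt θ hθ f hs ht
  exact ⟨e, hΦ, nonempty_pullback_iso e.hom ε⟩

/-! ### Assembling the isomorphism over the Gieseker curve -/

namespace GiesekerCurve

variable {Y : NodalCurve} {n : ℕ} (Z : GiesekerCurve Y n) {E E' : Z.Z.Modules}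

lemma p_π (k : Fin (n + 1)) : Z.p k ≫ Z.π = Y.node := by
  induction k using Fin.cases with
  | zero => rw [← Z.s_jX, Category.assoc, Z.jX_π]; exact Y.gluing.s_eq ()
  | succ j => rw [← Z.b_jR, Category.assoc, Z.jR_π, reassoc_of% (Z.b_str j)]

/-- Labels are distinguished by `ℂ`-points, while descent needs distinct topological points. All
nodes are sections of the same structure morphism, so `point_ext` connects the two. -/
lemma p_pt₀_injective (k l : Fin (n + 1)) (h : Z.p k pt₀ = Z.p l pt₀) : k = l := by
  have hn : Y.node ≫ Y.str = 𝟙 pt := by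
    rw [← show Y.X.s ≫ Y.q = Y.node from Y.gluing.s_eq (), Category.assoc, Y.q_str, Y.X.s_str]
  refine Z.gluing.p_injective (point_ext (Z.π ≫ Y.str) ?_ ?_ h)
  · rw [reassoc_of% (Z.p_π k), hn]
  · rw [reassoc_of% (Z.p_π l), hn]

/-- The kernels of both evaluations are lines by the dimension count along the whole chain; a single
line alone would not give this. -/
lemma IsGiesekerBundle.isLinked (hE : Z.IsGiesekerBundle n E) (j : Fin n) :
    IsLinked (Z.a j) (Z.b j) ((Scheme.Modules.pullback (Z.jR j)).obj E) := by
  have hl : ∀ m : Z.sections E j, val (Z.a j) ⊤ memOpen_top m = 0 ↔ (Z.evalLeft E j).hom m = 0 :=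
    fun m => (pval_eq_zero_iff (Z.a_jR j) _ m).symm.trans
      (Eq.congr_left (Z.evalLeft_apply j m)).symm
  have hr : ∀ m : Z.sections E j, val (Z.b j) ⊤ memOpen_top m = 0 ↔ (Z.evalRight E j).hom m = 0 :=
    fun m => (pval_eq_zero_iff (Z.b_jR j) _ m).symm.trans
      (Eq.congr_left (Z.evalRight_apply j m)).symm
  have key : ∀ (K : Submodule ℂ (Z.sections E j)), Module.finrank ℂ K = 1 → ∀ m ∈ K, ∀ m' ∈ K,
      m ≠ 0 → ∃ c : ℂ, m' = c • m := by
    intro K hK m hm m' hm' h0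
    obtain ⟨c, hc⟩ := (finrank_eq_one_iff_of_nonzero' (⟨m, hm⟩ : K)
      (fun h => h0 (congrArg Subtype.val h))).1 hK ⟨m', hm'⟩
    exact ⟨c, (congrArg Subtype.val hc).symm⟩
  have hC := hE.isGiesekerChain
  refine ⟨fun m h1 h2 => hC.eq_zero_of_link ((hl m).1 h1) ((hr m).1 h2), fun m m' h1 h2 h0 => ?_,
    fun m m' h1 h2 h0 => ?_⟩
  · exact (key _ (hC.finrank_ker_left j) m ((hl m).1 h1) m' ((hl m').1 h2) h0).imp fun c hc =>
      hc.trans (H0_smul P1.str _ c m)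
  · exact (key _ (hC.finrank_ker_right j) m ((hr m).1 h1) m' ((hr m').1 h2) h0).imp fun c hc =>
      hc.trans (H0_smul P1.str _ c m)

/-- An isomorphism of parabolic triples extends to the nodes and to the sections on the chain. -/
lemma exists_chain_iso (hn : 0 < n) (hE : Z.IsGiesekerBundle n E) (hE' : Z.IsGiesekerBundle n E')
    (ψ : (Scheme.Modules.pullback Z.jX).obj E ≅ (Scheme.Modules.pullback Z.jX).obj E')
    (hF : ∀ i, ((Z.parabolicTriple E).F i).map ((fiber Y.X.s).map ψ.hom).hom =
      (Z.parabolicTriple E').F i)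
    (hG : ∀ i, ((Z.parabolicTriple E).G i).map ((fiber Y.X.t).map ψ.hom).hom =
      (Z.parabolicTriple E').G i) :
    ∃ (f : ∀ k, (fiber (Z.p k)).obj E ≃ₗ[ℂ] (fiber (Z.p k)).obj E')
      (g : ∀ j, Z.sections E j ≃ₗ[ℂ] Z.sections E' j),
      f 0 = fiberIso Z.s_jX ψ ∧ f (Fin.last n) = fiberIso Z.t_jX ψ ∧
      ∀ j x, f j.castSucc ((Z.evalLeft E j).hom x) = (Z.evalLeft E' j).hom (g j x) ∧
        f j.succ ((Z.evalRight E j).hom x) = (Z.evalRight E' j).hom (g j x) := by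
  refine hE.isGiesekerChain.exists_iso hE'.isGiesekerChain _ _ (fun i y => ?_) fun i y => ?_
  · induction i using Fin.cases with
    | zero =>
      rw [chainLeft_zero_zero _ _ hn, chainLeft_zero_zero _ _ hn]
      exact ((fiberIso Z.s_jX ψ).map_eq_zero_iff).symm
    | succ i =>
      -- `F i` is the transport from the vertex `i.rev.succ`, so the reversed index reaches every
      -- positive vertex. The recursions `transportLeft` and `chainLeft` agree by unfolding.
      obtain ⟨i, rfl⟩ := Fin.rev_surjective i
      exact mem_iff_fiberIso_mem Z.s_jX ψ (hF i) y
  · induction i using Fin.lastCases with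
    | last =>
      rw [chainRight_last_last _ _ hn, chainRight_last_last _ _ hn]
      exact ((fiberIso Z.t_jX ψ).map_eq_zero_iff).symm
    | cast i => exact mem_iff_fiberIso_mem Z.t_jX ψ (hG i) y

/-- The isomorphisms `fs` and `ft` of fibres extend to an isomorphism of the restrictions of `E` and
`E'` to a component, over an automorphism of the component. -/
def ExtendsOver {S T : Scheme.{0}} (C : TwoPointed) (ν : C.C ⟶ S) (π : S ⟶ T) (E E' : S.Modules)
    {s t : pt ⟶ S} (hs : C.s ≫ ν = s) (ht : C.t ≫ ν = t)
    (fs : (fiber s).obj E ≃ₗ[ℂ] (fiber s).obj E') (ft : (fiber t).obj E ≃ₗ[ℂ] (fiber t).obj E') :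
    Prop :=
  ∃ φ : C.C ≅ C.C, C.s ≫ φ.hom = C.s ∧ C.t ≫ φ.hom = C.t ∧ φ.hom ≫ ν ≫ π = ν ≫ π ∧
    ∃ θ : SemiHom φ.hom ((Scheme.Modules.pullback ν).obj E) ((Scheme.Modules.pullback ν).obj E'),
      (∀ W, Function.Bijective (θ.app W)) ∧
      (∀ W h h' m, pval hs (φ.hom ⁻¹ᵁ W) h' (θ.app W m) = fs (pval hs W h m)) ∧
      (∀ W h h' m, pval ht (φ.hom ⁻¹ᵁ W) h' (θ.app W m) = ft (pval ht W h m))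

/-- On `X` the isomorphism of triples itself is used, over the identity. -/
lemma extendsOver_X (ψ : (Scheme.Modules.pullback Z.jX).obj E ≅ (Scheme.Modules.pullback Z.jX).obj E') :
    ExtendsOver Y.X Z.jX Z.π E E' Z.s_jX Z.t_jX (fiberIso Z.s_jX ψ) (fiberIso Z.t_jX ψ) :=
  ⟨Iso.refl _, Category.comp_id _, Category.comp_id _, Category.id_comp _,
    SemiHom.ofHom ψ.hom, SemiHom.bijective_ofHom ψ, fun _ h _ m => pval_iso Z.s_jX ψ h m,
    fun _ h _ m => pval_iso Z.t_jX ψ h m⟩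

lemma extendsOver_P1 (hE : Z.IsGiesekerBundle n E) (hE' : Z.IsGiesekerBundle n E') (j : Fin n)
    (fs : (fiber (Z.p j.castSucc)).obj E ≃ₗ[ℂ] (fiber (Z.p j.castSucc)).obj E')
    (ft : (fiber (Z.p j.succ)).obj E ≃ₗ[ℂ] (fiber (Z.p j.succ)).obj E')
    (g : Z.sections E j ≃ₗ[ℂ] Z.sections E' j)
    (hfs : ∀ x, fs ((Z.evalLeft E j).hom x) = (Z.evalLeft E' j).hom (g x))
    (hft : ∀ x, ft ((Z.evalRight E j).hom x) = (Z.evalRight E' j).hom (g x)) :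
    ExtendsOver ⟨P1, P1.str, Z.a j, Z.b j, Z.a_str j, Z.b_str j, Z.a_ne_b j⟩ (Z.jR j) Z.π E E'
      (Z.a_jR j) (Z.b_jR j) fs ft := by
  obtain ⟨φ, hφ, hφs, hφt, h⟩ := exists_semiHom_pval (Z.a_jR j) (Z.b_jR j) (Z.a_ne_b j)
    (Z.a_str j) (Z.b_str j) (hE.isStrictlyPositive j) (hE'.isStrictlyPositive j)
    (hE.isLinked Z j) (hE'.isLinked Z j) g fs ft
    (fun m => (congrArg fs (Z.evalLeft_apply j m)).symm.trans
      ((hfs m).trans (Z.evalLeft_apply j _)))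
    (fun m => (congrArg ft (Z.evalRight_apply j m)).symm.trans
      ((hft m).trans (Z.evalRight_apply j _)))
  exact ⟨φ, hφs, hφt, by rw [Z.jR_π]; exact (Category.assoc _ _ _).symm.trans (congrArg (· ≫ Y.node) hφ), h⟩

/-- The isomorphism of parabolic triples is induced by isomorphisms over the components which agree
at the nodes. -/
lemma exists_components_iso (hn : 0 < n) (hE : Z.IsGiesekerBundle n E)
    (hE' : Z.IsGiesekerBundle n E')
    (h : (Z.parabolicTriple E).Isomorphic (Z.parabolicTriple E')) :
    ∃ f : ∀ k, (fiber (Z.p k)).obj E ≃ₗ[ℂ] (fiber (Z.p k)).obj E', ∀ o,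
      ExtendsOver (components Y.X Z.a Z.b Z.a_str Z.b_str Z.a_ne_b o) (inclusions Z.jX Z.jR o) Z.π
        E E' (Z.gluing.s_eq o) (Z.gluing.t_eq o) (f _) (f _) := by
  obtain ⟨ψ, hF, hG⟩ := h
  obtain ⟨f, g, hf0, hf1, hfg⟩ := Z.exists_chain_iso hn hE hE' ψ hF hG
  refine ⟨f, fun | none => ?_ | some j => ?_⟩
  · have := Z.extendsOver_X ψ
    rwa [← hf0, ← hf1] at this
  · exact Z.extendsOver_P1 hE hE' j (f j.castSucc) (f j.succ) (g j) (fun x => (hfg j x).1)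
      fun x => (hfg j x).2

/-- The parabolic triple determines the equivalence class of a Gieseker bundle. -/
theorem equivalent_of_isomorphic (hn : 0 < n) (hE : Z.IsGiesekerBundle n E)
    (hE' : Z.IsGiesekerBundle n E')
    (h : (Z.parabolicTriple E).Isomorphic (Z.parabolicTriple E')) : Equivalent Z E Z E' := by
  -- The bundles are exchanged because gluing maps out of the first bundle exhibits the second as a
  -- pullback of the first, while equivalence asks for `E` as a pullback of `E'`.
  obtain ⟨f, hf⟩ := Z.exists_components_iso hn hE' hE h.symm
  choose φ hφs hφt hφπ θ hθ hs ht using hf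
  obtain ⟨Φ, hΦ, e⟩ := Z.gluing.exists_iso Z.p_pt₀_injective hE'.isVectorBundle hE.isVectorBundle f
    φ hφs hφt θ hθ hs ht
  refine ⟨Φ, Z.gluing.hom_ext fun o => ?_, e⟩
  rw [reassoc_of% (hΦ o), hφπ]

end GiesekerCurve

end Gieseker

end

theorem mainTheorem4 (n : ℕ) (hn : 0 < n) (Y : Gieseker.NodalCurve)
    (Z : Gieseker.GiesekerCurve Y n) (E E' : Z.Z.Modules)
    (hE : Z.IsGiesekerBundle n E) (hE' : Z.IsGiesekerBundle n E')
    (h : (Z.parabolicTriple E).Isomorphic (Z.parabolicTriple E')) :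
    Gieseker.GiesekerCurve.Equivalent Z E Z E' := by
  exact Z.equivalent_of_isomorphic hn hE hE' h
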